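/- **Setting.** There is a set $X$ of $n$ agents. Agent $i$ has a utility function $u_i(S)\in[0,1]$ for $S\subseteq X\setminus\{i\}$ with $u_i(\emptyset)=0$ and $u_i(T)\le u_i(S)$ for $T\subseteq S$, scaled so that $\max_i u_i(X\setminus\{i\})=1$. A utility sharing rule assigns to each $j\in S$ a share $h_{ij}(S)$ with $\sum_{j\in S}h_{ij}(S)=u_i(S)$. It is *cross-monotonic* if $h_{ij}(T)\ge h_{ij}(S)$ whenever $j\in T\subseteq S$. The *Shapley value* rule lets $h_{ij}(S)$ be the average, over all orders of $S$, of $u_i(W\cup\{j\})-u_i(W)$, where $W$ is the set of agents of $S$ before $j$. Utilities are *submodular* if $u_i(S\cup\{q\})-u_i(S)\le u_i(T\cup\{q\})-u_i(T)$ for $T\subseteq S$, $q\notin S$. In the *symmetric weighted* setting there are sizes $s_{ij}\ge 0$ and concave, non-decreasing, non-negative functions $f_i$ on $[0,\infty)$ with $u_i(S)=f_i(\sum_{j\in S}s_{ij})$; *proportional sharing* with $w_{ij}=s_{ij}$ means $h_{ij}(S)=\frac{s_{ij}}{\sum_{k\in S}s_{ik}}u_i(S)$ (read as $0$ if the denominator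 is $0$). For $\varepsilon\ge0$, an $\varepsilon$-*balanced solution* consists of numbers $x_{iS}\ge0$ ($i\in X$, $S\subseteq X\setminus\{i\}$) with $\sum_S x_{iS}\le1$ for every $i$ and $$\Bigl|\sum_S\sum_{j\in S}h_{ij}(S)x_{iS}-\sum_j\sum_{S\ni i}h_{ji}(S)x_{jS}\Bigr|\le\varepsilon\qquad\text{for all } i .$$ Its *social welfare* is $\sum_i\sum_S u_i(S)x_{iS}$. Solutions are *feasible* (exactly balanced) if $\varepsilon=0$. An algorithm is given $n$ and $\varepsilon\in(0,1)$, and it accesses the utilities and the shares only by calling a subroutine that, for given $i$, $S\subseteq X\setminus\{i\}$ and $j\in S$, returns $u_i(S)$ or $h_{ij}(S)$. It outputs a list of the non-zero $x_{iS}$ (repeated entries are added). It *runs in polynomial time* if the number of its steps, counting subroutine calls and arithmetic operations and comparisons of real numbers, is bounded by a fixed polynomial in $n$ and $1/\varepsilon$, and if, whenever $\varepsilon$ and all utilities and shares are rational numbers of at most $b$ bits, its running time, with arithmetic operations charged for the bits of the numbers involved, is bounded by a fixed polynomial in $n$, $1/\varepsilon$ and $b$. **Theorem.** 1. There are an absolute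 constant $C>0$ and a polynomial-time algorithm which, for all monotone utilities and all cross-monotonic sharing rules, and also for all monotone submodular utilities with the Shapley value rule, finds for each $\varepsilon\in(0,1)$ an $\varepsilon$-balanced solution whose social welfare is at least $\frac{1}{C\log n}$ times that of every $\varepsilon$-balanced solution, in particular of every feasible solution. 2. There is a polynomial-time algorithm which, in the symmetric weighted setting with proportional sharing and $w_{ij}=s_{ij}$, finds for each $\varepsilon\in(0,1)$ an $\varepsilon$-balanced solution whose social welfare is at least $\frac{1}{1+\varepsilon}$ times that of every $\varepsilon$-balanced solution, in particular of every feasible solution. -/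

import Mathlib

open scoped BigOperators

noncomputable section

namespace DataExchange

/-! ## Markets, utilities and sharing rules -/

/-- The data of a market with agents `X = Fin n`. Agent `i` gets utility `u i S` from the datasets
of a set `S ⊆ X \ {i}` of agents, of which `h i j S` is attributed to `j ∈ S`.
The values of `u i S` with `i ∈ S` and of `h i j S` with `i ∈ S` or `j ∉ S` have no meaning and are
never used. -/
structure Market (n : ℕ) where
  u : Fin n → Finset (Fin n) → ℝ
  h : Fin n → Fin n → Finset (Fin n) → ℝ

variable {n : ℕ}

/-- The standing assumptions: utilities lie in `[0, 1]`, vanish on the empty set, are monotone, and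
are scaled so that `max_i u_i(X \ {i}) = 1`; the shares of the members of `S` add up to `u_i(S)`. -/
structure Market.Valid (M : Market n) : Prop where
  nonneg : ∀ i S, i ∉ S → 0 ≤ M.u i S
  le_one : ∀ i S, i ∉ S → M.u i S ≤ 1
  empty : ∀ i, M.u i ∅ = 0
  scaled : ∃ i, M.u i (Finset.univ.erase i) = 1
  mono : ∀ i S T, i ∉ S → T ⊆ S → M.u i T ≤ M.u i S
  sharing : ∀ i S, i ∉ S → ∑ j ∈ S, M.h i j S = M.u i S

/-- Diminishing returns. -/
def Market.Submodular (M : Market n) : Prop :=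
  ∀ i S T q, i ∉ S → T ⊆ S → q ≠ i → q ∉ S →
    M.u i (insert q S) - M.u i S ≤ M.u i (insert q T) - M.u i T

/-- A larger set of contributors never increases the share of one of its members. -/
def Market.CrossMonotonic (M : Market n) : Prop :=
  ∀ i S T j, i ∉ S → T ⊆ S → j ∈ T → M.h i j S ≤ M.h i j T

/-- The agents of `S` that precede `j` in the order `σ` of `S`. -/
def predecessors (S : Finset (Fin n)) (σ : S ≃ Fin S.card) (j : S) : Finset (Fin n) :=
  (Finset.univ.filter fun k : S => σ k < σ j).map (Function.Embedding.subtype _)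

/-- The Shapley value of `j ∈ S` for the set function `v`: the average, over all orders of `S`, of
the increase of `v` when `j` joins the agents before it. -/
def shapley (v : Finset (Fin n) → ℝ) (S : Finset (Fin n)) (j : S) : ℝ :=
  (∑ σ : S ≃ Fin S.card,
    (v (insert (j : Fin n) (predecessors S σ j)) - v (predecessors S σ j))) / (S.card.factorial : ℝ)

/-- Utility is shared by the Shapley value. -/
def Market.IsShapley (M : Market n) : Prop :=
  ∀ (i : Fin n) (S : Finset (Fin n)), i ∉ S → ∀ j : S, M.h i j S = shapley (M.u i) S j

/-- Utility is shared in proportion to fixed weights `w i j`. -/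
def Market.IsProportional (M : Market n) (w : Fin n → Fin n → ℝ) : Prop :=
  ∀ i S, i ∉ S → ∀ j ∈ S, M.h i j S = w i j / (∑ k ∈ S, w i k) * M.u i S

/-- The symmetric weighted setting with dataset sizes `s i j`: the utility of `i` is a concave
non-decreasing non-negative function of the total size of the datasets that `i` receives. -/
def Market.IsSymmetricWeighted (M : Market n) (s : Fin n → Fin n → ℝ) : Prop :=
  (∀ i j, 0 ≤ s i j) ∧
  ∃ f : Fin n → ℝ → ℝ, ∀ i,
    ConcaveOn ℝ (Set.Ici 0) (f i) ∧ MonotoneOn (f i) (Set.Ici 0) ∧ (∀ t, 0 ≤ t → 0 ≤ f i t) ∧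
    ∀ S, i ∉ S → M.u i S = f i (∑ j ∈ S, s i j)

/-- Markets with monotone utilities and a cross-monotonic sharing rule, including those with
submodular utilities and the Shapley value. -/
def CrossMonotonicMarket (n : ℕ) (M : Market n) : Prop :=
  M.Valid ∧ (M.CrossMonotonic ∨ (M.Submodular ∧ M.IsShapley))

/-- Symmetric weighted markets with proportional sharing and weights `w i j = s i j`. -/
def SymmetricMarket (n : ℕ) (M : Market n) : Prop :=
  M.Valid ∧ ∃ s : Fin n → Fin n → ℝ, M.IsSymmetricWeighted s ∧ M.IsProportional s

/-! ## Solutions -/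

/-- The sets that agent `i` can receive. -/
def bundles (i : Fin n) : Finset (Finset (Fin n)) := (Finset.univ.erase i).powerset

/-- The expected utility that `i` receives under the distributions `x`. -/
def received (M : Market n) (x : Fin n → Finset (Fin n) → ℝ) (i : Fin n) : ℝ :=
  ∑ S ∈ bundles i, ∑ j ∈ S, M.h i j S * x i S

/-- The expected utility that `i` contributes to the other agents. -/
def contributed (M : Market n) (x : Fin n → Finset (Fin n) → ℝ) (i : Fin n) : ℝ :=
  ∑ j, ∑ S ∈ (bundles j).filter (fun S => i ∈ S), M.h j i S * x j S

/-- `x` assigns (sub)distributions, the missing mass being that of the empty set, and the balance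
condition holds up to an additive `ε` for every agent. For `ε = 0` this is exact balance. -/
structure BalancedUpTo (M : Market n) (ε : ℝ) (x : Fin n → Finset (Fin n) → ℝ) : Prop where
  nonneg : ∀ i, ∀ S ∈ bundles i, 0 ≤ x i S
  sum_le_one : ∀ i, ∑ S ∈ bundles i, x i S ≤ 1
  balance : ∀ i, |received M x i - contributed M x i| ≤ ε

/-- Social welfare. -/
def welfare (M : Market n) (x : Fin n → Finset (Fin n) → ℝ) : ℝ :=
  ∑ i, ∑ S ∈ bundles i, M.u i S * x i S

/-! ## Algorithms

A first-order language of programs over natural numbers, real numbers, Booleans, pairs and lists,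
with `for` loops and calls to a subroutine that evaluates utilities and shares. All values are
immutable, so that a pointer machine carries out every basic operation within the time that it is
charged. -/

/-- The set of agents other than `i` that a list of indices denotes. -/
def toBundle (i : Fin n) (l : List ℕ) : Finset (Fin n) :=
  Finset.univ.filter fun j => j ≠ i ∧ (j : ℕ) ∈ l

/-- The answer `u_i(S)` of the subroutine, the set `S` being given as a list. -/
def Market.askUtility (M : Market n) (i : ℕ) (l : List ℕ) : ℝ :=
  if hi : i < n then M.u ⟨i, hi⟩ (toBundle ⟨i, hi⟩ l) else 0

/-- The answer `h_ij(S)` of the subroutine, for `j ∈ S`. -/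
def Market.askShare (M : Market n) (i j : ℕ) (l : List ℕ) : ℝ :=
  if hij : i < n ∧ j < n then
    if (⟨j, hij.2⟩ : Fin n) ∈ toBundle ⟨i, hij.1⟩ l then
      M.h ⟨i, hij.1⟩ ⟨j, hij.2⟩ (toBundle ⟨i, hij.1⟩ l)
    else 0
  else 0

/-- Programs that turn a value of type `A` into one of type `B`. -/
inductive Prog : Type → Type → Type 1
  | id {A : Type} : Prog A A
  | comp {A B C : Type} (g : Prog B C) (f : Prog A B) : Prog A C
  | pair {A B C : Type} (f : Prog A B) (g : Prog A C) : Prog A (B × C)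
  | fst {A B : Type} : Prog (A × B) A
  | snd {A B : Type} : Prog (A × B) B
  | cond {A B : Type} (c : Prog A Bool) (t e : Prog A B) : Prog A B
  | natZero {A : Type} : Prog A ℕ
  | natSucc : Prog ℕ ℕ
  | natLt : Prog (ℕ × ℕ) Bool
  | nil {A B : Type} : Prog A (List B)
  | cons {B : Type} : Prog (B × List B) (List B)
  /-- `for` a number of times: apply `f` to the state. -/
  | repeatN {A : Type} (f : Prog A A) : Prog (ℕ × A) A
  /-- `for` each member of a list: update the state by `f`. -/
  | forEach {A B : Type} (f : Prog (A × B) A) : Prog (A × List B) A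
  | realZero {A : Type} : Prog A ℝ
  | realOne {A : Type} : Prog A ℝ
  | add : Prog (ℝ × ℝ) ℝ
  | sub : Prog (ℝ × ℝ) ℝ
  | mul : Prog (ℝ × ℝ) ℝ
  | div : Prog (ℝ × ℝ) ℝ
  | realLe : Prog (ℝ × ℝ) Bool
  /-- Call of the subroutine for the utility `u_i(S)`. -/
  | utility : Prog (ℕ × List ℕ) ℝ
  /-- Call of the subroutine for the share `h_ij(S)`. -/
  | share : Prog (ℕ × ℕ × List ℕ) ℝ

open Classical in
/-- The result of a program. -/
def Prog.val (M : Market n) : {A B : Type} → Prog A B → A → B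
  | _, _, .id => fun a => a
  | _, _, .comp g f => fun a => g.val M (f.val M a)
  | _, _, .pair f g => fun a => (f.val M a, g.val M a)
  | _, _, .fst => fun a => a.1
  | _, _, .snd => fun a => a.2
  | _, _, .cond c t e => fun a => if c.val M a = true then t.val M a else e.val M a
  | _, _, .natZero => fun _ => 0
  | _, _, .natSucc => fun k => k + 1
  | _, _, .natLt => fun a => decide (a.1 < a.2)
  | _, _, .nil => fun _ => []
  | _, _, .cons => fun a => a.1 :: a.2
  | _, _, .repeatN f => fun a => (f.val M)^[a.1] a.2
  | _, _, .forEach f => fun a => a.2.foldl (fun s b => f.val M (s, b)) a.1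
  | _, _, .realZero => fun _ => 0
  | _, _, .realOne => fun _ => 1
  | _, _, .add => fun a => a.1 + a.2
  | _, _, .sub => fun a => a.1 - a.2
  | _, _, .mul => fun a => a.1 * a.2
  | _, _, .div => fun a => a.1 / a.2
  | _, _, .realLe => fun a => decide (a.1 ≤ a.2)
  | _, _, .utility => fun a => M.askUtility a.1 a.2
  | _, _, .share => fun a => M.askShare a.1 a.2.1 a.2.2

/-- The cost of a loop over a list: each round costs one more than its body. -/
def forEachCost {A B : Type} (next : A → B → A) (c : A → B → ℕ) : A → List B → ℕ
  | _, [] => 1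
  | s, b :: l => 1 + c s b + forEachCost next c (next s b) l

/-- The running time of a program, when an operation on real numbers costs one more than the total
weight `w` of the numbers involved, and a call of the subroutine one more than the length of its
argument and the weight of its answer. Natural numbers only grow by counting, at unit cost. -/
def Prog.cost (M : Market n) (w : ℝ → ℕ) : {A B : Type} → Prog A B → A → ℕ
  | _, _, .id => fun _ => 1
  | _, _, .comp g f => fun a => f.cost M w a + g.cost M w (f.val M a)
  | _, _, .pair f g => fun a => 1 + f.cost M w a + g.cost M w a
  | _, _, .fst => fun _ => 1
  | _, _, .snd => fun _ => 1
  | _, _, .cond c t e => fun a =>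
      1 + c.cost M w a + if c.val M a = true then t.cost M w a else e.cost M w a
  | _, _, .natZero => fun _ => 1
  | _, _, .natSucc => fun _ => 1
  | _, _, .natLt => fun _ => 1
  | _, _, .nil => fun _ => 1
  | _, _, .cons => fun _ => 1
  | _, _, .repeatN f => fun a =>
      1 + ∑ t ∈ Finset.range a.1, (1 + f.cost M w ((f.val M)^[t] a.2))
  | _, _, .forEach f => fun a =>
      forEachCost (fun s b => f.val M (s, b)) (fun s b => f.cost M w (s, b)) a.1 a.2
  | _, _, .realZero => fun _ => 1
  | _, _, .realOne => fun _ => 1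
  | _, _, .add => fun a => 1 + w a.1 + w a.2 + w (a.1 + a.2)
  | _, _, .sub => fun a => 1 + w a.1 + w a.2 + w (a.1 - a.2)
  | _, _, .mul => fun a => 1 + w a.1 + w a.2 + w (a.1 * a.2)
  | _, _, .div => fun a => 1 + w a.1 + w a.2 + w (a.1 / a.2)
  | _, _, .realLe => fun a => 1 + w a.1 + w a.2
  | _, _, .utility => fun a => 1 + a.2.length + w (M.askUtility a.1 a.2)
  | _, _, .share => fun a => 1 + a.2.2.length + w (M.askShare a.1 a.2.1 a.2.2)

/-- The number of bits of a fraction in lowest terms. -/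
def ratBits (q : ℚ) : ℕ := q.num.natAbs.size + q.den.size

open Classical in
/-- The number of bits of a rational number. (The value `0` at irrational numbers is never used:
bit costs are only considered when all numbers in the input are rational.) -/
def realBits (x : ℝ) : ℕ := if hx : ∃ q : ℚ, (q : ℝ) = x then ratBits hx.choose else 0

/-- `x` is a rational number of at most `b` bits. -/
def HasBits (b : ℕ) (x : ℝ) : Prop := ∃ q : ℚ, (q : ℝ) = x ∧ ratBits q ≤ b

/-- All answers of the subroutine are rational numbers of at most `b` bits. -/
def Market.HasBits (M : Market n) (b : ℕ) : Prop :=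
  ∀ i S, i ∉ S → DataExchange.HasBits b (M.u i S) ∧ ∀ j ∈ S, DataExchange.HasBits b (M.h i j S)

/-- An algorithm receives the number of agents and `ε`; it has access to the market through the
subroutine only. Its output is the list of the triples `(i, S, p)` with the meaning that
probability `p` is added to `x_{iS}`. -/
abbrev Algorithm : Type 1 := Prog (ℕ × ℝ) (List (ℕ × List ℕ × ℝ))

/-- The solution that a list of triples denotes. -/
def decode (L : List (ℕ × List ℕ × ℝ)) (i : Fin n) (S : Finset (Fin n)) : ℝ :=
  (L.map fun e => if e.1 = (i : ℕ) ∧ toBundle i e.2.1 = S then e.2.2 else 0).sum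

/-- The solution that the algorithm `P` finds. -/
def Algorithm.solution (P : Algorithm) (M : Market n) (ε : ℝ) : Fin n → Finset (Fin n) → ℝ :=
  decode (Prog.val M P (n, ε))

/-- On the markets of the class `K`, `P` makes a number of steps (calls of the subroutine and
arithmetic operations included) that is polynomial in `n` and `1/ε`. Moreover, when the numbers in
the input are rationals of at most `b` bits, also its running time with every arithmetic operation
charged for the bits of the numbers involved is polynomial, in `n`, `1/ε` and `b`. -/
def Algorithm.PolynomialTime (P : Algorithm) (K : (n : ℕ) → Market n → Prop) : Prop :=
  ∃ p : Polynomial ℕ, ∀ (n : ℕ) (M : Market n) (ε : ℝ), K n M → 0 < ε → ε < 1 →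
    Prog.cost M (fun _ => 0) P (n, ε) ≤ p.eval (n + ⌈1 / ε⌉₊) ∧
    ∀ b : ℕ, HasBits b ε → M.HasBits b →
      Prog.cost M realBits P (n, ε) ≤ p.eval (n + ⌈1 / ε⌉₊ + b)

/-- On the markets of the class `K`, `P` finds an `ε`-balanced solution, whose welfare is at least
the fraction `1 / α n ε` of the welfare of any `ε`-balanced (in particular, of any exactly
balanced) solution. -/
def Algorithm.Approximates (P : Algorithm) (K : (n : ℕ) → Market n → Prop) (α : ℕ → ℝ → ℝ) :
    Prop :=
  ∀ (n : ℕ) (M : Market n) (ε : ℝ), K n M → 0 < ε → ε < 1 →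
    BalancedUpTo M ε (P.solution M ε) ∧
    ∀ y, BalancedUpTo M ε y → welfare M y ≤ α n ε * welfare M (P.solution M ε)

end DataExchange

end

/-! ### Cost model: sizes of rationals and of structured values, and programs derived from the
primitives -/

namespace DataExchange

/-! ## Bit lengths of rational numbers -/

/-! Maximizing welfare over ε-balanced solutions is a linear program with exponentially many
variables `x i S` but only `n` balance constraints, so it is treated through its Lagrangian. With
weight `L` on the welfare and multipliers `Y`, the Lagrangian splits into one problem per agent:
find a set `S` of large `score`, the sum over `j ∈ S` of `h i j S * (L + Y j - Y i)`
(`Market.Valid.lagrangian`). The dual algorithm lets every agent receive a nearly best set, moves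
`Y` against the resulting imbalance and a little towards `0`, and outputs the average of all rounds.
The potential `∑ Y i ^ 2` (`DualRun.sum_sq_le`) controls everything. It stays small, and `Y` records
the accumulated imbalance, so the average is ε-balanced (`balancedUpTo_outputs`). It is
non-negative, so the average welfare is near the optimum divided by the oracle's approximation
factor (`average_welfare_ge`). The additive error becomes a constant factor because some ε-balanced
solution has welfare `ε`.

The oracle differs in the two parts. For cross-monotonic sharing the level sets of `Y` are within a
factor `O(log n)` (`level_bound`): prices are grouped into dyadic classes, and a compression of the
gaps of `Y` (`exists_compression`) leaves only `O(log n)` classes. The Shapley value of a submodular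
function is cross-monotonic, since it is an average over orders of all agents (`shapley_eq`). In the
symmetric setting the score is a decreasing factor of the total size times a linear function, so a
knapsack approximation scheme gives the factor `1 + ε / 4` (`SymmetricMarket.score_le`,
`exists_packed_le_pick`).

Programs have bounded loops only, so natural numbers stay below a primitive recursive function of
those in the input, whereas the number of rounds must depend on the real number `1 / ε`. `Prog.grow`
counts towards `1 / ε` but gives up only after `ack r (n + 2)`. If it gives up, `1 / ε` exceeds the
cost, up to a factor linear in the bit length, of solving the whole linear program by
Fourier–Motzkin elimination, and this is done instead (`exactE_correct`, `exists_hybridE_cost`). -/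

theorem size_mul_le (a b : ℕ) : (a * b).size ≤ a.size + b.size := by
  rw [Nat.size_le, pow_add]
  exact Nat.mul_lt_mul'' (Nat.lt_size_self a) (Nat.lt_size_self b)

theorem size_add_le {a b k : ℕ} (ha : a.size ≤ k) (hb : b.size ≤ k) : (a + b).size ≤ k + 1 := by
  rw [Nat.size_le] at *
  rw [pow_succ]
  omega

/-- `x` is a fraction whose numerator and denominator have at most `B` bits. -/
def FracBits (B : ℕ) (x : ℝ) : Prop :=
  ∃ q : ℚ, (q : ℝ) = x ∧ q.num.natAbs.size ≤ B ∧ q.den.size ≤ B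

/-- Reduction to lowest terms only shrinks numerator and denominator, so bounds may be read off from
any representation as a fraction. -/
theorem fracBits_of_div {B : ℕ} {x : ℝ} (a : ℤ) (d : ℕ) (hd : d ≠ 0) (hx : (a : ℝ) / (d : ℝ) = x)
    (ha : a.natAbs.size ≤ B) (hB : d.size ≤ B) : FracBits B x := by
  refine ⟨(a : ℚ) / (d : ℚ), by rw [← hx]; push_cast; rfl, ?_, ?_⟩
  · refine le_trans (Nat.size_le_size ?_) ha
    by_cases h0 : a = 0
    · simp [h0]
    · have h := Rat.num_dvd a (b := (d : ℤ)) (by exact_mod_cast hd)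
      rw [Rat.divInt_eq_div] at h
      exact Nat.le_of_dvd (Int.natAbs_pos.mpr h0) (Int.natAbs_dvd_natAbs.mpr (by simpa using h))
  · refine le_trans (Nat.size_le_size ?_) hB
    have h := Rat.den_dvd a d
    rw [Rat.divInt_eq_div] at h
    rw [Int.cast_natCast] at h
    exact Nat.le_of_dvd (Nat.pos_of_ne_zero hd) (by exact_mod_cast h)

theorem FracBits.mono {B C : ℕ} {x : ℝ} (h : FracBits B x) (hBC : B ≤ C) : FracBits C x := by
  obtain ⟨q, h1, h2, h3⟩ := h
  exact ⟨q, h1, h2.trans hBC, h3.trans hBC⟩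

theorem FracBits.neg {B : ℕ} {x : ℝ} (h : FracBits B x) : FracBits B (-x) := by
  obtain ⟨q, h1, h2, h3⟩ := h
  exact ⟨-q, by simp [h1], by simpa using h2, by simpa using h3⟩

theorem FracBits.add {B C : ℕ} {x y : ℝ} (hx : FracBits B x) (hy : FracBits C y) :
    FracBits (B + C + 1) (x + y) := by
  obtain ⟨q, rfl, hq1, hq2⟩ := hx
  obtain ⟨r, rfl, hr1, hr2⟩ := hy
  have h1 : (q.den : ℝ) ≠ 0 := by exact_mod_cast q.den_nz
  have h2 : (r.den : ℝ) ≠ 0 := by exact_mod_cast r.den_nz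
  refine fracBits_of_div (q.num * r.den + r.num * q.den) (q.den * r.den)
    (Nat.mul_ne_zero q.den_nz r.den_nz) ?_ ?_ ?_
  · rw [Rat.cast_def q, Rat.cast_def r]
    push_cast
    field_simp
  · refine le_trans (Nat.size_le_size (Int.natAbs_add_le _ _)) ?_
    rw [Int.natAbs_mul, Int.natAbs_mul]
    refine size_add_le ((size_mul_le _ _).trans ?_) ((size_mul_le _ _).trans ?_) <;>
      simp only [Int.natAbs_natCast] <;> omega
  · refine (size_mul_le _ _).trans ?_
    omega

theorem FracBits.sub {B C : ℕ} {x y : ℝ} (hx : FracBits B x) (hy : FracBits C y) :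
    FracBits (B + C + 1) (x - y) := by
  rw [sub_eq_add_neg]
  exact hx.add hy.neg

theorem FracBits.mul {B C : ℕ} {x y : ℝ} (hx : FracBits B x) (hy : FracBits C y) :
    FracBits (B + C) (x * y) := by
  obtain ⟨q, rfl, hq1, hq2⟩ := hx
  obtain ⟨r, rfl, hr1, hr2⟩ := hy
  have h1 : (q.den : ℝ) ≠ 0 := by exact_mod_cast q.den_nz
  have h2 : (r.den : ℝ) ≠ 0 := by exact_mod_cast r.den_nz
  refine fracBits_of_div (q.num * r.num) (q.den * r.den)
    (Nat.mul_ne_zero q.den_nz r.den_nz) ?_ ?_ ?_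
  · rw [Rat.cast_def q, Rat.cast_def r]
    push_cast
    field_simp
  · rw [Int.natAbs_mul]
    exact (size_mul_le _ _).trans (by omega)
  · exact (size_mul_le _ _).trans (by omega)

theorem fracBits_zero : FracBits 1 0 := ⟨0, by simp, by simp, by simp⟩

theorem fracBits_one : FracBits 1 1 := ⟨1, by simp, by simp, by simp⟩

theorem FracBits.inv {B : ℕ} {x : ℝ} (hx : FracBits B x) : FracBits B x⁻¹ := by
  have hx' := hx
  obtain ⟨q, rfl, hq1, hq2⟩ := hx
  by_cases h0 : q = 0
  -- Here `0⁻¹ = 0`; otherwise inversion swaps numerator and denominator.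
  · simpa [h0] using hx'
  · refine ⟨q⁻¹, by push_cast; rfl, ?_, ?_⟩
    · rw [Rat.num_inv, Int.natAbs_mul, Int.natAbs_sign_of_ne_zero (by simpa using h0)]
      simpa using hq2
    · rw [Rat.den_inv, if_neg (by simpa using h0)]
      exact hq1

theorem FracBits.div {B C : ℕ} {x y : ℝ} (hx : FracBits B x) (hy : FracBits C y) :
    FracBits (B + C) (x / y) := by
  rw [div_eq_mul_inv]
  exact hx.mul hy.inv

theorem HasBits.fracBits {B : ℕ} {x : ℝ} (h : HasBits B x) : FracBits B x := by
  obtain ⟨q, h1, h2⟩ := h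
  unfold ratBits at h2
  exact ⟨q, h1, by omega, by omega⟩

theorem FracBits.realBits_le {B : ℕ} {x : ℝ} (h : FracBits B x) : realBits x ≤ 2 * B := by
  obtain ⟨q, h1, h2, h3⟩ := h
  have hx : ∃ q : ℚ, (q : ℝ) = x := ⟨q, h1⟩
  unfold realBits
  rw [dif_pos hx]
  have : hx.choose = q := by
    have := hx.choose_spec.trans h1.symm
    exact_mod_cast this
  rw [this]
  unfold ratBits
  omega

/-! ## Sizes of values -/

/-- A charge `w` for real numbers, together with a predicate `H B x` (`x` has size at most `B`) that
controls it and that grows slowly under arithmetic operations. -/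
structure Gauge (w : ℝ → ℕ) (H : ℕ → ℝ → Prop) : Prop where
  mono : ∀ {B C x}, H B x → B ≤ C → H C x
  le : ∀ {B x}, H B x → w x ≤ 2 * B
  zero : H 1 0
  one : H 1 1
  add : ∀ {B C x y}, H B x → H C y → H (B + C + 1) (x + y)
  sub : ∀ {B C x y}, H B x → H C y → H (B + C + 1) (x - y)
  mul : ∀ {B C x y}, H B x → H C y → H (B + C) (x * y)
  div : ∀ {B C x y}, H B x → H C y → H (B + C) (x / y)

/-- The gauge that counts steps. Together with `gauge_bits` it lets one cost analysis, carried out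
for an arbitrary gauge, give both halves of `Algorithm.PolynomialTime`. -/
theorem gauge_unit : Gauge (fun _ => 0) (fun _ _ => True) := by
  constructor <;> simp

theorem gauge_bits : Gauge realBits FracBits where
  mono := FracBits.mono
  le := FracBits.realBits_le
  zero := fracBits_zero
  one := fracBits_one
  add := FracBits.add
  sub := FracBits.sub
  mul := FracBits.mul
  div := FracBits.div

/-- All answers of the subroutine have size at most `B`. -/
structure Answers {n : ℕ} (M : Market n) (H : ℕ → ℝ → Prop) (B : ℕ) : Prop where
  utility : ∀ i l, H B (M.askUtility i l)
  share : ∀ i j l, H B (M.askShare i j l)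

theorem Answers.mono {n : ℕ} {M : Market n} {w : ℝ → ℕ} {H : ℕ → ℝ → Prop} {B C : ℕ}
    (hG : Gauge w H) (h : Answers M H B) (hBC : B ≤ C) : Answers M H C :=
  ⟨fun i l => hG.mono (h.utility i l) hBC, fun i j l => hG.mono (h.share i j l) hBC⟩

theorem not_mem_toBundle {n : ℕ} (i : Fin n) (l : List ℕ) : i ∉ toBundle i l := by
  simp [toBundle]

/-- The extra bit is for the default answer `0`, whose denominator `1` occupies one bit even when `b
= 0`. -/
theorem answers_bits {n b : ℕ} {M : Market n} (h : M.HasBits b) :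
    Answers M FracBits (b + 1) := by
  refine ⟨fun i l => ?_, fun i j l => ?_⟩
  · unfold Market.askUtility
    split
    · exact (h _ _ (not_mem_toBundle _ _)).1.fracBits.mono (by omega)
    · exact fracBits_zero.mono (by omega)
  · unfold Market.askShare
    split
    · split
      · rename_i hm
        exact ((h _ _ (not_mem_toBundle _ _)).2 _ hm).fracBits.mono (by omega)
      · exact fracBits_zero.mono (by omega)
    · exact fracBits_zero.mono (by omega)

/-- Values built from numbers, Booleans, pairs and lists. `Within H s b a` says that the natural
numbers and the list lengths in `a` are at most `s` and that the real numbers in `a` have size at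
most `b`. -/
class Sized (A : Type) where
  Within : (ℕ → ℝ → Prop) → ℕ → ℕ → A → Prop
  mono : ∀ {w H}, Gauge w H → ∀ {s s' b b' : ℕ} {a : A}, Within H s b a → s ≤ s' → b ≤ b' →
    Within H s' b' a

open Sized (Within)

instance : Sized ℕ where
  Within _ s _ a := a ≤ s
  mono _ _ _ _ _ _ h hs _ := le_trans h hs

instance : Sized ℝ where
  Within H _ b a := H b a
  mono hG _ _ _ _ _ h _ hb := hG.mono h hb

instance : Sized Bool where
  Within _ _ _ _ := True
  mono _ _ _ _ _ _ _ _ _ := trivial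

instance {A B : Type} [Sized A] [Sized B] : Sized (A × B) where
  Within H s b a := Within H s b a.1 ∧ Within H s b a.2
  mono hG _ _ _ _ _ h hs hb := ⟨Sized.mono hG h.1 hs hb, Sized.mono hG h.2 hs hb⟩

instance {A : Type} [Sized A] : Sized (List A) where
  Within H s b l := l.length ≤ s ∧ ∀ a ∈ l, Within H s b a
  mono hG _ _ _ _ _ h hs hb := ⟨h.1.trans hs, fun a ha => Sized.mono hG (h.2 a ha) hs hb⟩

/-! ## Derived program constructions -/

namespace Prog

variable {Γ A B C D : Type}

/-- The expression `e` in a context with one more variable. -/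
abbrev wk (e : Prog Γ A) : Prog (Γ × B) A := e.comp fst

/-- `let` binding. -/
def bind (e : Prog Γ A) (f : Prog (Γ × A) B) : Prog Γ B := f.comp (id.pair e)

def addE (e f : Prog Γ ℝ) : Prog Γ ℝ := add.comp (e.pair f)
def subE (e f : Prog Γ ℝ) : Prog Γ ℝ := sub.comp (e.pair f)
def mulE (e f : Prog Γ ℝ) : Prog Γ ℝ := mul.comp (e.pair f)
def divE (e f : Prog Γ ℝ) : Prog Γ ℝ := div.comp (e.pair f)
def leE (e f : Prog Γ ℝ) : Prog Γ Bool := realLe.comp (e.pair f)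
def ltE (e f : Prog Γ ℕ) : Prog Γ Bool := natLt.comp (e.pair f)
def succE (e : Prog Γ ℕ) : Prog Γ ℕ := natSucc.comp e
def consE (e : Prog Γ A) (l : Prog Γ (List A)) : Prog Γ (List A) := cons.comp (e.pair l)
def utilityE (i : Prog Γ ℕ) (l : Prog Γ (List ℕ)) : Prog Γ ℝ := utility.comp (i.pair l)
def shareE (i j : Prog Γ ℕ) (l : Prog Γ (List ℕ)) : Prog Γ ℝ := share.comp (i.pair (j.pair l))

/-- Iterate `f` on a state that starts as `e`, in a fixed context. -/
def iter (k : Prog Γ ℕ) (e : Prog Γ A) (f : Prog (Γ × A) A) : Prog Γ A :=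
  snd.comp ((repeatN (fst.pair f)).comp (k.pair (id.pair e)))

/-- Fold over a list in a fixed context. -/
def fold (l : Prog Γ (List B)) (e : Prog Γ A) (f : Prog ((Γ × A) × B) A) : Prog Γ A :=
  snd.comp ((forEach ((fst.comp fst).pair f)).comp ((id.pair e).pair l))

section val

variable {n : ℕ} (M : Market n) (γ : Γ)

@[simp] theorem val_comp (g : Prog A B) (f : Prog Γ A) :
    (g.comp f).val M γ = g.val M (f.val M γ) := rfl
@[simp] theorem val_pair (f : Prog Γ A) (g : Prog Γ B) :
    (f.pair g).val M γ = (f.val M γ, g.val M γ) := rfl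
@[simp] theorem val_fst (a : A × B) : (fst : Prog (A × B) A).val M a = a.1 := rfl
@[simp] theorem val_snd (a : A × B) : (snd : Prog (A × B) B).val M a = a.2 := rfl
@[simp] theorem val_cond (c : Prog Γ Bool) (t e : Prog Γ A) :
    (cond c t e).val M γ = if c.val M γ = true then t.val M γ else e.val M γ := rfl
@[simp] theorem val_natZero : (natZero : Prog Γ ℕ).val M γ = 0 := rfl
@[simp] theorem val_nil : (nil : Prog Γ (List A)).val M γ = [] := rfl
@[simp] theorem val_realZero : (realZero : Prog Γ ℝ).val M γ = 0 := rfl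
@[simp] theorem val_realOne : (realOne : Prog Γ ℝ).val M γ = 1 := rfl
@[simp] theorem val_bind (e : Prog Γ A) (f : Prog (Γ × A) B) :
    (bind e f).val M γ = f.val M (γ, e.val M γ) := rfl
@[simp] theorem val_addE (e f : Prog Γ ℝ) : (addE e f).val M γ = e.val M γ + f.val M γ := rfl
@[simp] theorem val_subE (e f : Prog Γ ℝ) : (subE e f).val M γ = e.val M γ - f.val M γ := rfl
@[simp] theorem val_mulE (e f : Prog Γ ℝ) : (mulE e f).val M γ = e.val M γ * f.val M γ := rfl
@[simp] theorem val_divE (e f : Prog Γ ℝ) : (divE e f).val M γ = e.val M γ / f.val M γ := rfl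
@[simp] theorem val_leE (e f : Prog Γ ℝ) :
    (leE e f).val M γ = true ↔ e.val M γ ≤ f.val M γ := by
  simp only [leE, val]
  exact decide_eq_true_iff
@[simp] theorem val_ltE (e f : Prog Γ ℕ) :
    (ltE e f).val M γ = true ↔ e.val M γ < f.val M γ := by
  simp only [ltE, val]
  exact decide_eq_true_iff
@[simp] theorem val_succE (e : Prog Γ ℕ) : (succE e).val M γ = e.val M γ + 1 := rfl
@[simp] theorem val_consE (e : Prog Γ A) (l : Prog Γ (List A)) :
    (consE e l).val M γ = e.val M γ :: l.val M γ := rfl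
@[simp] theorem val_utilityE (i : Prog Γ ℕ) (l : Prog Γ (List ℕ)) :
    (utilityE i l).val M γ = M.askUtility (i.val M γ) (l.val M γ) := rfl
@[simp] theorem val_shareE (i j : Prog Γ ℕ) (l : Prog Γ (List ℕ)) :
    (shareE i j l).val M γ = M.askShare (i.val M γ) (j.val M γ) (l.val M γ) := rfl

/-- The loops of the language see only their state; `iter` carries the unchanging context `γ` inside
the state and drops it at the end. `foldl_pair` does the same for lists. -/
theorem iterate_pair (f : Prog (Γ × A) A) (k : ℕ) (a : A) :
    ((fst.pair f).val M)^[k] (γ, a) = (γ, (fun a => f.val M (γ, a))^[k] a) := by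
  induction k generalizing a with
  | zero => rfl
  | succ k ih => rw [Function.iterate_succ_apply, Function.iterate_succ_apply]; exact ih _

@[simp] theorem val_iter (k : Prog Γ ℕ) (e : Prog Γ A) (f : Prog (Γ × A) A) :
    (iter k e f).val M γ = (fun a => f.val M (γ, a))^[k.val M γ] (e.val M γ) :=
  congrArg Prod.snd (iterate_pair M γ f _ _)

theorem foldl_pair (f : Prog ((Γ × A) × B) A) (l : List B) (a : A) :
    l.foldl (fun s b => ((fst.comp fst).pair f).val M (s, b)) (γ, a) =
      (γ, l.foldl (fun a b => f.val M ((γ, a), b)) a) := by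
  induction l generalizing a with
  | nil => rfl
  | cons b l ih => exact ih _

@[simp] theorem val_fold (l : Prog Γ (List B)) (e : Prog Γ A) (f : Prog ((Γ × A) × B) A) :
    (fold l e f).val M γ =
      (l.val M γ).foldl (fun a b => f.val M ((γ, a), b)) (e.val M γ) :=
  congrArg Prod.snd (foldl_pair M γ f _ _)

end val

/-! Library of list and number programs -/

/-- Natural number constant. -/
def natLit : ℕ → Prog Γ ℕ
  | 0 => natZero
  | k + 1 => succE (natLit k)

def addN (e f : Prog Γ ℕ) : Prog Γ ℕ := iter e f (succE snd)
def mulN (e f : Prog Γ ℕ) : Prog Γ ℕ := iter e natZero (addN (wk f) snd)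
def reverseE (l : Prog Γ (List A)) : Prog Γ (List A) := fold l nil (consE snd (snd.comp fst))
def appendE (k l : Prog Γ (List A)) : Prog Γ (List A) :=
  fold (reverseE k) l (consE snd (snd.comp fst))
def mapE (l : Prog Γ (List B)) (f : Prog (Γ × B) A) : Prog Γ (List A) :=
  reverseE (fold l nil (consE (f.comp ((fst.comp fst).pair snd)) (snd.comp fst)))
def filterE (l : Prog Γ (List B)) (f : Prog (Γ × B) Bool) : Prog Γ (List B) :=
  reverseE (fold l nil (cond (f.comp ((fst.comp fst).pair snd)) (consE snd (snd.comp fst))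
    (snd.comp fst)))
def flatMapE (l : Prog Γ (List B)) (f : Prog (Γ × B) (List A)) : Prog Γ (List A) :=
  fold (reverseE l) nil (appendE (f.comp ((fst.comp fst).pair snd)) (snd.comp fst))
def sumE (l : Prog Γ (List B)) (f : Prog (Γ × B) ℝ) : Prog Γ ℝ :=
  fold l realZero (addE (snd.comp fst) (f.comp ((fst.comp fst).pair snd)))
/-- A member of `e :: l` with the largest value of `f`. -/
def argmaxE (l : Prog Γ (List B)) (e : Prog Γ B) (f : Prog (Γ × B) ℝ) : Prog Γ B :=
  fold l e (cond (leE (f.comp ((fst.comp fst).pair snd))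
    (f.comp ((fst.comp fst).pair (snd.comp fst)))) (snd.comp fst) snd)
def rangeE (k : Prog Γ ℕ) : Prog Γ (List ℕ) :=
  reverseE (snd.comp (iter k (natZero.pair nil)
    ((succE (fst.comp snd)).pair (consE (fst.comp snd) (snd.comp snd)))))
def castE (k : Prog Γ ℕ) : Prog Γ ℝ := iter k realZero (addE snd realOne)
-- Booleans arise from comparisons only, so `e < e` and `e < e + 1` serve as the constants false and
-- true.
def eqE (e f : Prog Γ ℕ) : Prog Γ Bool :=
  cond (ltE e f) (ltE e e) (cond (ltE f e) (ltE e e) (ltE e (succE e)))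

section val

variable {n : ℕ} (M : Market n) (γ : Γ)

@[simp] theorem val_natLit (k : ℕ) : (natLit k : Prog Γ ℕ).val M γ = k := by
  induction k with
  | zero => rfl
  | succ k ih => simp [natLit, ih]

@[simp] theorem val_addN (e f : Prog Γ ℕ) : (addN e f).val M γ = e.val M γ + f.val M γ := by
  simp only [addN, val_iter, val_succE, val_snd]
  generalize e.val M γ = k
  generalize f.val M γ = m
  induction k with
  | zero => simp
  | succ k ih => rw [Function.iterate_succ_apply', ih]; ring

@[simp] theorem val_mulN (e f : Prog Γ ℕ) : (mulN e f).val M γ = e.val M γ * f.val M γ := by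
  simp only [mulN, val_iter, val_addN, val_snd, val_natZero, wk, val_comp, val_fst]
  generalize e.val M γ = k
  induction k with
  | zero => simp
  | succ k ih => rw [Function.iterate_succ_apply', ih]; ring

@[simp] theorem val_reverseE (l : Prog Γ (List A)) :
    (reverseE l).val M γ = (l.val M γ).reverse := by
  simp [reverseE]

@[simp] theorem val_appendE (k l : Prog Γ (List A)) :
    (appendE k l).val M γ = k.val M γ ++ l.val M γ := by
  simp [appendE]

@[simp] theorem val_mapE (l : Prog Γ (List B)) (f : Prog (Γ × B) A) :
    (mapE l f).val M γ = (l.val M γ).map fun b => f.val M (γ, b) := by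
  simp [mapE]

theorem val_filterE (l : Prog Γ (List B)) (f : Prog (Γ × B) Bool) :
    (filterE l f).val M γ = (l.val M γ).filter fun b => f.val M (γ, b) := by
  have h : ∀ (l : List B) (acc : List B),
      l.foldl (fun a b => if f.val M (γ, b) = true then b :: a else a) acc =
        (l.filter fun b => f.val M (γ, b)).reverse ++ acc := by
    intro l
    induction l with
    | nil => intro; rfl
    | cons b l ih =>
      intro acc
      rw [List.foldl_cons, ih, List.filter_cons]
      split <;> simp
  have h' := congrArg List.reverse (h (l.val M γ) [])
  rw [List.append_nil, List.reverse_reverse] at h'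
  rw [filterE, val_reverseE, val_fold]
  exact h'

@[simp] theorem val_flatMapE (l : Prog Γ (List B)) (f : Prog (Γ × B) (List A)) :
    (flatMapE l f).val M γ = (l.val M γ).flatMap fun b => f.val M (γ, b) := by
  have h : ∀ (l : List B) (acc : List A),
      l.reverse.foldl (fun a b => f.val M (γ, b) ++ a) acc =
        (l.flatMap fun b => f.val M (γ, b)) ++ acc := by
    intro l
    induction l with
    | nil => intro; rfl
    | cons b l ih => intro acc; simp [List.foldl_append, ih]
  simpa [flatMapE] using h (l.val M γ) []

@[simp] theorem val_sumE (l : Prog Γ (List B)) (f : Prog (Γ × B) ℝ) :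
    (sumE l f).val M γ = ((l.val M γ).map fun b => f.val M (γ, b)).sum := by
  have h : ∀ (l : List B) (acc : ℝ),
      l.foldl (fun a b => a + f.val M (γ, b)) acc = acc + (l.map fun b => f.val M (γ, b)).sum := by
    intro l
    induction l with
    | nil => simp
    | cons b l ih => intro acc; simp [ih, add_assoc]
  simpa [sumE] using h (l.val M γ) 0

theorem val_argmaxE (l : Prog Γ (List B)) (e : Prog Γ B) (f : Prog (Γ × B) ℝ) :
    (argmaxE l e f).val M γ ∈ e.val M γ :: l.val M γ ∧
      ∀ b ∈ e.val M γ :: l.val M γ, f.val M (γ, b) ≤ f.val M (γ, (argmaxE l e f).val M γ) := by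
  have h : ∀ (l : List B) (e : B) (r : B), r = l.foldl (fun a b =>
      if f.val M (γ, b) ≤ f.val M (γ, a) then a else b) e →
      r ∈ e :: l ∧ ∀ b ∈ e :: l, f.val M (γ, b) ≤ f.val M (γ, r) := by
    intro l
    induction l with
    | nil => intro e r hr; simp [hr]
    | cons c l ih =>
      intro e r hr
      rw [List.foldl_cons] at hr
      obtain ⟨h1, h2⟩ := ih _ r hr
      split at h1
      · rename_i hc
        rw [if_pos hc] at h2
        refine ⟨by simp at h1 ⊢; tauto, ?_⟩
        have he := h2 e (by simp)
        intro b hb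
        simp only [List.mem_cons] at hb h2
        rcases hb with rfl | rfl | hb
        · exact he
        · exact hc.trans he
        · exact h2 b (Or.inr hb)
      · rename_i hc
        rw [if_neg hc] at h2
        refine ⟨by simp at h1 ⊢; tauto, ?_⟩
        have he := h2 c (by simp)
        intro b hb
        simp only [List.mem_cons] at hb h2
        rcases hb with rfl | rfl | hb
        · exact (not_le.mp hc).le.trans he
        · exact he
        · exact h2 b (Or.inr hb)
  apply h
  simp [argmaxE]

@[simp] theorem val_rangeE (k : Prog Γ ℕ) : (rangeE k).val M γ = List.range (k.val M γ) := by
  have h : ∀ k : ℕ, (fun a : ℕ × List ℕ => (a.1 + 1, a.1 :: a.2))^[k] (0, []) =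
      (k, (List.range k).reverse) := by
    intro k
    induction k with
    | zero => rfl
    | succ k ih => rw [Function.iterate_succ_apply', ih, List.range_succ]; simp
  simp [rangeE, h]

@[simp] theorem val_castE (k : Prog Γ ℕ) : (castE k).val M γ = (k.val M γ : ℝ) := by
  simp only [castE, val_iter, val_addE, val_snd, val_realZero, val_realOne]
  generalize k.val M γ = m
  induction m with
  | zero => simp
  | succ k ih => rw [Function.iterate_succ_apply', ih]; push_cast; ring

@[simp] theorem val_eqE (e f : Prog Γ ℕ) : (eqE e f).val M γ = true ↔ e.val M γ = f.val M γ := by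
  simp only [eqE, val_cond, val_ltE]
  split
  · simp; omega
  · split
    · simp; omega
    · simp; omega

end val

end Prog

end DataExchange

/-! ### Calculus of polynomially bounded programs -/

namespace DataExchange
open Sized (Within)

/-! ## Polynomial time -/

/-- Polynomially bounded functions. -/
def PolyBdd (f : ℕ → ℕ) : Prop := ∃ d : ℕ, ∀ X, f X ≤ (X + 2) ^ d

namespace PolyBdd

/-- The base `X + 2` is at least `2`, so a large enough exponent absorbs every constant; single
powers then suffice as bounds. -/
theorem const (c : ℕ) : PolyBdd fun _ => c :=
  ⟨c, fun X => (Nat.lt_two_pow_self).le.trans (Nat.pow_le_pow_left (by omega) c)⟩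

theorem id : PolyBdd fun X => X := ⟨1, fun X => by simp⟩

theorem pow (d : ℕ) : PolyBdd fun X => (X + 2) ^ d := ⟨d, fun _ => le_rfl⟩

theorem mul {f g : ℕ → ℕ} (hf : PolyBdd f) (hg : PolyBdd g) : PolyBdd fun X => f X * g X := by
  obtain ⟨d, hd⟩ := hf
  obtain ⟨e, he⟩ := hg
  exact ⟨d + e, fun X => by rw [pow_add]; exact Nat.mul_le_mul (hd X) (he X)⟩

theorem add {f g : ℕ → ℕ} (hf : PolyBdd f) (hg : PolyBdd g) : PolyBdd fun X => f X + g X := by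
  obtain ⟨d, hd⟩ := hf
  obtain ⟨e, he⟩ := hg
  refine ⟨d + e + 1, fun X => ?_⟩
  have h1 := (hd X).trans (Nat.pow_le_pow_right (show 0 < X + 2 by omega) (Nat.le_add_right d e))
  have h2 := (he X).trans (Nat.pow_le_pow_right (show 0 < X + 2 by omega) (Nat.le_add_left e d))
  rw [pow_succ]
  nlinarith [Nat.zero_le ((X + 2) ^ (d + e) * X)]

theorem comp_pow {g : ℕ → ℕ} (hg : PolyBdd g) (e : ℕ) : PolyBdd fun X => (g X + 2) ^ e := by
  obtain ⟨d, hd⟩ := hg.add (const 2)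
  exact ⟨d * e, fun X => by rw [pow_mul]; exact Nat.pow_le_pow_left (hd X) e⟩

end PolyBdd

theorem le_pow_exp {X d e x : ℕ} (h : x ≤ (X + 2) ^ d) (hde : d ≤ e) : x ≤ (X + 2) ^ e :=
  h.trans (Nat.pow_le_pow_right (by omega) hde)

namespace Prog

/-- The cost of an iteration. -/
theorem iter_cost {Γ A : Type} {n : ℕ} (M : Market n) (w : ℝ → ℕ) (k : Prog Γ ℕ) (e : Prog Γ A)
    (f : Prog (Γ × A) A) (γ : Γ) (c : ℕ)
    (hc : ∀ t < k.val M γ, f.cost M w (γ, (fun a => f.val M (γ, a))^[t] (e.val M γ)) ≤ c) :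
    (iter k e f).cost M w γ ≤ k.cost M w γ + e.cost M w γ + k.val M γ * (c + 3) + 5 := by
  have h : ∑ t ∈ Finset.range (k.val M γ),
      (1 + (fst.pair f).cost M w (((fst.pair f).val M)^[t] (γ, e.val M γ))) ≤
      k.val M γ * (c + 3) := by
    have : ∀ t ∈ Finset.range (k.val M γ),
        1 + (fst.pair f).cost M w (((fst.pair f).val M)^[t] (γ, e.val M γ)) ≤ c + 3 := by
      intro t ht
      rw [iterate_pair]
      have := hc t (Finset.mem_range.mp ht)
      simp only [cost]
      omega
    refine (Finset.sum_le_card_nsmul _ _ _ this).trans ?_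
    simp
  simp only [iter, cost, val] at h ⊢
  omega

/-- The cost of a fold. -/
theorem fold_cost {Γ A B : Type} {n : ℕ} (M : Market n) (w : ℝ → ℕ) (l : Prog Γ (List B))
    (e : Prog Γ A)
    (f : Prog ((Γ × A) × B) A) (γ : Γ) (c : ℕ) (I : ℕ → A → Prop) (h0 : I 0 (e.val M γ))
    (hI : ∀ t a, ∀ b ∈ l.val M γ, t < (l.val M γ).length → I t a →
      f.cost M w ((γ, a), b) ≤ c ∧ I (t + 1) (f.val M ((γ, a), b))) :
    (fold l e f).cost M w γ ≤ l.cost M w γ + e.cost M w γ + (l.val M γ).length * (c + 5) + 6 ∧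
      I (l.val M γ).length ((fold l e f).val M γ) := by
  have key : ∀ (k : List B) (t : ℕ) (a : A), I t a → (∀ b ∈ k, b ∈ l.val M γ) →
      t + k.length = (l.val M γ).length →
      forEachCost (fun s b => ((fst.comp fst).pair f).val M (s, b))
        (fun s b => ((fst.comp fst).pair f).cost M w (s, b)) (γ, a) k ≤
        k.length * (c + 5) + 1 ∧
      I (l.val M γ).length (k.foldl (fun a b => f.val M ((γ, a), b)) a) := by
    intro k
    induction k with
    | nil => intro t a ha _ ht; simp [forEachCost]; simpa [← ht] using ha
    | cons b k ih =>
      intro t a ha hk ht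
      simp only [List.length_cons] at ht
      obtain ⟨h1, h2⟩ := hI t a b (hk b (by simp)) (by omega) ha
      obtain ⟨h3, h4⟩ := ih (t + 1) _ h2 (fun b hb => hk b (by simp [hb])) (by omega)
      refine ⟨?_, h4⟩
      simp only [forEachCost, cost, val, List.length_cons] at h3 ⊢
      rw [add_mul]
      omega
  obtain ⟨h1, h2⟩ := key (l.val M γ) 0 (e.val M γ) h0 (fun _ h => h) (by simp)
  refine ⟨?_, by rw [val_fold]; exact h2⟩
  simp only [fold, cost, val] at h1 ⊢
  omega

end Prog

/-- `P` runs in polynomial time and its result has polynomial size. -/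
class Poly {A B : Type} [Sized A] [Sized B] (P : Prog A B) : Prop where
  bound : ∃ d : ℕ, ∀ {n : ℕ} (M : Market n) (w : ℝ → ℕ) (H : ℕ → ℝ → Prop), Gauge w H →
    ∀ X, Answers M H X → ∀ a, Within H X X a →
      P.cost M w a ≤ (X + 2) ^ d ∧ Within H ((X + 2) ^ d) ((X + 2) ^ d) (P.val M a)

variable {Γ A B C D : Type} [Sized Γ] [Sized A] [Sized B] [Sized C] [Sized D]

theorem Poly.of_polyBdd {P : Prog A B} (f g : ℕ → ℕ) (hf : PolyBdd f) (hg : PolyBdd g)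
    (h : ∀ {n : ℕ} (M : Market n) (w : ℝ → ℕ) (H : ℕ → ℝ → Prop), Gauge w H →
      ∀ X, Answers M H X → ∀ a, Within H X X a →
        P.cost M w a ≤ f X ∧ Within H (g X) (g X) (P.val M a)) : Poly P := by
  obtain ⟨d, hd⟩ := hf
  obtain ⟨e, he⟩ := hg
  refine ⟨max d e, fun M w H hG X hX a ha => ?_⟩
  obtain ⟨h1, h2⟩ := h M w H hG X hX a ha
  exact ⟨le_pow_exp (h1.trans (hd X)) (le_max_left _ _),
    Sized.mono hG h2 (le_pow_exp (he X) (le_max_right _ _)) (le_pow_exp (he X) (le_max_right _ _))⟩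

namespace Poly

theorem of_const {P : Prog A B} (c : ℕ)
    (h : ∀ {n : ℕ} (M : Market n) (w : ℝ → ℕ) (H : ℕ → ℝ → Prop), Gauge w H →
      ∀ X, Answers M H X → ∀ a, Within H X X a →
        P.cost M w a ≤ c * (X + 1) ∧ Within H (c * (X + 1)) (c * (X + 1)) (P.val M a)) : Poly P :=
  of_polyBdd (fun X => c * (X + 1)) (fun X => c * (X + 1))
    ((PolyBdd.const c).mul (PolyBdd.id.add (PolyBdd.const 1)))
    ((PolyBdd.const c).mul (PolyBdd.id.add (PolyBdd.const 1))) h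

instance id : Poly (Prog.id : Prog A A) := of_const 1 fun M w H hG X _ a ha =>
  ⟨by simp [Prog.cost], Sized.mono hG ha (by omega) (by omega)⟩

instance fst : Poly (Prog.fst : Prog (A × B) A) := of_const 1 fun M w H hG X _ a ha =>
  ⟨by simp [Prog.cost], Sized.mono hG ha.1 (by omega) (by omega)⟩

instance snd : Poly (Prog.snd : Prog (A × B) B) := of_const 1 fun M w H hG X _ a ha =>
  ⟨by simp [Prog.cost], Sized.mono hG ha.2 (by omega) (by omega)⟩

/-- The second program is run with the parameter `X + (X + 2) ^ d`, which bounds its input as well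
as the answers of the subroutine. -/
instance comp (g : Prog B C) (f : Prog A B) [hg : Poly g] [hf : Poly f] : Poly (g.comp f) := by
  obtain ⟨d, hd⟩ := hf.bound
  obtain ⟨e, he⟩ := hg.bound
  refine of_polyBdd (fun X => (X + 2) ^ d + (X + (X + 2) ^ d + 2) ^ e)
    (fun X => (X + (X + 2) ^ d + 2) ^ e) ((PolyBdd.pow d).add
      ((PolyBdd.id.add (PolyBdd.pow d)).comp_pow e))
    ((PolyBdd.id.add (PolyBdd.pow d)).comp_pow e) fun M w H hG X hX a ha => ?_
  obtain ⟨h1, h2⟩ := hd M w H hG X hX a ha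
  obtain ⟨h3, h4⟩ := he M w H hG (X + (X + 2) ^ d) (hX.mono hG (by omega)) _
    (Sized.mono hG h2 (by omega) (by omega))
  exact ⟨Nat.add_le_add h1 h3, h4⟩

instance pair (f : Prog A B) (g : Prog A C) [hf : Poly f] [hg : Poly g] : Poly (f.pair g) := by
  obtain ⟨d, hd⟩ := hf.bound
  obtain ⟨e, he⟩ := hg.bound
  refine of_polyBdd (fun X => 1 + (X + 2) ^ d + (X + 2) ^ e)
    (fun X => (X + 2) ^ d + (X + 2) ^ e) (((PolyBdd.const 1).add (PolyBdd.pow d)).add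
      (PolyBdd.pow e)) ((PolyBdd.pow d).add (PolyBdd.pow e)) fun M w H hG X hX a ha => ?_
  obtain ⟨h1, h2⟩ := hd M w H hG X hX a ha
  obtain ⟨h3, h4⟩ := he M w H hG X hX a ha
  refine ⟨by simp only [Prog.cost]; omega, ?_, ?_⟩
  · exact Sized.mono hG h2 (by omega) (by omega)
  · exact Sized.mono hG h4 (by omega) (by omega)

instance cond (c : Prog A Bool) (f g : Prog A B) [hc : Poly c] [hf : Poly f] [hg : Poly g] :
    Poly (Prog.cond c f g) := by
  obtain ⟨k, hk⟩ := hc.bound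
  obtain ⟨d, hd⟩ := hf.bound
  obtain ⟨e, he⟩ := hg.bound
  refine of_polyBdd (fun X => 1 + (X + 2) ^ k + ((X + 2) ^ d + (X + 2) ^ e))
    (fun X => (X + 2) ^ d + (X + 2) ^ e) (((PolyBdd.const 1).add (PolyBdd.pow k)).add
      ((PolyBdd.pow d).add (PolyBdd.pow e))) ((PolyBdd.pow d).add (PolyBdd.pow e))
      fun M w H hG X hX a ha => ?_
  obtain ⟨h1, h2⟩ := hd M w H hG X hX a ha
  obtain ⟨h3, h4⟩ := he M w H hG X hX a ha
  obtain ⟨h5, _⟩ := hk M w H hG X hX a ha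
  simp only [Prog.cost, Prog.val]
  split
  · exact ⟨by omega, Sized.mono hG h2 (by omega) (by omega)⟩
  · exact ⟨by omega, Sized.mono hG h4 (by omega) (by omega)⟩

instance natZero : Poly (Prog.natZero : Prog A ℕ) := of_const 1 fun M w H hG X _ a ha =>
  ⟨by simp [Prog.cost], Nat.zero_le _⟩

instance natSucc : Poly Prog.natSucc := of_const 1 fun M w H hG X _ a ha =>
  ⟨by simp [Prog.cost], by
    change a ≤ X at ha
    change a + 1 ≤ 1 * (X + 1)
    omega⟩

instance natLt : Poly Prog.natLt := of_const 1 fun M w H hG X _ a ha =>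
  ⟨by simp [Prog.cost], trivial⟩

instance nil : Poly (Prog.nil : Prog A (List B)) := of_const 1 fun M w H hG X _ a ha =>
  ⟨by simp [Prog.cost], Nat.zero_le _, fun b hb => absurd hb (by simp [Prog.val])⟩

theorem within_cons {w : ℝ → ℕ} {H : ℕ → ℝ → Prop} (hG : Gauge w H) {s b : ℕ} {a : B}
    {l : List B} (ha : Within H s b a) (hl : Within H s b l) : Within H (s + 1) b (a :: l) := by
  refine ⟨Nat.succ_le_succ hl.1, fun c hc => ?_⟩
  rcases List.mem_cons.mp hc with rfl | hc
  · exact Sized.mono hG ha (by omega) le_rfl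
  · exact Sized.mono hG (hl.2 c hc) (by omega) le_rfl

instance cons : Poly (Prog.cons : Prog (B × List B) (List B)) :=
  of_const 1 fun M w H hG X _ a ha =>
  ⟨by simp [Prog.cost], Sized.mono hG (within_cons hG ha.1 ha.2) (by omega) (by omega)⟩

instance realZero : Poly (Prog.realZero : Prog A ℝ) := of_const 1 fun M w H hG X _ a ha =>
  ⟨by simp [Prog.cost], hG.mono hG.zero (by omega)⟩

instance realOne : Poly (Prog.realOne : Prog A ℝ) := of_const 1 fun M w H hG X _ a ha =>
  ⟨by simp [Prog.cost], hG.mono hG.one (by omega)⟩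

instance add : Poly Prog.add := of_const 10 fun M w H hG X _ a ha => by
  have h : H (X + X + 1) (a.1 + a.2) := hG.add ha.1 ha.2
  have h1 := hG.le ha.1
  have h2 := hG.le ha.2
  have h3 := hG.le h
  exact ⟨by simp only [Prog.cost]; omega, hG.mono h (by omega)⟩

instance sub : Poly Prog.sub := of_const 10 fun M w H hG X _ a ha => by
  have h : H (X + X + 1) (a.1 - a.2) := hG.sub ha.1 ha.2
  have h1 := hG.le ha.1
  have h2 := hG.le ha.2
  have h3 := hG.le h
  exact ⟨by simp only [Prog.cost]; omega, hG.mono h (by omega)⟩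

instance mul : Poly Prog.mul := of_const 10 fun M w H hG X _ a ha => by
  have h : H (X + X) (a.1 * a.2) := hG.mul ha.1 ha.2
  have h1 := hG.le ha.1
  have h2 := hG.le ha.2
  have h3 := hG.le h
  exact ⟨by simp only [Prog.cost]; omega, hG.mono h (by omega)⟩

instance div : Poly Prog.div := of_const 10 fun M w H hG X _ a ha => by
  have h : H (X + X) (a.1 / a.2) := hG.div ha.1 ha.2
  have h1 := hG.le ha.1
  have h2 := hG.le ha.2
  have h3 := hG.le h
  exact ⟨by simp only [Prog.cost]; omega, hG.mono h (by omega)⟩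

instance realLe : Poly Prog.realLe := of_const 10 fun M w H hG X _ a ha => by
  have h1 := hG.le ha.1
  have h2 := hG.le ha.2
  exact ⟨by simp only [Prog.cost]; omega, trivial⟩

instance utility : Poly Prog.utility := of_const 10 fun M w H hG X hX a ha => by
  have h := hX.utility a.1 a.2
  have h1 := hG.le h
  have h2 : a.2.length ≤ X := ha.2.1
  exact ⟨by simp only [Prog.cost]; omega, hG.mono h (by omega)⟩

instance share : Poly Prog.share := of_const 10 fun M w H hG X hX a ha => by
  have h := hX.share a.1 a.2.1 a.2.2
  have h1 := hG.le h
  have h2 : a.2.2.length ≤ X := ha.2.2.1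
  exact ⟨by simp only [Prog.cost]; omega, hG.mono h (by omega)⟩

open Prog

instance bind (e : Prog Γ A) (f : Prog (Γ × A) B) [Poly e] [Poly f] : Poly (bind e f) := by
  unfold Prog.bind; infer_instance
instance addE (e f : Prog Γ ℝ) [Poly e] [Poly f] : Poly (addE e f) := by
  unfold Prog.addE; infer_instance
instance subE (e f : Prog Γ ℝ) [Poly e] [Poly f] : Poly (subE e f) := by
  unfold Prog.subE; infer_instance
instance mulE (e f : Prog Γ ℝ) [Poly e] [Poly f] : Poly (mulE e f) := by
  unfold Prog.mulE; infer_instance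
instance divE (e f : Prog Γ ℝ) [Poly e] [Poly f] : Poly (divE e f) := by
  unfold Prog.divE; infer_instance
instance leE (e f : Prog Γ ℝ) [Poly e] [Poly f] : Poly (leE e f) := by
  unfold Prog.leE; infer_instance
instance ltE (e f : Prog Γ ℕ) [Poly e] [Poly f] : Poly (ltE e f) := by
  unfold Prog.ltE; infer_instance
instance succE (e : Prog Γ ℕ) [Poly e] : Poly (succE e) := by
  unfold Prog.succE; infer_instance
instance consE (e : Prog Γ A) (l : Prog Γ (List A)) [Poly e] [Poly l] : Poly (consE e l) := by
  unfold Prog.consE; infer_instance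
instance utilityE (i : Prog Γ ℕ) (l : Prog Γ (List ℕ)) [Poly i] [Poly l] :
    Poly (utilityE i l) := by
  unfold Prog.utilityE; infer_instance
instance shareE (i j : Prog Γ ℕ) (l : Prog Γ (List ℕ)) [Poly i] [Poly j] [Poly l] :
    Poly (shareE i j l) := by
  unfold Prog.shareE; infer_instance
instance eqE (e f : Prog Γ ℕ) [Poly e] [Poly f] : Poly (eqE e f) := by
  unfold Prog.eqE; infer_instance

instance natLit (k : ℕ) : Poly (natLit k : Prog Γ ℕ) := by
  induction k with
  | zero => unfold Prog.natLit; infer_instance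
  | succ k ih => unfold Prog.natLit; infer_instance

/-- A fold whose body increases the size of the state only by an amount that does not depend on
the state. -/
theorem fold (l : Prog Γ (List B)) (e : Prog Γ A) (f : Prog ((Γ × A) × B) A)
    [hl : Poly l] [he : Poly e] [hf : Poly f]
    (hg : ∃ g, PolyBdd g ∧ ∀ {n : ℕ} (M : Market n) (w : ℝ → ℕ) (H : ℕ → ℝ → Prop), Gauge w H →
      ∀ X, Answers M H X → ∀ γ b a Z, Within H X X γ → Within H X X b → Within H Z Z a →
        Within H (Z + g X) (Z + g X) (f.val M ((γ, a), b))) : Poly (fold l e f) := by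
  obtain ⟨d, hd⟩ := hl.bound
  obtain ⟨d', hd'⟩ := he.bound
  obtain ⟨k, hk⟩ := hf.bound
  obtain ⟨g, ⟨m, hm⟩, hg⟩ := hg
  set X' : ℕ → ℕ := fun X => X + (X + 2) ^ d with hX'
  have hp : PolyBdd X' := PolyBdd.id.add (PolyBdd.pow d)
  set Z : ℕ → ℕ := fun X => X' X + (X + 2) ^ d' + X' X * (X' X + 2) ^ m with hZ
  have hZp : PolyBdd Z := (hp.add (PolyBdd.pow d')).add (hp.mul (hp.comp_pow m))
  refine of_polyBdd (fun X => (X + 2) ^ d + (X + 2) ^ d' + X' X * ((Z X + 2) ^ k + 5) + 6) Z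
    ((((PolyBdd.pow d).add (PolyBdd.pow d')).add (hp.mul ((hZp.comp_pow k).add
      (PolyBdd.const 5)))).add (PolyBdd.const 6)) hZp fun M w H hG X hX γ hγ => ?_
  obtain ⟨h1, h2⟩ := hd M w H hG X hX γ hγ
  obtain ⟨h3, h4⟩ := hd' M w H hG X hX γ hγ
  have hlen : (l.val M γ).length ≤ X' X := h2.1.trans (by simp [hX'])
  have hXX : X ≤ X' X := by simp [hX']
  have hXZ : X' X ≤ Z X := by simp [hZ, add_assoc]
  have hZt : ∀ t ≤ X' X, (X + 2) ^ d' + t * (X' X + 2) ^ m ≤ Z X := by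
    intro t ht
    have := Nat.mul_le_mul_right ((X' X + 2) ^ m) ht
    simp only [hZ]
    omega
  -- Invariant: after `t` rounds the state has size at most its initial bound plus `t` equal
  -- increments. An increment depending on the state could compound to exponential growth.
  obtain ⟨h5, h6⟩ := fold_cost M w l e f γ ((Z X + 2) ^ k)
    (fun t a => Within H ((X + 2) ^ d' + t * (X' X + 2) ^ m) ((X + 2) ^ d' + t * (X' X + 2) ^ m) a)
    (Sized.mono hG h4 (by omega) (by omega)) (by
      intro t a b hb ht ha
      have hbw : Within H (X' X) (X' X) b := Sized.mono hG (h2.2 b hb) (by simp [hX'])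
        (by simp [hX'])
      have hγw : Within H (X' X) (X' X) γ := Sized.mono hG hγ hXX hXX
      have hZ1 := hZt t (by omega)
      refine ⟨(hk M w H hG (Z X) (hX.mono hG (hXX.trans hXZ)) ((γ, a), b)
        ⟨⟨Sized.mono hG hγw hXZ hXZ, Sized.mono hG ha hZ1 hZ1⟩, Sized.mono hG hbw hXZ hXZ⟩).1, ?_⟩
      have h7 := hg M w H hG (X' X) (hX.mono hG hXX) γ b a _ hγw hbw ha
      have h8 := hm (X' X)
      refine Sized.mono hG h7 ?_ ?_ <;> rw [add_mul] <;> omega)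
  refine ⟨h5.trans ?_, Sized.mono hG h6 (hZt _ hlen) (hZt _ hlen)⟩
  have := Nat.mul_le_mul_right ((Z X + 2) ^ k + 5) hlen
  omega

/-- An iteration whose body increases the size of the state only by an amount that does not depend
on the state. -/
theorem iter (k : Prog Γ ℕ) (e : Prog Γ A) (f : Prog (Γ × A) A)
    [hl : Poly k] [he : Poly e] [hf : Poly f]
    (hg : ∃ g, PolyBdd g ∧ ∀ {n : ℕ} (M : Market n) (w : ℝ → ℕ) (H : ℕ → ℝ → Prop), Gauge w H →
      ∀ X, Answers M H X → ∀ γ a Z, Within H X X γ → Within H Z Z a →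
        Within H (Z + g X) (Z + g X) (f.val M (γ, a))) : Poly (iter k e f) := by
  obtain ⟨d, hd⟩ := hl.bound
  obtain ⟨d', hd'⟩ := he.bound
  obtain ⟨k', hk⟩ := hf.bound
  obtain ⟨g, ⟨m, hm⟩, hg⟩ := hg
  set Z : ℕ → ℕ := fun X => X + (X + 2) ^ d' + (X + 2) ^ d * (X + 2) ^ m with hZ
  have hZp : PolyBdd Z := (PolyBdd.id.add (PolyBdd.pow d')).add ((PolyBdd.pow d).mul
    (PolyBdd.pow m))
  refine of_polyBdd (fun X => (X + 2) ^ d + (X + 2) ^ d' + (X + 2) ^ d * ((Z X + 2) ^ k' + 3) + 5) Z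
    ((((PolyBdd.pow d).add (PolyBdd.pow d')).add ((PolyBdd.pow d).mul ((hZp.comp_pow k').add
      (PolyBdd.const 3)))).add (PolyBdd.const 5)) hZp fun M w H hG X hX γ hγ => ?_
  obtain ⟨h1, h2⟩ := hd M w H hG X hX γ hγ
  obtain ⟨h3, h4⟩ := hd' M w H hG X hX γ hγ
  change k.val M γ ≤ (X + 2) ^ d at h2
  have hXZ : X ≤ Z X := by simp [hZ, add_assoc]
  have hZt : ∀ t ≤ (X + 2) ^ d, (X + 2) ^ d' + t * (X + 2) ^ m ≤ Z X := by
    intro t ht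
    have := Nat.mul_le_mul_right ((X + 2) ^ m) ht
    simp only [hZ]
    omega
  have hst : ∀ t, Within H ((X + 2) ^ d' + t * (X + 2) ^ m) ((X + 2) ^ d' + t * (X + 2) ^ m)
      ((fun a => f.val M (γ, a))^[t] (e.val M γ)) := by
    intro t
    induction t with
    | zero => exact Sized.mono hG h4 (by omega) (by omega)
    | succ t ih =>
      rw [Function.iterate_succ_apply']
      have h8 := hm X
      refine Sized.mono hG (hg M w H hG X hX γ _ _ hγ ih) ?_ ?_ <;> rw [add_mul] <;> omega
  have h5 := iter_cost M w k e f γ ((Z X + 2) ^ k') (by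
    intro t ht
    have hZ1 := hZt t (by omega)
    exact (hk M w H hG (Z X) (hX.mono hG hXZ) _
      ⟨Sized.mono hG hγ hXZ hXZ, Sized.mono hG (hst t) hZ1 hZ1⟩).1)
  refine ⟨h5.trans ?_, ?_⟩
  · have := Nat.mul_le_mul_right ((Z X + 2) ^ k' + 3) h2
    omega
  · rw [val_iter]
    exact Sized.mono hG (hst _) (hZt _ h2) (hZt _ h2)

theorem within_sum {w : ℝ → ℕ} {H : ℕ → ℝ → Prop} (hG : Gauge w H) {B : ℕ} {l : List ℝ}
    (h : ∀ x ∈ l, H B x) : H (l.length * (B + 1) + 1) l.sum := by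
  induction l with
  | nil => simpa using hG.zero
  | cons x l ih =>
    have := hG.add (h x (by simp)) (ih fun y hy => h y (by simp [hy]))
    simp only [List.sum_cons, List.length_cons]
    exact hG.mono this (by rw [add_mul]; omega)

instance reverseE (l : Prog Γ (List A)) [Poly l] : Poly (reverseE l) := by
  unfold Prog.reverseE
  refine fold _ _ _ ⟨fun X => X + 1, PolyBdd.id.add (PolyBdd.const 1), ?_⟩
  intro n M w H hG X hX γ b a Z hγ hb ha
  beta_reduce
  exact Sized.mono hG (within_cons hG (s := X + Z) (b := X + Z)
    (Sized.mono hG hb (by omega) (by omega)) (Sized.mono hG ha (by omega) (by omega)))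
    (by omega) (by omega)

instance appendE (k l : Prog Γ (List A)) [Poly k] [Poly l] : Poly (appendE k l) := by
  unfold Prog.appendE
  refine fold _ _ _ ⟨fun X => X + 1, PolyBdd.id.add (PolyBdd.const 1), ?_⟩
  intro n M w H hG X hX γ b a Z hγ hb ha
  beta_reduce
  exact Sized.mono hG (within_cons hG (s := X + Z) (b := X + Z)
    (Sized.mono hG hb (by omega) (by omega)) (Sized.mono hG ha (by omega) (by omega)))
    (by omega) (by omega)

instance mapE (l : Prog Γ (List B)) (f : Prog (Γ × B) A) [Poly l] [hf : Poly f] :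
    Poly (mapE l f) := by
  unfold Prog.mapE
  obtain ⟨d, hd⟩ := hf.bound
  refine @reverseE _ _ _ _ _ (fold _ _ _ ⟨fun X => (X + 2) ^ d + 1,
    (PolyBdd.pow d).add (PolyBdd.const 1), ?_⟩)
  intro n M w H hG X hX γ b a Z hγ hb ha
  beta_reduce
  have h := (hd M w H hG X hX (γ, b) ⟨hγ, hb⟩).2
  exact Sized.mono hG (within_cons hG (s := (X + 2) ^ d + Z) (b := (X + 2) ^ d + Z)
    (Sized.mono hG h (by omega) (by omega)) (Sized.mono hG ha (by omega) (by omega)))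
    (by omega) (by omega)

instance filterE (l : Prog Γ (List B)) (f : Prog (Γ × B) Bool) [Poly l] [hf : Poly f] :
    Poly (filterE l f) := by
  unfold Prog.filterE
  refine @reverseE _ _ _ _ _ (fold _ _ _ ⟨fun X => X + 1, PolyBdd.id.add (PolyBdd.const 1), ?_⟩)
  intro n M w H hG X hX γ b a Z hγ hb ha
  beta_reduce
  rw [val_cond]
  split
  · exact Sized.mono hG (within_cons hG (s := X + Z) (b := X + Z)
      (Sized.mono hG hb (by omega) (by omega)) (Sized.mono hG ha (by omega) (by omega)))
      (by omega) (by omega)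
  · exact Sized.mono hG ha (by omega) (by omega)

instance flatMapE (l : Prog Γ (List B)) (f : Prog (Γ × B) (List A)) [Poly l] [hf : Poly f] :
    Poly (flatMapE l f) := by
  unfold Prog.flatMapE
  obtain ⟨d, hd⟩ := hf.bound
  refine fold _ _ _ ⟨fun X => (X + 2) ^ d, PolyBdd.pow d, ?_⟩
  intro n M w H hG X hX γ b a Z hγ hb ha
  beta_reduce
  have h := (hd M w H hG X hX (γ, b) ⟨hγ, hb⟩).2
  rw [val_appendE]
  -- Lengths add up under concatenation, while the members come unchanged from one of the two lists;
  -- so the growth is additive.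
  refine ⟨?_, fun c hc => ?_⟩
  · have h1 := h.1
    have h2 := ha.1
    simp only [val_comp, val_pair, val_fst, val_snd, List.length_append] at h1 ⊢
    omega
  · rcases List.mem_append.mp hc with hc | hc
    · exact Sized.mono hG (h.2 c hc) (by omega) (by omega)
    · exact Sized.mono hG (ha.2 c hc) (by omega) (by omega)

instance sumE (l : Prog Γ (List B)) (f : Prog (Γ × B) ℝ) [Poly l] [hf : Poly f] :
    Poly (sumE l f) := by
  unfold Prog.sumE
  obtain ⟨d, hd⟩ := hf.bound
  refine fold _ _ _ ⟨fun X => (X + 2) ^ d + 1, (PolyBdd.pow d).add (PolyBdd.const 1), ?_⟩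
  intro n M w H hG X hX γ b a Z hγ hb ha
  beta_reduce
  exact hG.add ha (hd M w H hG X hX (γ, b) ⟨hγ, hb⟩).2

instance argmaxE (l : Prog Γ (List B)) (e : Prog Γ B) (f : Prog (Γ × B) ℝ) [Poly l] [Poly e]
    [hf : Poly f] : Poly (argmaxE l e f) := by
  unfold Prog.argmaxE
  refine fold _ _ _ ⟨fun X => X, PolyBdd.id, ?_⟩
  intro n M w H hG X hX γ b a Z hγ hb ha
  beta_reduce
  rw [val_cond]
  split
  · exact Sized.mono hG ha (by omega) (by omega)
  · exact Sized.mono hG hb (by omega) (by omega)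

instance addN (e f : Prog Γ ℕ) [Poly e] [Poly f] : Poly (addN e f) := by
  unfold Prog.addN
  refine iter _ _ _ ⟨fun _ => 1, PolyBdd.const 1, ?_⟩
  intro n M w H hG X hX γ a Z hγ ha
  exact Nat.succ_le_succ ha

instance mulN (e f : Prog Γ ℕ) [Poly e] [hf : Poly f] : Poly (mulN e f) := by
  unfold Prog.mulN
  obtain ⟨d, hd⟩ := hf.bound
  refine iter _ _ _ ⟨fun X => (X + 2) ^ d, PolyBdd.pow d, ?_⟩
  intro n M w H hG X hX γ a Z hγ ha
  have h1 : f.val M γ ≤ (X + 2) ^ d := (hd M w H hG X hX γ hγ).2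
  have h2 : a ≤ Z := ha
  change (Prog.addN (wk f) Prog.snd).val M (γ, a) ≤ Z + (X + 2) ^ d
  rw [val_addN]
  simp only [wk, val_comp, val_fst, val_snd]
  omega

instance rangeE (k : Prog Γ ℕ) [Poly k] : Poly (rangeE k) := by
  unfold Prog.rangeE
  have : Poly (Prog.iter k (Prog.natZero.pair Prog.nil)
    ((Prog.succE (Prog.fst.comp Prog.snd)).pair
      (Prog.consE (Prog.fst.comp Prog.snd) (Prog.snd.comp Prog.snd))) : Prog Γ (ℕ × List ℕ)) := by
    refine iter _ _ _ ⟨fun _ => 1, PolyBdd.const 1, ?_⟩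
    intro n M w H hG X hX γ a Z hγ ha
    exact ⟨Nat.succ_le_succ ha.1, Sized.mono hG (within_cons hG ha.1 ha.2) le_rfl (by omega)⟩
  infer_instance

instance castE (k : Prog Γ ℕ) [Poly k] : Poly (castE k) := by
  unfold Prog.castE
  refine iter _ _ _ ⟨fun _ => 2, PolyBdd.const 2, ?_⟩
  intro n M w H hG X hX γ a Z hγ ha
  exact hG.add ha hG.one

end Poly

end DataExchange

/-! ### Primitive recursive bounds for arbitrary programs, and counting up to `1 / ε` -/

namespace DataExchange
open Sized (Within)

/-! ## Size bounds for arbitrary programs -/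

/-- A hierarchy of fast growing functions. -/
def ack : ℕ → ℕ → ℕ
  | 0, s => s + 1
  | r + 1, s => (ack r)^[s + 2] s

theorem lt_ack (r s : ℕ) : s < ack r s := by
  induction r generalizing s with
  | zero => simp [ack]
  | succ r ih =>
    have h : ∀ k, s ≤ (ack r)^[k] s := by
      intro k
      induction k with
      | zero => simp
      | succ k ihk => rw [Function.iterate_succ_apply']; exact ihk.trans (ih _).le
    rw [ack, Function.iterate_succ_apply']
    exact (h _).trans_lt (ih _)

theorem ack_mono (r : ℕ) : Monotone (ack r) := by
  induction r with
  | zero => intro a b h; simp [ack, h]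
  | succ r ih =>
    intro a b h
    simp only [ack]
    refine (ih.iterate (a + 2) h).trans ?_
    exact Function.monotone_iterate_of_id_le (fun s => (lt_ack r s).le) (Nat.add_le_add_right h 2) b

theorem iterate_ack_mono (r : ℕ) {k m s t : ℕ} (h : k ≤ m) (hst : s ≤ t) :
    (ack r)^[k] s ≤ (ack r)^[m] t :=
  ((ack_mono r).iterate k hst).trans
    (Function.monotone_iterate_of_id_le (fun s => (lt_ack r s).le) h t)

/-- The `s + 2` iterations in the definition are at least two, so a composition costs only one level
of the hierarchy. -/
theorem ack_ack_le (r s : ℕ) : ack r (ack r s) ≤ ack (r + 1) s := by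
  change (ack r)^[2] s ≤ (ack r)^[s + 2] s
  exact iterate_ack_mono r (by omega) le_rfl

theorem ack_le_succ (r s : ℕ) : ack r s ≤ ack (r + 1) s :=
  ((lt_ack r _).le).trans (ack_ack_le r s)

theorem ack_le {r r' : ℕ} (h : r ≤ r') (s : ℕ) : ack r s ≤ ack r' s := by
  induction h with
  | refl => rfl
  | step _ ih => exact ih.trans (ack_le_succ _ s)

/-- Closed forms of the first levels: `ack 1 s + 2 = 2 * (s + 2)` and `ack 2 s + 2 = 2 ^ (s + 2) *
(s + 2)`. Squares, and through them products and sums, thus stay inside the hierarchy. -/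
theorem sq_le_ack (s : ℕ) : (s + 2) * (s + 2) ≤ ack 2 s + 2 := by
  have h1 : ∀ s, ack 1 s + 2 = 2 * (s + 2) := by
    intro s
    have : ∀ k, (ack 0)^[k] s = s + k := by
      intro k
      induction k with
      | zero => rfl
      | succ k ih => rw [Function.iterate_succ_apply', ih]; rfl
    rw [ack, this]
    ring
  have h2 : ∀ k, (ack 1)^[k] s + 2 = 2 ^ k * (s + 2) := by
    intro k
    induction k with
    | zero => simp
    | succ k ih => rw [Function.iterate_succ_apply', h1, ih]; ring
  rw [ack, h2]
  exact Nat.mul_le_mul_right _ (Nat.lt_two_pow_self).le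

/-- Functions below some level of the hierarchy. -/
def AckBdd (f : ℕ → ℕ) : Prop := ∃ r, ∀ s, f s ≤ ack r s

namespace AckBdd

theorem id : AckBdd fun s => s := ⟨0, fun s => (lt_ack 0 s).le⟩

theorem ack (r : ℕ) : AckBdd (ack r) := ⟨r, fun _ => le_rfl⟩

theorem of_le {f g : ℕ → ℕ} (hg : AckBdd g) (h : ∀ s, f s ≤ g s) : AckBdd f := by
  obtain ⟨r, hr⟩ := hg
  exact ⟨r, fun s => (h s).trans (hr s)⟩

theorem comp {f g : ℕ → ℕ} (hf : AckBdd f) (hg : AckBdd g) : AckBdd fun s => f (g s) := by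
  obtain ⟨r, hr⟩ := hf
  obtain ⟨r', hr'⟩ := hg
  refine ⟨max r r' + 1, fun s => ((hr _).trans ?_).trans (ack_ack_le _ s)⟩
  exact (ack_le (le_max_left r r') _).trans
    (ack_mono _ ((hr' s).trans (ack_le (le_max_right r r') s)))

theorem sq : AckBdd fun s => (s + 2) * (s + 2) :=
  (comp (ack 0) (comp (ack 0) (ack 2))).of_le fun s => sq_le_ack s

theorem mul {f g : ℕ → ℕ} (hf : AckBdd f) (hg : AckBdd g) : AckBdd fun s => f s * g s := by
  obtain ⟨r, hr⟩ := hf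
  obtain ⟨r', hr'⟩ := hg
  refine (comp sq (ack (max r r'))).of_le fun s => Nat.mul_le_mul ?_ ?_
  · exact ((hr s).trans (ack_le (le_max_left r r') s)).trans (by omega)
  · exact ((hr' s).trans (ack_le (le_max_right r r') s)).trans (by omega)

theorem add {f g : ℕ → ℕ} (hf : AckBdd f) (hg : AckBdd g) : AckBdd fun s => f s + g s := by
  refine (mul (comp (ack 0) hf) (comp (ack 0) hg)).of_le fun s => ?_
  simp only [DataExchange.ack]
  nlinarith [Nat.zero_le (f s * g s)]

theorem const (c : ℕ) : AckBdd fun _ => c := by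
  induction c with
  | zero => exact id.of_le fun _ => Nat.zero_le _
  | succ c ih => exact (comp (ack 0) ih).of_le fun _ => le_rfl

/-- Iteration costs one level: at argument `f s + g s` the next level iterates at least `f s` times
from a point at least `g s`. This handles loops. -/
theorem iterate (r : ℕ) {f g : ℕ → ℕ} (hf : AckBdd f) (hg : AckBdd g) :
    AckBdd fun s => (DataExchange.ack r)^[f s] (g s) :=
  (comp (ack (r + 1)) (hf.add hg)).of_le fun s => iterate_ack_mono r (by omega) (by omega)

end AckBdd

/-- The running time of `P` and the size of its result are bounded by a function in the hierarchy
of the numbers and list lengths in the input, and depend linearly on the size of the real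
numbers. -/
class Tame {A B : Type} [Sized A] [Sized B] (P : Prog A B) : Prop where
  bound : ∃ r : ℕ, ∀ {n : ℕ} (M : Market n) (w : ℝ → ℕ) (H : ℕ → ℝ → Prop), Gauge w H →
    ∀ s b, Answers M H b → ∀ a, Within H s b a →
      P.cost M w a ≤ ack r s * (b + 1) ∧ Within H (ack r s) (ack r s * (b + 1)) (P.val M a)

variable {Γ A B C D : Type} [Sized Γ] [Sized A] [Sized B] [Sized C] [Sized D]

theorem Tame.of_ackBdd {P : Prog A B} (f g : ℕ → ℕ) (hf : AckBdd f) (hg : AckBdd g)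
    (h : ∀ {n : ℕ} (M : Market n) (w : ℝ → ℕ) (H : ℕ → ℝ → Prop), Gauge w H →
      ∀ s b, Answers M H b → ∀ a, Within H s b a →
        P.cost M w a ≤ f s * (b + 1) ∧ Within H (g s) (g s * (b + 1)) (P.val M a)) : Tame P := by
  obtain ⟨d, hd⟩ := hf
  obtain ⟨e, he⟩ := hg
  refine ⟨max d e, fun M w H hG s b hX a ha => ?_⟩
  obtain ⟨h1, h2⟩ := h M w H hG s b hX a ha
  have h3 := (hd s).trans (ack_le (le_max_left d e) s)
  have h4 := (he s).trans (ack_le (le_max_right d e) s)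
  exact ⟨h1.trans (Nat.mul_le_mul_right _ h3), Sized.mono hG h2 h4 (Nat.mul_le_mul_right _ h4)⟩

namespace Tame

theorem of_const {P : Prog A B} (c : ℕ)
    (h : ∀ {n : ℕ} (M : Market n) (w : ℝ → ℕ) (H : ℕ → ℝ → Prop), Gauge w H →
      ∀ s b, Answers M H b → ∀ a, Within H s b a →
        P.cost M w a ≤ c * (b + 1) + s ∧ Within H (s + 1) (c * (b + 1)) (P.val M a)) : Tame P :=
  of_ackBdd (fun s => c + s) (fun s => c + s + 1) ((AckBdd.const c).add AckBdd.id)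
    (((AckBdd.const c).add AckBdd.id).add (AckBdd.const 1))
    fun M w H hG s b hX a ha => by
      obtain ⟨h1, h2⟩ := h M w H hG s b hX a ha
      have e : s ≤ s * (b + 1) := Nat.le_mul_of_pos_right s (by omega)
      exact ⟨by rw [add_mul]; omega, Sized.mono hG h2 (by omega)
        (Nat.mul_le_mul_right _ (by omega))⟩

instance id : Tame (Prog.id : Prog A A) := of_const 1 fun M w H hG s b _ a ha =>
  ⟨by simp only [Prog.cost]; omega, Sized.mono hG ha (by omega) (by omega)⟩

instance fst : Tame (Prog.fst : Prog (A × B) A) := of_const 1 fun M w H hG s b _ a ha =>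
  ⟨by simp only [Prog.cost]; omega, Sized.mono hG ha.1 (by omega) (by omega)⟩

instance snd : Tame (Prog.snd : Prog (A × B) B) := of_const 1 fun M w H hG s b _ a ha =>
  ⟨by simp only [Prog.cost]; omega, Sized.mono hG ha.2 (by omega) (by omega)⟩

/-- Natural numbers and list lengths in a result are bounded without reference to `b`, so the linear
factors in `b + 1` compose to a linear factor. This keeps the exact solver polynomial in the bit
length. -/
instance comp (g : Prog B C) (f : Prog A B) [hg : Tame g] [hf : Tame f] : Tame (g.comp f) := by
  obtain ⟨d, hd⟩ := hf.bound
  obtain ⟨e, he⟩ := hg.bound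
  have hp : AckBdd fun s => ack e (ack d s) * (ack d s + 1) :=
    ((AckBdd.ack e).comp (AckBdd.ack d)).mul ((AckBdd.ack d).add (AckBdd.const 1))
  refine of_ackBdd (fun s => ack d s + ack e (ack d s) * (ack d s + 1))
    (fun s => ack e (ack d s) * (ack d s + 1))
    ((AckBdd.ack d).add hp) hp fun M w H hG s b hX a ha => ?_
  obtain ⟨h1, h2⟩ := hd M w H hG s b hX a ha
  have h0 : 1 ≤ ack d s := by have := lt_ack d s; omega
  have hb : b ≤ ack d s * (b + 1) := by nlinarith
  obtain ⟨h3, h4⟩ := he M w H hG (ack d s) _ (hX.mono hG hb) _ h2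
  have hm : ack e (ack d s) * (ack d s * (b + 1) + 1) ≤
      ack e (ack d s) * (ack d s + 1) * (b + 1) := by
    rw [mul_assoc]
    exact Nat.mul_le_mul_left _ (by nlinarith)
  refine ⟨?_, Sized.mono hG h4 (Nat.le_mul_of_pos_right _ (by omega)) hm⟩
  simp only [Prog.cost]
  rw [add_mul]
  exact Nat.add_le_add h1 (h3.trans hm)

instance pair (f : Prog A B) (g : Prog A C) [hf : Tame f] [hg : Tame g] : Tame (f.pair g) := by
  obtain ⟨d, hd⟩ := hf.bound
  obtain ⟨e, he⟩ := hg.bound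
  have hp : AckBdd fun s => 1 + ack d s + ack e s :=
    ((AckBdd.const 1).add (AckBdd.ack d)).add (AckBdd.ack e)
  refine of_ackBdd _ _ hp hp fun M w H hG s b hX a ha => ?_
  obtain ⟨h1, h2⟩ := hd M w H hG s b hX a ha
  obtain ⟨h3, h4⟩ := he M w H hG s b hX a ha
  refine ⟨by simp only [Prog.cost, add_mul]; omega, ?_, ?_⟩
  · exact Sized.mono hG h2 (by omega) (by simp only [add_mul]; omega)
  · exact Sized.mono hG h4 (by omega) (by simp only [add_mul]; omega)

instance cond (c : Prog A Bool) (f g : Prog A B) [hc : Tame c] [hf : Tame f] [hg : Tame g] :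
    Tame (Prog.cond c f g) := by
  obtain ⟨k, hk⟩ := hc.bound
  obtain ⟨d, hd⟩ := hf.bound
  obtain ⟨e, he⟩ := hg.bound
  have hp : AckBdd fun s => 1 + ack k s + ack d s + ack e s :=
    (((AckBdd.const 1).add (AckBdd.ack k)).add (AckBdd.ack d)).add (AckBdd.ack e)
  refine of_ackBdd _ _ hp hp fun M w H hG s b hX a ha => ?_
  obtain ⟨h1, h2⟩ := hd M w H hG s b hX a ha
  obtain ⟨h3, h4⟩ := he M w H hG s b hX a ha
  obtain ⟨h5, _⟩ := hk M w H hG s b hX a ha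
  simp only [Prog.cost, Prog.val, add_mul]
  split
  · exact ⟨by omega, Sized.mono hG h2 (by omega) (by omega)⟩
  · exact ⟨by omega, Sized.mono hG h4 (by omega) (by omega)⟩

instance natZero : Tame (Prog.natZero : Prog A ℕ) := of_const 1 fun M w H hG s b _ a ha =>
  ⟨by simp only [Prog.cost]; omega, Nat.zero_le _⟩

instance natSucc : Tame Prog.natSucc := of_const 1 fun M w H hG s b _ a ha =>
  ⟨by simp only [Prog.cost]; omega, Nat.succ_le_succ ha⟩

instance natLt : Tame Prog.natLt := of_const 1 fun M w H hG s b _ a ha =>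
  ⟨by simp only [Prog.cost]; omega, trivial⟩

instance nil : Tame (Prog.nil : Prog A (List B)) := of_const 1 fun M w H hG s b _ a ha =>
  ⟨by simp only [Prog.cost]; omega, Nat.zero_le _, fun b hb => absurd hb (by simp [Prog.val])⟩

instance cons : Tame (Prog.cons : Prog (B × List B) (List B)) :=
  of_const 1 fun M w H hG s b _ a ha =>
  ⟨by simp only [Prog.cost]; omega,
    Sized.mono hG (Poly.within_cons hG ha.1 ha.2) (by omega) (by omega)⟩

instance realZero : Tame (Prog.realZero : Prog A ℝ) := of_const 1 fun M w H hG s b _ a ha =>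
  ⟨by simp only [Prog.cost]; omega, hG.mono hG.zero (by omega)⟩

instance realOne : Tame (Prog.realOne : Prog A ℝ) := of_const 1 fun M w H hG s b _ a ha =>
  ⟨by simp only [Prog.cost]; omega, hG.mono hG.one (by omega)⟩

instance add : Tame Prog.add := of_const 10 fun M w H hG s b _ a ha => by
  have h : H (b + b + 1) (a.1 + a.2) := hG.add ha.1 ha.2
  have h1 := hG.le ha.1
  have h2 := hG.le ha.2
  have h3 := hG.le h
  exact ⟨by simp only [Prog.cost]; omega, hG.mono h (by omega)⟩

instance sub : Tame Prog.sub := of_const 10 fun M w H hG s b _ a ha => by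
  have h : H (b + b + 1) (a.1 - a.2) := hG.sub ha.1 ha.2
  have h1 := hG.le ha.1
  have h2 := hG.le ha.2
  have h3 := hG.le h
  exact ⟨by simp only [Prog.cost]; omega, hG.mono h (by omega)⟩

instance mul : Tame Prog.mul := of_const 10 fun M w H hG s b _ a ha => by
  have h : H (b + b) (a.1 * a.2) := hG.mul ha.1 ha.2
  have h1 := hG.le ha.1
  have h2 := hG.le ha.2
  have h3 := hG.le h
  exact ⟨by simp only [Prog.cost]; omega, hG.mono h (by omega)⟩

instance div : Tame Prog.div := of_const 10 fun M w H hG s b _ a ha => by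
  have h : H (b + b) (a.1 / a.2) := hG.div ha.1 ha.2
  have h1 := hG.le ha.1
  have h2 := hG.le ha.2
  have h3 := hG.le h
  exact ⟨by simp only [Prog.cost]; omega, hG.mono h (by omega)⟩

instance realLe : Tame Prog.realLe := of_const 10 fun M w H hG s b _ a ha => by
  have h1 := hG.le ha.1
  have h2 := hG.le ha.2
  exact ⟨by simp only [Prog.cost]; omega, trivial⟩

instance utility : Tame Prog.utility := of_const 10 fun M w H hG s b hX a ha => by
  have h := hX.utility a.1 a.2
  have h1 := hG.le h
  have h2 : a.2.length ≤ s := ha.2.1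
  exact ⟨by simp only [Prog.cost]; omega, hG.mono h (by omega)⟩

instance share : Tame Prog.share := of_const 10 fun M w H hG s b hX a ha => by
  have h := hX.share a.1 a.2.1 a.2.2
  have h1 := hG.le h
  have h2 : a.2.2.length ≤ s := ha.2.2.1
  exact ⟨by simp only [Prog.cost]; omega, hG.mono h (by omega)⟩

/-- One step of a loop keeps the state within the iterates of a function of the hierarchy. -/
theorem step {A : Type} [Sized A] {r r' : ℕ} (hr : ∀ z, ack r z * (z + 1) ≤ ack r' z)
    {w : ℝ → ℕ} {H : ℕ → ℝ → Prop} (hG : Gauge w H) {z b : ℕ} {a : A}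
    (h : Within H (ack r z) (ack r z * (z * (b + 1) + 1)) a) :
    Within H (ack r' z) (ack r' z * (b + 1)) a := by
  refine Sized.mono hG h ((Nat.le_mul_of_pos_right _ (by omega)).trans (hr z)) ?_
  refine le_trans ?_ (Nat.mul_le_mul_right _ (hr z))
  rw [mul_assoc]
  exact Nat.mul_le_mul_left _ (by nlinarith)

theorem step_cost {r r' : ℕ} (hr : ∀ z, ack r z * (z + 1) ≤ ack r' z) (z b : ℕ) :
    ack r z * (z * (b + 1) + 1) ≤ ack r' z * (b + 1) := by
  refine le_trans ?_ (Nat.mul_le_mul_right _ (hr z))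
  rw [mul_assoc]
  exact Nat.mul_le_mul_left _ (by nlinarith)

/-- The factor `z + 1` pays for bit lengths: if the state has numbers of size `z * (b + 1)`, the
body of a loop sees that value in place of `b`. -/
theorem exists_step (r : ℕ) : ∃ r', ∀ z, ack r z * (z + 1) ≤ ack r' z :=
  (AckBdd.ack r).mul (AckBdd.id.add (AckBdd.const 1))

/-- No restriction on the growth of the body is needed here: the `t`-th state is bounded by the
`t`-th iterate of `ack r'` at `s + 1`, and these iterates remain in the hierarchy. Starting at `s +
1` keeps the bounds positive. -/
instance repeatN (f : Prog A A) [hf : Tame f] : Tame (Prog.repeatN f) := by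
  obtain ⟨r, hd⟩ := hf.bound
  obtain ⟨r', hr⟩ := exists_step r
  have hZ : AckBdd fun s => (ack r')^[s] (s + 1) :=
    AckBdd.iterate r' AckBdd.id (AckBdd.id.add (AckBdd.const 1))
  refine of_ackBdd (fun s => 1 + s * (1 + ack r' ((ack r')^[s] (s + 1))))
    (fun s => (ack r')^[s] (s + 1))
    ((AckBdd.const 1).add (AckBdd.id.mul ((AckBdd.const 1).add ((AckBdd.ack r').comp hZ)))) hZ
    fun M w H hG s b hX a ha => ?_
  have hk : a.1 ≤ s := ha.1
  have h1z : ∀ t, 1 ≤ (ack r')^[t] (s + 1) := fun t =>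
    (Nat.le_add_left 1 s).trans (iterate_ack_mono r' (Nat.zero_le t) le_rfl)
  have hst : ∀ t, Within H ((ack r')^[t] (s + 1)) ((ack r')^[t] (s + 1) * (b + 1))
      ((f.val M)^[t] a.2) ∧ f.cost M w ((f.val M)^[t] a.2) ≤
        ack r' ((ack r')^[t] (s + 1)) * (b + 1) := by
    intro t
    have hcost : ∀ z a, 1 ≤ z → Within H z (z * (b + 1)) a →
        f.cost M w a ≤ ack r' z * (b + 1) ∧
          Within H (ack r' z) (ack r' z * (b + 1)) (f.val M a) := by
      intro z a hz h
      obtain ⟨h1, h2⟩ := hd M w H hG z (z * (b + 1)) (hX.mono hG (by nlinarith)) a h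
      exact ⟨h1.trans (step_cost hr z b), step hr hG h2⟩
    have hw : Within H ((ack r')^[t] (s + 1)) ((ack r')^[t] (s + 1) * (b + 1))
        ((f.val M)^[t] a.2) := by
      induction t with
      | zero => exact Sized.mono hG ha.2 (by simp) (by simp; nlinarith)
      | succ t ih =>
        rw [Function.iterate_succ_apply', Function.iterate_succ_apply']
        exact (hcost _ _ (h1z t) ih).2
    exact ⟨hw, (hcost _ _ (h1z t) hw).1⟩
  constructor
  · simp only [Prog.cost]
    have : ∀ t ∈ Finset.range a.1, 1 + f.cost M w ((f.val M)^[t] a.2) ≤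
        (1 + ack r' ((ack r')^[s] (s + 1))) * (b + 1) := by
      intro t ht
      have h1 := (hst t).2
      have h2 := Nat.mul_le_mul_right (b + 1) (ack_mono r' (iterate_ack_mono r'
        (le_of_lt ((Finset.mem_range.mp ht).trans_le hk)) (le_refl (s + 1))))
      rw [add_mul]
      omega
    have h3 := Finset.sum_le_card_nsmul _ _ _ this
    simp only [Finset.card_range, smul_eq_mul] at h3
    have h4 := Nat.mul_le_mul_right ((1 + ack r' ((ack r')^[s] (s + 1))) * (b + 1)) hk
    rw [add_mul, mul_assoc]
    omega
  · have := iterate_ack_mono r' hk (le_refl (s + 1))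
    exact Sized.mono hG (hst a.1).1 this (Nat.mul_le_mul_right _ this)

instance forEach (f : Prog (A × B) A) [hf : Tame f] : Tame (Prog.forEach f) := by
  obtain ⟨r, hd⟩ := hf.bound
  obtain ⟨r', hr⟩ := exists_step r
  have hZ : AckBdd fun s => (ack r')^[s] (s + 1) :=
    AckBdd.iterate r' AckBdd.id (AckBdd.id.add (AckBdd.const 1))
  refine of_ackBdd (fun s => 1 + s * (1 + ack r' ((ack r')^[s] (s + 1))))
    (fun s => (ack r')^[s] (s + 1))
    ((AckBdd.const 1).add (AckBdd.id.mul ((AckBdd.const 1).add ((AckBdd.ack r').comp hZ)))) hZ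
    fun M w H hG s b hX a ha => ?_
  have hk : a.2.length ≤ s := ha.2.1
  have h1z : ∀ t, s + 1 ≤ (ack r')^[t] (s + 1) := fun t =>
    iterate_ack_mono r' (Nat.zero_le t) le_rfl
  have key : ∀ (l : List B) (t : ℕ) (x : A), (∀ y ∈ l, Within H s b y) → t + l.length ≤ s →
      Within H ((ack r')^[t] (s + 1)) ((ack r')^[t] (s + 1) * (b + 1)) x →
      forEachCost (fun s b => f.val M (s, b)) (fun s b => f.cost M w (s, b)) x l ≤
        1 + l.length * ((1 + ack r' ((ack r')^[s] (s + 1))) * (b + 1)) ∧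
      Within H ((ack r')^[s] (s + 1)) ((ack r')^[s] (s + 1) * (b + 1))
        (l.foldl (fun s b => f.val M (s, b)) x) := by
    intro l
    induction l with
    | nil =>
      intro t x _ ht hx
      have := iterate_ack_mono r' (show t ≤ s by simpa using ht) (le_refl (s + 1))
      exact ⟨by simp [forEachCost], Sized.mono hG hx this (Nat.mul_le_mul_right _ this)⟩
    | cons y l ih =>
      intro t x hl ht hx
      simp only [List.length_cons] at ht
      have hz := h1z t
      obtain ⟨h1, h2⟩ := hd M w H hG ((ack r')^[t] (s + 1)) ((ack r')^[t] (s + 1) * (b + 1))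
        (hX.mono hG (by nlinarith)) (x, y)
        ⟨hx, Sized.mono hG (hl y (by simp)) (by omega) (by nlinarith)⟩
      have h1' := h1.trans (step_cost hr _ b)
      have h2' := step hr hG h2
      rw [← Function.iterate_succ_apply' (ack r')] at h2'
      obtain ⟨h3, h4⟩ := ih (t + 1) _ (fun y hy => hl y (by simp [hy])) (by omega) h2'
      refine ⟨?_, h4⟩
      have h5 := Nat.mul_le_mul_right (b + 1) (ack_mono r' (iterate_ack_mono r'
        (show t ≤ s by omega) (le_refl (s + 1))))
      simp only [forEachCost, List.length_cons]
      rw [add_mul l.length, one_mul]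
      rw [add_mul 1 _ (b + 1)] at h3 ⊢
      omega
  obtain ⟨h1, h2⟩ := key a.2 0 a.1 ha.2.2 (by simpa using hk)
    (Sized.mono hG ha.1 (by simp) (by simp; nlinarith))
  refine ⟨?_, h2⟩
  have h4 := Nat.mul_le_mul_right ((1 + ack r' ((ack r')^[s] (s + 1))) * (b + 1)) hk
  simp only [Prog.cost]
  rw [add_mul, mul_assoc]
  omega

open Prog

instance iter (k : Prog Γ ℕ) (e : Prog Γ A) (f : Prog (Γ × A) A) [Tame k] [Tame e] [Tame f] :
    Tame (iter k e f) := by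
  unfold Prog.iter; infer_instance
instance fold (l : Prog Γ (List B)) (e : Prog Γ A) (f : Prog ((Γ × A) × B) A) [Tame l] [Tame e]
    [Tame f] : Tame (fold l e f) := by
  unfold Prog.fold; infer_instance
instance bind (e : Prog Γ A) (f : Prog (Γ × A) B) [Tame e] [Tame f] : Tame (bind e f) := by
  unfold Prog.bind; infer_instance
instance addE (e f : Prog Γ ℝ) [Tame e] [Tame f] : Tame (addE e f) := by
  unfold Prog.addE; infer_instance
instance subE (e f : Prog Γ ℝ) [Tame e] [Tame f] : Tame (subE e f) := by
  unfold Prog.subE; infer_instance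
instance mulE (e f : Prog Γ ℝ) [Tame e] [Tame f] : Tame (mulE e f) := by
  unfold Prog.mulE; infer_instance
instance divE (e f : Prog Γ ℝ) [Tame e] [Tame f] : Tame (divE e f) := by
  unfold Prog.divE; infer_instance
instance leE (e f : Prog Γ ℝ) [Tame e] [Tame f] : Tame (leE e f) := by
  unfold Prog.leE; infer_instance
instance ltE (e f : Prog Γ ℕ) [Tame e] [Tame f] : Tame (ltE e f) := by
  unfold Prog.ltE; infer_instance
instance succE (e : Prog Γ ℕ) [Tame e] : Tame (succE e) := by
  unfold Prog.succE; infer_instance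
instance consE (e : Prog Γ A) (l : Prog Γ (List A)) [Tame e] [Tame l] : Tame (consE e l) := by
  unfold Prog.consE; infer_instance
instance utilityE (i : Prog Γ ℕ) (l : Prog Γ (List ℕ)) [Tame i] [Tame l] :
    Tame (utilityE i l) := by
  unfold Prog.utilityE; infer_instance
instance shareE (i j : Prog Γ ℕ) (l : Prog Γ (List ℕ)) [Tame i] [Tame j] [Tame l] :
    Tame (shareE i j l) := by
  unfold Prog.shareE; infer_instance
instance eqE (e f : Prog Γ ℕ) [Tame e] [Tame f] : Tame (eqE e f) := by
  unfold Prog.eqE; infer_instance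
instance reverseE (l : Prog Γ (List A)) [Tame l] : Tame (reverseE l) := by
  unfold Prog.reverseE; infer_instance
instance appendE (k l : Prog Γ (List A)) [Tame k] [Tame l] : Tame (appendE k l) := by
  unfold Prog.appendE; infer_instance
instance mapE (l : Prog Γ (List B)) (f : Prog (Γ × B) A) [Tame l] [Tame f] :
    Tame (mapE l f) := by
  unfold Prog.mapE; infer_instance
instance filterE (l : Prog Γ (List B)) (f : Prog (Γ × B) Bool) [Tame l] [Tame f] :
    Tame (filterE l f) := by
  unfold Prog.filterE; infer_instance
instance flatMapE (l : Prog Γ (List B)) (f : Prog (Γ × B) (List A)) [Tame l] [Tame f] :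
    Tame (flatMapE l f) := by
  unfold Prog.flatMapE; infer_instance
instance sumE (l : Prog Γ (List B)) (f : Prog (Γ × B) ℝ) [Tame l] [Tame f] :
    Tame (sumE l f) := by
  unfold Prog.sumE; infer_instance
instance rangeE (k : Prog Γ ℕ) [Tame k] : Tame (rangeE k) := by
  unfold Prog.rangeE; infer_instance
instance castE (k : Prog Γ ℕ) [Tame k] : Tame (castE k) := by
  unfold Prog.castE; infer_instance

end Tame

/-! ## Reaching the threshold `1 / ε` -/

namespace Prog

/-- Increase the counter (given as a natural and as a real number) as the functions of the
hierarchy do, but stop when it reaches `1 / ε`. -/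
def grow : ℕ → Prog (ℝ × ℕ × ℝ) (ℕ × ℝ)
  | 0 => cond (leE realOne (mulE (snd.comp snd) fst)) snd
      ((succE (fst.comp snd)).pair (addE (snd.comp snd) realOne))
  | r + 1 => iter (succE (succE (fst.comp snd))) snd ((grow r).comp ((fst.comp fst).pair snd))

/-- The dichotomy behind the hybrid algorithm: either the counter reaches `1 / ε`, or it has grown
as far as `ack r k`. In both cases it does not exceed the larger of `k` and `⌈1 / ε⌉₊`, which keeps
the search cheap. -/
theorem grow_spec {n : ℕ} (M : Market n) {ε : ℝ} (hε : 0 < ε) (r k : ℕ) :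
    ∃ k' : ℕ, (grow r).val M (ε, k, (k : ℝ)) = (k', (k' : ℝ)) ∧ k ≤ k' ∧
      k' ≤ max k ⌈1 / ε⌉₊ ∧ (1 ≤ (k' : ℝ) * ε ∨ ack r k ≤ k') := by
  induction r generalizing k with
  | zero =>
    by_cases h : 1 ≤ (k : ℝ) * ε
    · exact ⟨k, by simp [grow, h], le_rfl, le_max_left _ _, Or.inl h⟩
    · refine ⟨k + 1, by simp [grow, h], by omega, ?_, Or.inr (by simp [ack])⟩
      -- The counter is increased only while it is below `1 / ε`.
      apply le_max_of_le_right
      rw [Nat.add_one_le_ceil_iff, lt_div_iff₀ hε]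
      exact not_le.mp h
  | succ r ih =>
    have h : ∀ t, ∃ k' : ℕ, (fun a => ((grow r).comp ((fst.comp fst).pair snd)).val M
        ((ε, k, (k : ℝ)), a))^[t] (k, (k : ℝ)) = (k', (k' : ℝ)) ∧ k ≤ k' ∧
        k' ≤ max k ⌈1 / ε⌉₊ ∧ (1 ≤ (k' : ℝ) * ε ∨ (ack r)^[t] k ≤ k') := by
      intro t
      induction t with
      | zero => exact ⟨k, rfl, le_rfl, le_max_left _ _, Or.inr le_rfl⟩
      | succ t iht =>
        obtain ⟨k', h1, h2, h3, h4⟩ := iht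
        obtain ⟨m, g1, g2, g3, g4⟩ := ih k'
        refine ⟨m, ?_, h2.trans g2, g3.trans (max_le h3 (le_max_right _ _)), ?_⟩
        · rw [Function.iterate_succ_apply', h1]
          exact g1
        · rcases h4 with h4 | h4
          · left
            exact h4.trans (mul_le_mul_of_nonneg_right (by exact_mod_cast g2) hε.le)
          · refine g4.imp_right fun h => ?_
            rw [Function.iterate_succ_apply']
            exact (ack_mono r h4).trans h
    obtain ⟨k', h1, h2⟩ := h (k + 2)
    exact ⟨k', by simpa only [grow, val_iter, val_succE, val_snd, val_comp, val_fst] using h1, h2⟩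

/-- Obtained by adding ones, hence linear rather than logarithmic in `k`; the counters are
themselves polynomially bounded, so this suffices. -/
theorem natCast_within {w : ℝ → ℕ} {H : ℕ → ℝ → Prop} (hG : Gauge w H) (k : ℕ) :
    H (2 * k + 1) (k : ℝ) := by
  induction k with
  | zero => simpa using hG.zero
  | succ k ih =>
    push_cast
    exact hG.mono (hG.add ih hG.one) (by omega)

/-- The nested loops keep every intermediate counter below `X` by `grow_spec`, because `⌈1 / ε⌉₊ ≤
X`. Hence each level of nesting multiplies the cost by a polynomial only, although the uncapped
counters would grow like `ack r`. -/
theorem grow_cost (r : ℕ) : ∃ d : ℕ, ∀ {n : ℕ} (M : Market n) (w : ℝ → ℕ) (H : ℕ → ℝ → Prop),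
    Gauge w H → ∀ X, Answers M H X → ∀ (ε : ℝ), 0 < ε → H X ε → ⌈1 / ε⌉₊ ≤ X → ∀ k ≤ X,
      (grow r).cost M w (ε, k, (k : ℝ)) ≤ (X + 2) ^ d := by
  induction r with
  | zero =>
    have hp : Poly (grow 0) := by unfold grow; infer_instance
    obtain ⟨d, hd⟩ := hp.bound
    obtain ⟨e, he⟩ := (((PolyBdd.const 2).mul PolyBdd.id).add (PolyBdd.const 1)).comp_pow d
    refine ⟨e, fun M w H hG X hX ε hε hw hc k hk => ?_⟩
    refine (hd M w H hG (2 * X + 1) (hX.mono hG (by omega)) _ ⟨?_, ?_, ?_⟩).1.trans (he X)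
    · exact hG.mono hw (by omega)
    · exact hk.trans (by omega)
    · exact hG.mono (natCast_within hG k) (by omega)
  | succ r ih =>
    obtain ⟨d, hd⟩ := ih
    obtain ⟨e, he⟩ := ((PolyBdd.const 4).add (PolyBdd.const 1)).add
      (((PolyBdd.id.add (PolyBdd.const 2)).mul (((PolyBdd.pow d).add (PolyBdd.const 10)).add
        (PolyBdd.const 3))).add (PolyBdd.const 10))
    refine ⟨e, fun M w H hG X hX ε hε hw hc k hk => le_trans ?_ (he X)⟩
    have h := iter_cost M w (succE (succE (fst.comp snd))) snd
      ((grow r).comp ((fst.comp fst).pair snd)) (ε, k, (k : ℝ)) ((X + 2) ^ d + 10) (by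
        intro t _
        have : ∃ k' : ℕ, (fun a => ((grow r).comp ((fst.comp fst).pair snd)).val M
            ((ε, k, (k : ℝ)), a))^[t] (k, (k : ℝ)) = (k', (k' : ℝ)) ∧ k' ≤ max k ⌈1 / ε⌉₊ := by
          induction t with
          | zero => exact ⟨k, rfl, le_max_left _ _⟩
          | succ t iht =>
            obtain ⟨k', h1, h3⟩ := iht (by omega)
            obtain ⟨m, g1, g2, g3, g4⟩ := grow_spec M hε r k'
            refine ⟨m, ?_, g3.trans (max_le h3 (le_max_right _ _))⟩
            rw [Function.iterate_succ_apply', h1]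
            exact g1
        obtain ⟨k', h1, h2⟩ := this
        simp only [val_snd]
        rw [h1]
        have h3 := hd M w H hG X hX ε hε hw hc k' (h2.trans (max_le hk hc))
        simp only [cost, val]
        omega)
    simp only [val_succE, val_comp, val_snd, val_fst] at h
    have h2 : (k + 2) * ((X + 2) ^ d + 10 + 3) ≤ (X + 2) * ((X + 2) ^ d + 10 + 3) :=
      Nat.mul_le_mul_right _ (by omega)
    have h3 : (succE (succE (fst.comp snd)) : Prog (ℝ × ℕ × ℝ) ℕ).cost M w (ε, k, (k : ℝ)) = 4 :=
      rfl
    have h4 : (snd : Prog (ℝ × ℕ × ℝ) (ℕ × ℝ)).cost M w (ε, k, (k : ℝ)) = 1 := rfl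
    change (grow (r + 1)).cost M w (ε, k, (k : ℝ)) ≤ _
    rw [grow]
    rw [show k + 1 + 1 = k + 2 from rfl] at h
    beta_reduce
    omega

end Prog

end DataExchange

/-! ### Cross-monotonicity, Lagrangian duality, approximate oracles and the subgradient potential -/

namespace DataExchange

/-! ## Cross-monotonicity -/

section Shapley

variable {n : ℕ}

/-- The agents of `S` that precede `j` in an order of all agents. -/
def before (S : Finset (Fin n)) (π : Equiv.Perm (Fin n)) (j : Fin n) : Finset (Fin n) :=
  S.filter fun k => π k < π j

/-- The order of `S` induced by an order of all agents. -/
theorem exists_induced_order (S : Finset (Fin n)) (π : Equiv.Perm (Fin n)) :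
    ∃ σ : S ≃ Fin S.card, ∀ k l : S, σ k < σ l ↔ π k < π l := by
  have hc : (S.map π.toEmbedding).card = S.card := Finset.card_map _
  refine ⟨(π.subtypeEquiv (p := fun x => x ∈ S) (q := fun x => x ∈ S.map π.toEmbedding)
    (by simp)).trans ((S.map π.toEmbedding).orderIsoOfFin hc).symm.toEquiv, fun k l => ?_⟩
  simp

/-- Permuting the members of `S` among themselves before applying `π` changes the induced order of
`S` by exactly that permutation. -/
theorem predecessors_comp (S : Finset (Fin n)) (π : Equiv.Perm (Fin n)) (τ : Equiv.Perm S)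
    (σ : S ≃ Fin S.card) (hσ : ∀ k l : S, σ k < σ l ↔ π k < π l) (j : S) :
    before S ((Equiv.Perm.ofSubtype τ).trans π) j = predecessors S (τ.trans σ) j := by
  ext k
  constructor
  · intro h
    obtain ⟨hk, h⟩ := Finset.mem_filter.mp h
    refine Finset.mem_map.mpr ⟨⟨k, hk⟩, Finset.mem_filter.mpr ⟨Finset.mem_univ _, ?_⟩, rfl⟩
    rw [Equiv.trans_apply, Equiv.trans_apply, hσ]
    rwa [Equiv.trans_apply, Equiv.trans_apply, show k = ((⟨k, hk⟩ : S) : Fin n) from rfl,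
      Equiv.Perm.ofSubtype_apply_coe, Equiv.Perm.ofSubtype_apply_coe] at h
  · intro h
    obtain ⟨k, hk, rfl⟩ := Finset.mem_map.mp h
    refine Finset.mem_filter.mpr ⟨k.2, ?_⟩
    have h := (Finset.mem_filter.mp hk).2
    rw [Equiv.trans_apply, Equiv.trans_apply, hσ] at h
    rwa [Equiv.trans_apply, Equiv.trans_apply, Function.Embedding.subtype_apply,
      Equiv.Perm.ofSubtype_apply_coe, Equiv.Perm.ofSubtype_apply_coe]

/-- The Shapley value as an average over the orders of all agents. -/
theorem shapley_eq (v : Finset (Fin n) → ℝ) (S : Finset (Fin n)) (j : S) :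
    shapley v S j = (∑ π : Equiv.Perm (Fin n),
      (v (insert (j : Fin n) (before S π j)) - v (before S π j))) / (n.factorial : ℝ) := by
  set F : Finset (Fin n) → ℝ := fun P => v (insert (j : Fin n) P) - v P with hF
  -- Precomposition with a fixed permutation is a bijection of the orders of all agents.
  have h1 : ∀ τ : Equiv.Perm S, ∑ π : Equiv.Perm (Fin n), F (before S π j) =
      ∑ π : Equiv.Perm (Fin n), F (before S ((Equiv.Perm.ofSubtype τ).trans π) j) := by
    intro τ
    exact (Equiv.sum_comp (Equiv.mulRight (Equiv.Perm.ofSubtype τ))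
      fun π => F (before S π j)).symm
  -- For fixed `π` the induced order runs once through all orders of `S` as `τ` varies.
  have h2 : ∀ π : Equiv.Perm (Fin n),
      ∑ τ : Equiv.Perm S, F (before S ((Equiv.Perm.ofSubtype τ).trans π) j) =
        ∑ σ : S ≃ Fin S.card, F (predecessors S σ j) := by
    intro π
    obtain ⟨σ, hσ⟩ := exists_induced_order S π
    simp only [predecessors_comp S π _ σ hσ]
    exact (Equiv.equivCongr (Equiv.refl S) σ).sum_comp fun σ => F (predecessors S σ j)
  -- Double counting over all pairs `(τ, π)`.
  have h3 : (S.card.factorial : ℝ) * ∑ π : Equiv.Perm (Fin n), F (before S π j) =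
      (n.factorial : ℝ) * ∑ σ : S ≃ Fin S.card, F (predecessors S σ j) := by
    have e1 : ∑ τ : Equiv.Perm S, ∑ π : Equiv.Perm (Fin n), F (before S π j) =
        ∑ π : Equiv.Perm (Fin n), ∑ σ : S ≃ Fin S.card, F (predecessors S σ j) := by
      rw [Finset.sum_congr rfl fun τ _ => h1 τ, Finset.sum_comm]
      exact Finset.sum_congr rfl fun π _ => h2 π
    simpa [Finset.sum_const, Fintype.card_perm] using e1
  have hS : (S.card.factorial : ℝ) ≠ 0 := by positivity
  have hn : (n.factorial : ℝ) ≠ 0 := by positivity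
  unfold shapley
  rw [div_eq_div_iff hS hn]
  linarith

/-- With both shares written as averages over the orders of all agents, they compare term by term:
in every order the predecessors of `j` in `T` are among those in `S`, and marginal gains diminish.
-/
theorem Market.Submodular.crossMonotonic {M : Market n} (h : M.Submodular) (hM : M.IsShapley) :
    M.CrossMonotonic := by
  intro i S T j hi hTS hj
  have e1 := hM i S hi ⟨j, hTS hj⟩
  have e2 := hM i T (fun h => hi (hTS h)) ⟨j, hj⟩
  simp only at e1 e2
  rw [e1, e2, shapley_eq, shapley_eq]
  refine div_le_div_of_nonneg_right (Finset.sum_le_sum fun π _ => ?_) (by positivity)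
  refine h i _ _ j (fun hc => hi (Finset.mem_of_mem_filter _ hc)) ?_ ?_ ?_
  · exact Finset.filter_subset_filter _ hTS
  · rintro rfl; exact hi (hTS hj)
  · simp [before]

end Shapley

variable {n : ℕ} {M : Market n}

/-- The point `a` is a convex combination of `0` and `b`, and `0 ≤ f 0` can be dropped. This is
average utility per unit of size decreasing with the size. -/
theorem concaveOn_slope_le {f : ℝ → ℝ} (hf : ConcaveOn ℝ (Set.Ici 0) f) (h0 : 0 ≤ f 0) {a b : ℝ}
    (ha : 0 < a) (hab : a ≤ b) : f b / b ≤ f a / a := by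
  have hb := ha.trans_le hab
  have h := hf.2 (show (0 : ℝ) ∈ Set.Ici 0 by simp) (show b ∈ Set.Ici 0 from hb.le)
    (show 0 ≤ 1 - a / b by rw [sub_nonneg, div_le_one hb]; exact hab)
    (show 0 ≤ a / b by positivity) (by ring)
  simp only [smul_eq_mul, mul_zero, zero_add] at h
  rw [div_mul_cancel₀ _ hb.ne'] at h
  have h2 : 0 ≤ (1 - a / b) * f 0 :=
    mul_nonneg (by rw [sub_nonneg, div_le_one hb]; exact hab) h0
  rw [div_le_div_iff₀ hb ha]
  have h3 : a / b * f b ≤ f a := by linarith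
  calc f b * a = a / b * f b * b := by field_simp
    _ ≤ f a * b := mul_le_mul_of_nonneg_right h3 hb.le

theorem SymmetricMarket.crossMonotonic (h : SymmetricMarket n M) : M.CrossMonotonic := by
  obtain ⟨hV, s, ⟨hs, f, hf⟩, hp⟩ := h
  intro i S T j hi hTS hj
  obtain ⟨hc, hm, hn, hu⟩ := hf i
  have hiT : i ∉ T := fun h => hi (hTS h)
  rw [hp i S hi j (hTS hj), hp i T hiT j hj, hu S hi, hu T hiT]
  rcases (hs i j).eq_or_lt with h0 | h0
  · simp [← h0]
  · have hT : 0 < ∑ k ∈ T, s i k :=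
      h0.trans_le (Finset.single_le_sum (fun k _ => hs i k) hj)
    have hTS' : ∑ k ∈ T, s i k ≤ ∑ k ∈ S, s i k :=
      Finset.sum_le_sum_of_subset_of_nonneg hTS fun _ _ _ => hs i _
    have := concaveOn_slope_le hc (hn 0 le_rfl) hT hTS'
    calc _ = s i j * (f i (∑ k ∈ S, s i k) / ∑ k ∈ S, s i k) := by ring
      _ ≤ s i j * (f i (∑ k ∈ T, s i k) / ∑ k ∈ T, s i k) := mul_le_mul_of_nonneg_left this h0.le
      _ = _ := by ring

theorem CrossMonotonicMarket.crossMonotonic (h : CrossMonotonicMarket n M) : M.CrossMonotonic :=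
  h.2.elim (fun h => h) fun h => h.1.crossMonotonic h.2

/-- Removing `j` does not lower the shares of the others, so `u (S \ {j})` is at least `u S` minus
the share of `j`; monotonicity of `u` makes this share non-negative. -/
theorem Market.Valid.share_nonneg (hV : M.Valid) (hc : M.CrossMonotonic) {i j : Fin n}
    {S : Finset (Fin n)} (hi : i ∉ S) (hj : j ∈ S) : 0 ≤ M.h i j S := by
  have hi' : i ∉ S.erase j := fun h => hi (Finset.mem_of_mem_erase h)
  have h1 := hV.sharing i S hi
  have h2 := hV.sharing i _ hi'
  have h3 := hV.mono i S _ hi (Finset.erase_subset j S)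
  have h4 : ∑ k ∈ S.erase j, M.h i k S ≤ ∑ k ∈ S.erase j, M.h i k (S.erase j) :=
    Finset.sum_le_sum fun k hk => hc i S _ k hi (Finset.erase_subset j S) hk
  rw [← Finset.add_sum_erase S _ hj] at h1
  linarith

theorem Market.Valid.share_le_one (hV : M.Valid) (hc : M.CrossMonotonic) {i j : Fin n}
    {S : Finset (Fin n)} (hi : i ∉ S) (hj : j ∈ S) : M.h i j S ≤ 1 :=
  (Finset.single_le_sum (fun _ hk => hV.share_nonneg hc hi hk) hj).trans
    ((hV.sharing i S hi).le.trans (hV.le_one i S hi))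

theorem Market.Valid.two_le (hV : M.Valid) : 2 ≤ n := by
  obtain ⟨i, hi⟩ := hV.scaled
  by_contra h
  have hn : n = 1 := by have := i.pos; omega
  subst hn
  have : (Finset.univ.erase i : Finset (Fin 1)) = ∅ := by
    ext j; simp [Subsingleton.elim j i]
  rw [this, hV.empty] at hi
  norm_num at hi

/-! ## Compression of the dual variables -/

open MeasureTheory in
/-- Shrinking all gaps longer than `L` between the numbers `Y i` to length `L`. -/
theorem exists_compression (Y : Fin n → ℝ) {L : ℝ} (hL : 0 < L) :
    ∃ z : Fin n → ℝ, (∀ i j, z j - z i ≤ n * L) ∧ (∀ i, |z i| ≤ |Y i|) ∧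
      ∀ i j, z i - z j < L → z j - z i ≤ Y j - Y i := by
  -- The compression map sends `y` to the signed length of the part of `U` between `0` and `y`. It
  -- is non-decreasing and `1`-Lipschitz, fixes `0`, and its total variation is the measure of `U`,
  -- at most `n * L`.
  set U : Set ℝ := ⋃ i, Set.Icc (Y i) (Y i + L) with hU
  have hUm : MeasurableSet U := MeasurableSet.iUnion fun i => measurableSet_Icc
  have hUv : volume U ≤ ENNReal.ofReal (n * L) := by
    refine (measure_iUnion_le _).trans ?_
    rw [tsum_fintype]
    simp only [Real.volume_Icc, add_sub_cancel_left]
    rw [Finset.sum_const, Finset.card_univ, Fintype.card_fin, nsmul_eq_mul,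
      ENNReal.ofReal_mul (by positivity), ENNReal.ofReal_natCast]
  have hUf : volume U ≠ ⊤ := (hUv.trans_lt ENNReal.ofReal_lt_top).ne
  set g : ℝ → ℝ := U.indicator fun _ => 1 with hg
  have hgi : Integrable g := (integrable_indicator_iff hUm).mpr (integrableOn_const hUf)
  have hgI : ∀ a b, IntervalIntegrable g volume a b := fun a b => hgi.intervalIntegrable
  have hdiff : ∀ a b, (∫ t in (0)..b, g t) - (∫ t in (0)..a, g t) = ∫ t in a..b, g t :=
    fun a b => intervalIntegral.integral_interval_sub_left (hgI _ _) (hgI _ _)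
  have hg0 : ∀ t, 0 ≤ g t := fun t => Set.indicator_nonneg (fun _ _ => zero_le_one) t
  have hg1 : ∀ t, g t ≤ 1 := fun t => Set.indicator_le_self' (fun _ _ => zero_le_one) t
  have hle : ∀ a b, a ≤ b → ∫ t in a..b, g t ≤ b - a := by
    intro a b hab
    calc ∫ t in a..b, g t ≤ ∫ t in a..b, (1 : ℝ) :=
          intervalIntegral.integral_mono_on hab (hgI _ _) (by simp) fun t _ => hg1 t
      _ = b - a := by simp
  have hnn : ∀ a b, a ≤ b → 0 ≤ ∫ t in a..b, g t := fun a b hab =>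
    intervalIntegral.integral_nonneg hab fun t _ => hg0 t
  refine ⟨fun i => ∫ t in (0)..(Y i), g t, fun i j => ?_, fun i => ?_, fun i j h => ?_⟩
  · simp only
    rw [hdiff]
    rcases le_total (Y i) (Y j) with hij | hij
    · rw [intervalIntegral.integral_of_le hij]
      refine (setIntegral_le_integral hgi (Filter.Eventually.of_forall hg0)).trans ?_
      rw [hg, integral_indicator hUm]
      simp only [integral_const, smul_eq_mul, mul_one, measureReal_def, Measure.restrict_apply,
        MeasurableSet.univ, Set.univ_inter]
      exact ENNReal.toReal_le_of_le_ofReal (by positivity) hUv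
    · rw [intervalIntegral.integral_symm]
      have := hnn _ _ hij
      have : 0 ≤ n * L := by positivity
      linarith
  · simp only
    rcases le_total 0 (Y i) with h0 | h0
    · rw [abs_of_nonneg (hnn _ _ h0), abs_of_nonneg h0]
      simpa using hle _ _ h0
    · rw [intervalIntegral.integral_symm, abs_neg, abs_of_nonneg (hnn _ _ h0), abs_of_nonpos h0]
      simpa using hle _ _ h0
  · simp only at h ⊢
    rw [hdiff] at h ⊢
    rcases le_total (Y i) (Y j) with hij | hij
    · exact hle _ _ hij
    -- To the right of `Y j` the map is an isometry on an interval of length `L`. So if the images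
    -- differ by less than `L`, the gap from `Y j` up to `Y i` was not shortened.
    · have hone : ∀ c, Y j ≤ c → c ≤ Y j + L → ∫ t in (Y j)..c, g t = c - Y j := by
        intro c hc hcL
        have : ∫ t in (Y j)..c, g t = ∫ t in (Y j)..c, (1 : ℝ) := by
          apply intervalIntegral.integral_congr
          intro t ht
          rw [Set.uIcc_of_le hc] at ht
          have hm : t ∈ U := by
            rw [hU]
            exact Set.mem_iUnion.mpr ⟨j, ht.1, ht.2.trans hcL⟩
          exact Set.indicator_of_mem hm _
        rw [this]
        simp
      rw [intervalIntegral.integral_symm]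
      by_cases hlong : Y i ≤ Y j + L
      · rw [hone _ hij hlong]
        linarith
      · exfalso
        have h1 := hone (Y j + L) (by linarith) le_rfl
        have h2 := hnn (Y j + L) (Y i) (by linarith)
        have h3 := intervalIntegral.integral_add_adjacent_intervals (hgI (Y j) (Y j + L))
          (hgI (Y j + L) (Y i))
        linarith

end DataExchange

namespace DataExchange

/-! ## The Lagrangian -/

variable {n : ℕ} {M : Market n}

theorem mem_bundles {i : Fin n} {S : Finset (Fin n)} : S ∈ bundles i ↔ i ∉ S := by
  simp only [bundles, Finset.mem_powerset]
  refine ⟨fun h hi => by simpa using h hi, fun h j hj => ?_⟩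
  refine Finset.mem_erase.mpr ⟨?_, Finset.mem_univ _⟩
  rintro rfl
  exact h hj

theorem Market.Valid.received_eq (hV : M.Valid) (x : Fin n → Finset (Fin n) → ℝ) (i : Fin n) :
    received M x i = ∑ S ∈ bundles i, M.u i S * x i S := by
  refine Finset.sum_congr rfl fun S hS => ?_
  rw [← Finset.sum_mul, hV.sharing i S (mem_bundles.mp hS)]

theorem contributed_eq (x : Fin n → Finset (Fin n) → ℝ) (i : Fin n) :
    contributed M x i = ∑ j, ∑ S ∈ bundles j, (if i ∈ S then M.h j i S else 0) * x j S := by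
  refine Finset.sum_congr rfl fun j _ => ?_
  rw [Finset.sum_filter]
  refine Finset.sum_congr rfl fun S _ => ?_
  split <;> simp

/-- The value for `i` of the set `S`, when `i` pays `c j` per unit of the share of `j`. -/
def score (M : Market n) (c : Fin n → ℝ) (i : Fin n) (S : Finset (Fin n)) : ℝ :=
  ∑ j ∈ S, M.h i j S * c j

theorem Market.Valid.score_eq (hV : M.Valid) (L : ℝ) (z : Fin n → ℝ) {i : Fin n}
    {S : Finset (Fin n)} (hi : i ∉ S) : score M (fun j => L + z j - z i) i S =
      L * M.u i S + ∑ j, z j * (if j ∈ S then M.h i j S else 0) - z i * M.u i S := by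
  have : ∑ j, z j * (if j ∈ S then M.h i j S else 0) = ∑ j ∈ S, M.h i j S * z j := by
    rw [← Finset.sum_filter_add_sum_filter_not Finset.univ (· ∈ S)]
    rw [Finset.sum_congr (g := fun j => M.h i j S * z j) (s₂ := S) (by ext; simp)
      (fun j hj => by rw [if_pos hj, mul_comm])]
    rw [Finset.sum_eq_zero (s := Finset.univ.filter fun j => ¬ j ∈ S), add_zero]
    intro j hj
    rw [if_neg (Finset.mem_filter.mp hj).2, mul_zero]
  rw [this, ← hV.sharing i S hi, score, Finset.mul_sum, Finset.mul_sum, ← Finset.sum_add_distrib,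
    ← Finset.sum_sub_distrib]
  exact Finset.sum_congr rfl fun j _ => by ring

/-- For fixed multipliers the right side is the Lagrangian of the linear program, and the left side
is a sum of independent problems, one for each agent. -/
theorem Market.Valid.lagrangian (hV : M.Valid) (L : ℝ) (z : Fin n → ℝ)
    (x : Fin n → Finset (Fin n) → ℝ) :
    ∑ i, ∑ S ∈ bundles i, score M (fun j => L + z j - z i) i S * x i S =
      L * welfare M x + ∑ i, z i * (contributed M x i - received M x i) := by
  have h1 : ∀ i, ∑ S ∈ bundles i, score M (fun j => L + z j - z i) i S * x i S =
      L * ∑ S ∈ bundles i, M.u i S * x i S +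
        ∑ j, z j * ∑ S ∈ bundles i, (if j ∈ S then M.h i j S else 0) * x i S -
        z i * received M x i := by
    intro i
    rw [hV.received_eq]
    simp only [Finset.mul_sum]
    rw [Finset.sum_comm (s := Finset.univ), ← Finset.sum_add_distrib, ← Finset.sum_sub_distrib]
    refine Finset.sum_congr rfl fun S hS => ?_
    rw [hV.score_eq L z (mem_bundles.mp hS), sub_mul, add_mul, Finset.sum_mul]
    simp only [mul_assoc]
  rw [Finset.sum_congr rfl fun i _ => h1 i, Finset.sum_sub_distrib, Finset.sum_add_distrib,
    ← Finset.mul_sum, Finset.sum_comm]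
  simp only [mul_sub, Finset.sum_sub_distrib, contributed_eq, welfare, Finset.mul_sum]
  ring

/-- Weak duality: violating balance by `ε` costs at most `ε * ∑ |z i|`. The bound is stated with a
dominating `Y` so that the compressed multipliers can be used as `z`. -/
theorem BalancedUpTo.le_lagrangian {ε : ℝ} {x : Fin n → Finset (Fin n) → ℝ} (hV : M.Valid)
    (hx : BalancedUpTo M ε x) (L : ℝ) {z Y : Fin n → ℝ} (hz : ∀ i, |z i| ≤ |Y i|) :
    L * welfare M x - ε * ∑ i, |Y i| ≤
      ∑ i, ∑ S ∈ bundles i, score M (fun j => L + z j - z i) i S * x i S := by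
  rw [hV.lagrangian, sub_eq_add_neg]
  gcongr
  rw [Finset.mul_sum, ← Finset.sum_neg_distrib]
  refine Finset.sum_le_sum fun i _ => ?_
  have h1 := hx.balance i
  rw [abs_sub_comm] at h1
  have h2 := neg_abs_le (z i * (contributed M x i - received M x i))
  rw [abs_mul] at h2
  have h3 : |z i| * |contributed M x i - received M x i| ≤ |Y i| * ε :=
    mul_le_mul (hz i) h1 (abs_nonneg _) (abs_nonneg _)
  linarith

/-- The total value of a solution, when a set of each agent is worth at most `b` plus a multiple of
its utility. -/
theorem BalancedUpTo.sum_le {ε : ℝ} {x : Fin n → Finset (Fin n) → ℝ}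
    (hx : BalancedUpTo M ε x) {F : Fin n → Finset (Fin n) → ℝ} {a : ℝ} {b : Fin n → ℝ}
    (hb : ∀ i, 0 ≤ b i) (h : ∀ i S, i ∉ S → F i S ≤ a * M.u i S + b i) :
    ∑ i, ∑ S ∈ bundles i, F i S * x i S ≤ a * welfare M x + ∑ i, b i := by
  have h1 : ∀ i, ∑ S ∈ bundles i, F i S * x i S ≤
      a * ∑ S ∈ bundles i, M.u i S * x i S + b i := by
    intro i
    calc ∑ S ∈ bundles i, F i S * x i S
        ≤ ∑ S ∈ bundles i, (a * M.u i S + b i) * x i S :=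
          Finset.sum_le_sum fun S hS =>
            mul_le_mul_of_nonneg_right (h i S (mem_bundles.mp hS)) (hx.nonneg i S hS)
      _ = a * ∑ S ∈ bundles i, M.u i S * x i S + b i * ∑ S ∈ bundles i, x i S := by
          rw [Finset.mul_sum, Finset.mul_sum, ← Finset.sum_add_distrib]
          exact Finset.sum_congr rfl fun S _ => by ring
      _ ≤ _ := by
          have := mul_le_mul_of_nonneg_left (hx.sum_le_one i) (hb i)
          linarith
  refine (Finset.sum_le_sum fun i _ => h1 i).trans ?_
  rw [Finset.sum_add_distrib, ← Finset.mul_sum]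
  rfl

/-- A solution of welfare `ε`. -/
theorem Market.Valid.exists_welfare_eq (hV : M.Valid) (hc : M.CrossMonotonic) {ε : ℝ}
    (h0 : 0 < ε) (h1 : ε < 1) : ∃ x, BalancedUpTo M ε x ∧ welfare M x = ε := by
  obtain ⟨a, ha⟩ := hV.scaled
  set X := Finset.univ.erase a with hX
  have haX : a ∉ X := by simp [hX]
  -- An agent of maximal utility `1` receives all other data with probability `ε`. No share exceeds
  -- `1`, so no balance is violated by more than `ε`.
  set x : Fin n → Finset (Fin n) → ℝ := fun i S => if i = a ∧ S = X then ε else 0 with hx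
  have key : ∀ (F : Fin n → Finset (Fin n) → ℝ) (i : Fin n),
      ∑ S ∈ bundles i, F i S * x i S = if i = a then F a X * ε else 0 := by
    intro F i
    split
    · rename_i hi
      subst hi
      rw [Finset.sum_eq_single X]
      · simp [hx]
      · intro S _ hS; simp [hx, hS]
      · intro h; exact absurd (mem_bundles.mpr haX) h
    · rename_i hi
      exact Finset.sum_eq_zero fun S _ => by simp [hx, hi]
  refine ⟨x, ⟨?_, ?_, ?_⟩, ?_⟩
  · intro i S _
    simp only [hx]
    split <;> linarith
  · intro i
    have := key (fun _ _ => 1) i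
    simp only [one_mul] at this
    rw [this]
    split <;> linarith
  · intro i
    rw [hV.received_eq, key, contributed_eq]
    have : ∀ j, ∑ S ∈ bundles j, (if i ∈ S then M.h j i S else 0) * x j S =
        if j = a then (if i ∈ X then M.h a i X else 0) * ε else 0 :=
      fun j => key (fun j S => if i ∈ S then M.h j i S else 0) j
    rw [Finset.sum_congr rfl fun j _ => this j]
    simp only [Finset.sum_ite_eq', Finset.mem_univ, if_true]
    by_cases hi : i = a
    · subst hi
      rw [if_pos rfl, if_neg haX, ha, zero_mul, sub_zero, one_mul, abs_of_pos h0]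
    · have hiX : i ∈ X := by simp [hX, hi]
      rw [if_neg hi, if_pos hiX, zero_sub, abs_neg, abs_of_nonneg
        (mul_nonneg (hV.share_nonneg hc haX hiX) h0.le)]
      have := mul_le_mul_of_nonneg_right (hV.share_le_one hc haX hiX) h0.le
      linarith
  · rw [welfare, Finset.sum_congr rfl fun i _ => key M.u i]
    simp [ha]

/-! ## Quality of the candidate sets -/

/-- Level sets of the dual variables are nearly optimal for cross-monotonic sharing. -/
theorem level_bound (hV : M.Valid) (hc : M.CrossMonotonic) {L : ℝ} (hL : 0 < L)
    {Y z : Fin n → ℝ} (hz1 : ∀ i j, z j - z i ≤ n * L)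
    (hz3 : ∀ i j, z i - z j < L → z j - z i ≤ Y j - Y i) (K : ℕ) (hK : n + 1 < 2 ^ (K - 1))
    (i : Fin n) {best : ℝ} (hb0 : 0 ≤ best)
    (hb : ∀ m, score M (fun j => L + Y j - Y i) i
      (Finset.univ.filter fun j => j ≠ i ∧ Y m ≤ Y j) ≤ best)
    {S : Finset (Fin n)} (hi : i ∉ S) :
    score M (fun j => L + z j - z i) i S ≤ L / 2 * M.u i S + 2 * K * best := by
  have hK1 : 1 ≤ K := by
    by_contra h
    have : K - 1 = 0 := by omega
    rw [this] at hK
    omega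
  -- Dyadic price thresholds, starting at `L / 2`. The set `B k` below consists of the agents whose
  -- uncompressed price is at least the `k`-th threshold.
  set τ : ℕ → ℝ := fun k => L * 2 ^ k / 2 with hτ
  have hτ0 : ∀ k, 0 < τ k := fun k => by simp only [hτ]; positivity
  set c : Fin n → ℝ := fun j => L + Y j - Y i with hcdef
  set B : ℕ → Finset (Fin n) := fun k => Finset.univ.filter fun j => j ≠ i ∧ τ k ≤ c j with hB
  have hiB : ∀ k, i ∉ B k := fun k => by simp [hB]
  have hnn : ∀ j ∈ S, 0 ≤ M.h i j S := fun j hj => hV.share_nonneg hc hi hj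
  -- Each member of `B k` has price at least `τ k`, and `B k` is one of the candidate level sets,
  -- cut at its least value of `Y`.
  have hblock : ∀ k, τ k * M.u i (B k) ≤ best := by
    intro k
    have h1 : τ k * M.u i (B k) ≤ score M c i (B k) := by
      rw [← hV.sharing i _ (hiB k), Finset.mul_sum]
      refine Finset.sum_le_sum fun j hj => ?_
      rw [mul_comm]
      exact mul_le_mul_of_nonneg_left (by simp [hB] at hj; exact hj.2)
        (hV.share_nonneg hc (hiB k) hj)
    refine h1.trans ?_
    rcases (B k).eq_empty_or_nonempty with he | hne
    · rw [he]; simpa [score] using hb0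
    · obtain ⟨m, hm, hmin⟩ := Finset.exists_min_image (B k) Y hne
      have : B k = Finset.univ.filter fun j => j ≠ i ∧ Y m ≤ Y j := by
        ext j
        simp only [hB, Finset.mem_filter, Finset.mem_univ, true_and] at hm hmin ⊢
        constructor
        · intro h; exact ⟨h.1, hmin j h⟩
        · intro h
          refine ⟨h.1, hm.2.trans ?_⟩
          simp only [hcdef]
          linarith [h.2]
      rw [this]
      exact hb m
  -- A price up to `L / 2` is charged to the utility of `S`. A larger compressed price lies in a
  -- dyadic class `[τ k, 2 * τ k)` with `k < K`, and is charged to `B k`.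
  have hpt : ∀ j ∈ S, M.h i j S * (L + z j - z i) ≤ M.h i j S * (L / 2) +
      ∑ k ∈ Finset.range K, 2 * τ k * (if j ∈ B k then M.h i j S else 0) := by
    intro j hj
    have hji : j ≠ i := by rintro rfl; exact hi hj
    have hsum : ∀ k ∈ Finset.range K, 0 ≤ 2 * τ k * (if j ∈ B k then M.h i j S else 0) := by
      intro k _
      refine mul_nonneg (by linarith [hτ0 k]) ?_
      split
      · exact hnn j hj
      · exact le_rfl
    by_cases hsmall : L + z j - z i ≤ L / 2
    · have := mul_le_mul_of_nonneg_left hsmall (hnn j hj)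
      have := Finset.sum_nonneg hsum
      linarith
    · push Not at hsmall
      have hex : ∃ k, L + z j - z i < 2 * τ k ∧ k < K := by
        -- Compressed prices are at most `(n + 1) * L`, which is less than `2 * τ (K - 1) = L * 2 ^
        -- (K - 1)`.
        refine ⟨K - 1, ?_, by omega⟩
        have h1 := hz1 i j
        have h2 : ((n : ℝ) + 1) < 2 ^ (K - 1) := by exact_mod_cast hK
        have h3 := mul_lt_mul_of_pos_left h2 hL
        simp only [hτ]
        linarith
      classical
      have hk := Nat.find_spec hex
      have hmin := fun m hm => Nat.find_min (m := m) hex hm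
      set k := Nat.find hex
      have hle : τ k ≤ L + z j - z i := by
        rcases Nat.eq_zero_or_pos k with h0 | hpos
        · rw [h0]; simp only [hτ, pow_zero, mul_one]; exact hsmall.le
        · have := hmin (k - 1) (by omega)
          simp only [not_and, not_lt] at this
          by_contra hcon
          push Not at hcon
          have e : 2 * τ (k - 1) = τ k := by
            simp only [hτ]
            obtain ⟨m, hm⟩ : ∃ m, k = m + 1 := ⟨k - 1, by omega⟩
            rw [hm, pow_succ]
            simp only [Nat.add_sub_cancel]
            ring
          have := this (by rw [e]; exact hcon)
          have := hk.2
          omega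
      have hjB : j ∈ B k := by
        simp only [hB, Finset.mem_filter, Finset.mem_univ, true_and]
        refine ⟨hji, hle.trans ?_⟩
        -- The compressed price is positive, so the last property of the compression applies: the
        -- true price is at least as large, and `j` belongs to `B k`.
        have := hz3 i j (by linarith [hτ0 k])
        simp only [hcdef]
        linarith
      have h1 := Finset.single_le_sum hsum (Finset.mem_range.mpr hk.2)
      rw [if_pos hjB] at h1
      have h2 := mul_le_mul_of_nonneg_left hk.1.le (hnn j hj)
      have h3 : 0 ≤ M.h i j S * (L / 2) := mul_nonneg (hnn j hj) (by linarith)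
      linarith
  -- Cross-monotonicity: passing from `S` to `S ∩ B k` does not lower the shares of the remaining
  -- agents, and there the shares add up to a utility.
  have hmass : ∀ k, ∑ j ∈ S, (if j ∈ B k then M.h i j S else 0) ≤ M.u i (B k) := by
    intro k
    rw [← Finset.sum_filter]
    set T := S.filter (· ∈ B k) with hT
    have hTS : T ⊆ S := Finset.filter_subset _ _
    have hiT : i ∉ T := fun h => hi (hTS h)
    calc ∑ j ∈ T, M.h i j S ≤ ∑ j ∈ T, M.h i j T :=
          Finset.sum_le_sum fun j hj => hc i S T j hi hTS hj
      _ = M.u i T := hV.sharing i T hiT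
      _ ≤ M.u i (B k) := hV.mono i _ _ (hiB k) fun j hj => (Finset.mem_filter.mp hj).2
  calc score M (fun j => L + z j - z i) i S
      ≤ ∑ j ∈ S, (M.h i j S * (L / 2) +
          ∑ k ∈ Finset.range K, 2 * τ k * (if j ∈ B k then M.h i j S else 0)) :=
        Finset.sum_le_sum hpt
    _ = L / 2 * M.u i S + ∑ k ∈ Finset.range K, 2 * τ k *
          ∑ j ∈ S, (if j ∈ B k then M.h i j S else 0) := by
        rw [Finset.sum_add_distrib, ← Finset.sum_mul, hV.sharing i S hi, Finset.sum_comm,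
          mul_comm]
        simp only [Finset.mul_sum]
    _ ≤ L / 2 * M.u i S + ∑ _k ∈ Finset.range K, 2 * best := by
        refine add_le_add le_rfl (Finset.sum_le_sum fun k _ => ?_)
        have h1 := mul_le_mul_of_nonneg_left (hmass k) (show 0 ≤ 2 * τ k by linarith [hτ0 k])
        linarith [hblock k]
    _ = _ := by simp; ring

/-- In the symmetric setting, a set of larger linear value and of hardly larger size has nearly the
same score. Sizes are measured by the shares `h i j X` of the set `X` of all other agents. -/
theorem SymmetricMarket.score_le (h : SymmetricMarket n M) {δ : ℝ} (hδ : 0 ≤ δ) {c : Fin n → ℝ}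
    {i : Fin n} {S S' : Finset (Fin n)} (hi : i ∉ S) (hi' : i ∉ S') (hpos : 0 < score M c i S)
    (hN : ∑ j ∈ S, M.h i j (Finset.univ.erase i) * c j ≤
      ∑ j ∈ S', M.h i j (Finset.univ.erase i) * c j)
    (ha : ∑ j ∈ S', M.h i j (Finset.univ.erase i) ≤
      (1 + δ) * ∑ j ∈ S, M.h i j (Finset.univ.erase i)) :
    score M c i S ≤ (1 + δ) * score M c i S' := by
  obtain ⟨hV, s, ⟨hs, f, hf⟩, hp⟩ := h
  obtain ⟨hc, hm, hn, hu⟩ := hf i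
  set X := Finset.univ.erase i with hX
  have hiX : i ∉ X := by simp [hX]
  have hsub : ∀ T : Finset (Fin n), i ∉ T → T ⊆ X := fun T hT j hj =>
    Finset.mem_erase.mpr ⟨by rintro rfl; exact hT hj, Finset.mem_univ _⟩
  set σ : Finset (Fin n) → ℝ := fun T : Finset (Fin n) => ∑ k ∈ T, s i k with hσ
  have hσ0 : ∀ T, 0 ≤ σ T := fun _ => Finset.sum_nonneg fun k _ => hs i k
  -- The score is the utility per unit of size times a linear function of the set.
  have hscore : ∀ T : Finset (Fin n), i ∉ T →
      score M c i T = f i (σ T) / σ T * ∑ j ∈ T, s i j * c j := by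
    intro T hT
    rw [score, Finset.mul_sum]
    refine Finset.sum_congr rfl fun j hj => ?_
    rw [hp i T hT j hj, hu T hT]
    ring
  rw [hscore S hi] at hpos ⊢
  rw [hscore S' hi']
  have hg0 : ∀ T, 0 ≤ f i (σ T) / σ T := fun T => div_nonneg (hn _ (hσ0 T)) (hσ0 T)
  have hgS : 0 < f i (σ S) / σ S := by
    rcases (hg0 S).eq_or_lt with h0 | h0
    · rw [← h0, zero_mul] at hpos; exact absurd hpos (lt_irrefl 0)
    · exact h0
  have hSpos : 0 < σ S := by
    rcases (hσ0 S).eq_or_lt with h0 | h0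
    · rw [← h0, div_zero] at hgS; exact absurd hgS (lt_irrefl 0)
    · exact h0
  have hfS : 0 < f i (σ S) := by
    have := mul_pos hgS hSpos
    rwa [div_mul_cancel₀ _ hSpos.ne'] at this
  have hlS : 0 < ∑ j ∈ S, s i j * c j := pos_of_mul_pos_right hpos (hg0 S)
  have hSX : σ S ≤ σ X :=
    Finset.sum_le_sum_of_subset_of_nonneg (hsub S hi) fun _ _ _ => hs i _
  set κ := f i (σ X) / σ X with hκ
  have hκ0 : 0 < κ :=
    div_pos (hfS.trans_le (hm (hσ0 S) (hσ0 X) hSX)) (hSpos.trans_le hSX)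
  -- The sizes `s` are not accessible to an algorithm, but the shares of the full set are
  -- proportional to them, with a positive factor `κ` that cancels.
  have hshare : ∀ T : Finset (Fin n), i ∉ T → ∀ j ∈ T, M.h i j X = κ * s i j := by
    intro T hT j hj
    rw [hp i X hiX j (hsub T hT hj), hu X hiX]
    simp only [hκ, hσ]
    ring
  have e1 : ∀ T : Finset (Fin n), i ∉ T → ∑ j ∈ T, M.h i j X * c j = κ * ∑ j ∈ T, s i j * c j := by
    intro T hT
    rw [Finset.mul_sum]
    exact Finset.sum_congr rfl fun j hj => by rw [hshare T hT j hj]; ring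
  have e2 : ∀ T : Finset (Fin n), i ∉ T → ∑ j ∈ T, M.h i j X = κ * σ T := by
    intro T hT
    simp only [hσ]
    rw [Finset.mul_sum]
    exact Finset.sum_congr rfl fun j hj => hshare T hT j hj
  rw [e1 S hi, e1 S' hi'] at hN
  rw [e2 S hi, e2 S' hi'] at ha
  have hN' : ∑ j ∈ S, s i j * c j ≤ ∑ j ∈ S', s i j * c j := le_of_mul_le_mul_left hN hκ0
  have ha' : σ S' ≤ (1 + δ) * σ S := by
    refine le_of_mul_le_mul_left ?_ hκ0
    linarith
  have hS'pos : 0 < σ S' := by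
    rcases (hσ0 S').eq_or_lt with h0 | h0
    · exfalso
      have hz : ∀ k ∈ S', s i k = 0 :=
        (Finset.sum_eq_zero_iff_of_nonneg (s := S') fun k _ => hs i k).mp h0.symm
      rw [Finset.sum_eq_zero (s := S') fun j hj => by rw [hz j hj, zero_mul]] at hN'
      linarith
    · exact h0
  -- If `S'` is smaller than `S`, its utility per unit is no worse by concavity. If it is larger,
  -- its utility is no smaller and its size exceeds that of `S` by a factor of at most `1 + δ`.
  have hgg : f i (σ S) / σ S ≤ (1 + δ) * (f i (σ S') / σ S') := by
    rcases le_total (σ S') (σ S) with hle | hle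
    · have h1 := concaveOn_slope_le hc (hn 0 le_rfl) hS'pos hle
      have h2 := mul_nonneg hδ (hg0 S')
      linarith
    · have h1 : f i (σ S) ≤ f i (σ S') := hm (hσ0 S) (hσ0 S') hle
      rw [mul_div_assoc', div_le_div_iff₀ hSpos hS'pos]
      calc f i (σ S) * σ S' ≤ f i (σ S') * ((1 + δ) * σ S) :=
            mul_le_mul h1 ha' hS'pos.le (hn _ (hσ0 S'))
        _ = _ := by ring
  calc f i (σ S) / σ S * ∑ j ∈ S, s i j * c j
      ≤ ((1 + δ) * (f i (σ S') / σ S')) * ∑ j ∈ S', s i j * c j :=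
        mul_le_mul hgg hN' hlS.le (mul_nonneg (by linarith) (hg0 S'))
    _ = _ := by ring

/-! ## Drift of the dual variables -/

/-- Contribution minus receipt of agent `i`, when each agent `j` receives `A j`. -/
def imbalance (M : Market n) (A : Fin n → Finset (Fin n)) (i : Fin n) : ℝ :=
  ∑ j, (if i ∈ A j then M.h j i (A j) else 0) - M.u i (A i)

/-- The Lagrangian identity for one deterministic choice of sets. It turns a lower bound on the
scores into one on the inner product of `Y` with the imbalance. -/
theorem Market.Valid.sum_score (hV : M.Valid) {A : Fin n → Finset (Fin n)} (hA : ∀ i, i ∉ A i)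
    (L : ℝ) (Y : Fin n → ℝ) :
    ∑ i, score M (fun j => L + Y j - Y i) i (A i) =
      L * ∑ i, M.u i (A i) + ∑ i, Y i * imbalance M A i := by
  rw [Finset.sum_congr rfl fun i _ => hV.score_eq L Y (hA i), Finset.sum_sub_distrib,
    Finset.sum_add_distrib, Finset.sum_comm, ← Finset.mul_sum]
  simp only [imbalance, mul_sub, Finset.sum_sub_distrib, Finset.mul_sum]
  ring

theorem Market.Valid.abs_imbalance_le (hV : M.Valid) (hc : M.CrossMonotonic)
    {A : Fin n → Finset (Fin n)} (hA : ∀ i, i ∉ A i) (i : Fin n) : |imbalance M A i| ≤ n := by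
  have h1 : ∀ j, 0 ≤ (if i ∈ A j then M.h j i (A j) else 0) ∧
      (if i ∈ A j then M.h j i (A j) else 0) ≤ 1 := by
    intro j
    split
    · rename_i h; exact ⟨hV.share_nonneg hc (hA j) h, hV.share_le_one hc (hA j) h⟩
    · exact ⟨le_rfl, zero_le_one⟩
  have h2 := Finset.sum_nonneg fun j (_ : j ∈ Finset.univ) => (h1 j).1
  have h3 := Finset.sum_le_sum fun j (_ : j ∈ Finset.univ) => (h1 j).2
  simp only [Finset.sum_const, Finset.card_univ, Fintype.card_fin, nsmul_eq_mul, mul_one] at h3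
  have h4 := hV.nonneg i _ (hA i)
  have h5 := hV.le_one i _ (hA i)
  have h6 : (1 : ℝ) ≤ n := by have := hV.two_le; exact_mod_cast (by omega : 1 ≤ n)
  rw [imbalance, abs_le]
  constructor <;> linarith

/-- The sign of `y`, with `0` counted as positive. -/
noncomputable def sgn (y : ℝ) : ℝ := if 0 ≤ y then 1 else -1

theorem mul_sgn (y : ℝ) : y * sgn y = |y| := by
  unfold sgn
  split
  · rename_i h; rw [abs_of_nonneg h, mul_one]
  · rename_i h; rw [abs_of_neg (not_le.mp h), mul_neg_one]

theorem abs_sgn (y : ℝ) : |sgn y| = 1 := by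
  unfold sgn
  split <;> simp

/-- A run of the dual update. -/
structure DualRun (M : Market n) (θ : ℝ) (Y : ℕ → Fin n → ℝ) (A : ℕ → Fin n → Finset (Fin n)) :
    Prop where
  not_mem : ∀ t i, i ∉ A t i
  zero : ∀ i, Y 0 i = 0
  succ : ∀ t i, Y (t + 1) i = Y t i - (imbalance M (A t) i + θ * sgn (Y t i))

namespace DualRun

variable {θ : ℝ} {Y : ℕ → Fin n → ℝ} {A : ℕ → Fin n → Finset (Fin n)}

/-- Expand the square of an update: the linear term is `-2 * (∑ Y i * imbalance + θ * ∑ |Y i|)`, and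
the update of a coordinate is at most `n + 1` in absolute value. By `hG` and `sum_score` the linear
term is at most `2 * L` times the utility of the round minus `2 * G`. The drift `θ * sgn` thus
exactly offsets the loss `θ * ∑ |Y i|` allowed in `hG`. -/
theorem sum_sq_le (hR : DualRun M θ Y A) (hV : M.Valid) (hc : M.CrossMonotonic) (h0 : 0 ≤ θ)
    (h1 : θ ≤ 1) {L G : ℝ} (hG : ∀ t, G - θ * ∑ i, |Y t i| ≤
      ∑ i, score M (fun j => L + Y t j - Y t i) i (A t i)) (T : ℕ) :
    ∑ i, Y T i ^ 2 ≤ 2 * L * ∑ t ∈ Finset.range T, ∑ i, M.u i (A t i) - 2 * T * G +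
      T * (n * (n + 1) ^ 2) := by
  induction T with
  | zero => simp [hR.zero]
  | succ T ih =>
    have hstep : ∑ i, Y (T + 1) i ^ 2 ≤ ∑ i, Y T i ^ 2 - 2 * ∑ i, Y T i * imbalance M (A T) i -
        2 * θ * ∑ i, |Y T i| + n * (n + 1) ^ 2 := by
      have : ∀ i ∈ Finset.univ, Y (T + 1) i ^ 2 ≤ Y T i ^ 2 - 2 * (Y T i * imbalance M (A T) i) -
          2 * θ * |Y T i| + (n + 1) ^ 2 := by
        intro i _
        have e1 : |imbalance M (A T) i + θ * sgn (Y T i)| ≤ n + 1 := by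
          refine (abs_add_le _ _).trans (add_le_add (hV.abs_imbalance_le hc (hR.not_mem T) i) ?_)
          rw [abs_mul, abs_sgn, mul_one, abs_of_nonneg h0]
          exact h1
        have e2 : (imbalance M (A T) i + θ * sgn (Y T i)) ^ 2 ≤ (n + 1) ^ 2 :=
          sq_le_sq' (by linarith [neg_le_of_abs_le e1]) (le_of_abs_le e1)
        rw [hR.succ, ← mul_sgn (Y T i)]
        linarith
      refine (Finset.sum_le_sum this).trans (le_of_eq ?_)
      rw [Finset.sum_add_distrib, Finset.sum_sub_distrib, Finset.sum_sub_distrib, Finset.mul_sum,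
        Finset.mul_sum]
      simp
    have hs := hG T
    rw [hV.sum_score (hR.not_mem T)] at hs
    rw [Finset.sum_range_succ]
    push_cast
    linarith

/-- Apart from the drifts, which sum to at most `T * θ` in absolute value, `-Y T i` is the
accumulated imbalance. -/
theorem abs_sum_imbalance_le (hR : DualRun M θ Y A) (h0 : 0 ≤ θ) (T : ℕ) (i : Fin n) :
    |∑ t ∈ Finset.range T, imbalance M (A t) i| ≤ |Y T i| + T * θ := by
  have h : ∀ T : ℕ, |Y T i + ∑ t ∈ Finset.range T, imbalance M (A t) i| ≤ T * θ := by
    intro T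
    induction T with
    | zero => simp [hR.zero]
    | succ T ih =>
      rw [Finset.sum_range_succ, hR.succ]
      have e : Y T i - (imbalance M (A T) i + θ * sgn (Y T i)) +
          (∑ t ∈ Finset.range T, imbalance M (A t) i + imbalance M (A T) i) =
          (Y T i + ∑ t ∈ Finset.range T, imbalance M (A t) i) - θ * sgn (Y T i) := by ring
      rw [e]
      refine (abs_sub _ _).trans ?_
      rw [abs_mul, abs_sgn, abs_of_nonneg h0]
      push_cast
      linarith
  have h1 := h T
  have h2 := abs_sub_abs_le_abs_sub (∑ t ∈ Finset.range T, imbalance M (A t) i) (-Y T i)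
  rw [abs_neg, sub_neg_eq_add, add_comm (∑ t ∈ Finset.range T, _)] at h2
  linarith

end DualRun

end DataExchange

/-! ### Exact solution of the linear program by Fourier–Motzkin elimination -/

namespace DataExchange
open Sized (Within)

/-! ## Fourier–Motzkin elimination -/

/-- The value of the variable `k` under a list of assignments, and also the coefficient of `k` in a
linear form. -/
def lookup (k : ℕ) (c : List (ℕ × ℝ)) : ℝ := (c.map fun e => if k = e.1 then e.2 else 0).sum

/-- The value of a linear form. -/
def evalForm (σ : ℕ → ℝ) (c : List (ℕ × ℝ)) : ℝ := (c.map fun e => e.2 * σ e.1).sum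

/-- Multiple of a linear form. -/
def scaleForm (a : ℝ) (c : List (ℕ × ℝ)) : List (ℕ × ℝ) := c.map fun e => (e.1, a * e.2)

theorem lookup_cons (k : ℕ) (e : ℕ × ℝ) (c : List (ℕ × ℝ)) :
    lookup k (e :: c) = (if k = e.1 then e.2 else 0) + lookup k c := rfl

theorem lookup_append (k : ℕ) (c d : List (ℕ × ℝ)) :
    lookup k (c ++ d) = lookup k c + lookup k d := by simp [lookup]

theorem lookup_scaleForm (k : ℕ) (a : ℝ) (c : List (ℕ × ℝ)) :
    lookup k (scaleForm a c) = a * lookup k c := by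
  induction c with
  | nil => simp [lookup, scaleForm]
  | cons e c ih =>
    rw [scaleForm, List.map_cons, ← scaleForm, lookup_cons, lookup_cons, ih]
    split <;> simp_all [mul_add]

theorem evalForm_cons (σ : ℕ → ℝ) (e : ℕ × ℝ) (c : List (ℕ × ℝ)) :
    evalForm σ (e :: c) = e.2 * σ e.1 + evalForm σ c := rfl

theorem evalForm_append (σ : ℕ → ℝ) (c d : List (ℕ × ℝ)) :
    evalForm σ (c ++ d) = evalForm σ c + evalForm σ d := by simp [evalForm]

theorem evalForm_scaleForm (σ : ℕ → ℝ) (a : ℝ) (c : List (ℕ × ℝ)) :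
    evalForm σ (scaleForm a c) = a * evalForm σ c := by
  induction c with
  | nil => simp [evalForm, scaleForm]
  | cons e c ih =>
    rw [scaleForm, List.map_cons, ← scaleForm, evalForm_cons, evalForm_cons, ih]
    ring

theorem evalForm_eq_sum (σ : ℕ → ℝ) (c : List (ℕ × ℝ)) (s : Finset ℕ) (h : ∀ e ∈ c, e.1 ∈ s) :
    evalForm σ c = ∑ k ∈ s, lookup k c * σ k := by
  induction c with
  | nil => simp [evalForm, lookup]
  | cons e c ih =>
    rw [evalForm_cons, ih fun e he => h e (by simp [he])]
    simp only [lookup_cons, add_mul, Finset.sum_add_distrib, ite_mul, zero_mul]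
    rw [Finset.sum_ite_eq' s e.1, if_pos (h e (by simp))]

theorem evalForm_congr {σ τ : ℕ → ℝ} {c : List (ℕ × ℝ)}
    (h : ∀ k, σ k = τ k ∨ lookup k c = 0) : evalForm σ c = evalForm τ c := by
  have hs : ∀ e ∈ c, e.1 ∈ (c.map Prod.fst).toFinset := fun e he => by
    simp only [List.mem_toFinset, List.mem_map]
    exact ⟨e, he, rfl⟩
  rw [evalForm_eq_sum σ c _ hs, evalForm_eq_sum τ c _ hs]
  refine Finset.sum_congr rfl fun k _ => ?_
  rcases h k with h | h <;> simp [h]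

/-- The hypothesis `σ k = 0` makes the update additive; during back substitution unassigned
variables have value `0`. -/
theorem evalForm_update (σ : ℕ → ℝ) (k : ℕ) (t : ℝ) (hk : σ k = 0) (c : List (ℕ × ℝ)) :
    evalForm (Function.update σ k t) c = evalForm σ c + lookup k c * t := by
  induction c with
  | nil => simp [evalForm, lookup]
  | cons e c ih =>
    rw [evalForm_cons, evalForm_cons, lookup_cons, ih]
    by_cases h : k = e.1
    · subst h; simp [hk]; ring
    · rw [Function.update_of_ne (Ne.symm h), if_neg h]; ring

/-- All linear forms of a system are non-negative. -/
def Feasible (σ : ℕ → ℝ) (s : List (List (ℕ × ℝ))) : Prop := ∀ c ∈ s, 0 ≤ evalForm σ c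

/-- `s'` arises from `s` by elimination of the non-negative variable `k`. -/
def IsElim (k : ℕ) (s s' : List (List (ℕ × ℝ))) : Prop :=
  ∀ c, c ∈ s' ↔ (c ∈ s ∧ lookup k c = 0) ∨
    ∃ p q, (p = [(k, 1)] ∨ (p ∈ s ∧ 0 < lookup k p)) ∧ q ∈ s ∧ lookup k q < 0 ∧
      c = scaleForm (-lookup k q) p ++ scaleForm (lookup k p) q

/-- `t` is the smallest non-negative value of `k` that meets the lower bounds of the system. -/
def IsLeast' (k : ℕ) (s : List (List (ℕ × ℝ))) (σ : ℕ → ℝ) (t : ℝ) : Prop :=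
  0 ≤ t ∧ (∀ c ∈ s, 0 < lookup k c → -evalForm σ c / lookup k c ≤ t) ∧
    (t = 0 ∨ ∃ c ∈ s, 0 < lookup k c ∧ t = -evalForm σ c / lookup k c)

theorem lookup_single (k m : ℕ) : lookup m [(k, (1 : ℝ))] = if m = k then 1 else 0 := by
  simp [lookup]

theorem evalForm_single (σ : ℕ → ℝ) (k : ℕ) : evalForm σ [(k, (1 : ℝ))] = σ k := by
  simp [evalForm]

namespace IsElim

variable {k : ℕ} {s s' : List (List (ℕ × ℝ))}

theorem feasible (h : IsElim k s s') {τ : ℕ → ℝ} (hτ : Feasible τ s) (h0 : 0 ≤ τ k) :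
    Feasible τ s' := by
  intro c hc
  rcases (h c).mp hc with ⟨hc, _⟩ | ⟨p, q, hp, hq, hq0, rfl⟩
  · exact hτ c hc
  · rw [evalForm_append, evalForm_scaleForm, evalForm_scaleForm]
    have hp' : 0 ≤ evalForm τ p ∧ 0 ≤ lookup k p := by
      rcases hp with rfl | ⟨hp, hp0⟩
      · rw [evalForm_single, lookup_single, if_pos rfl]
        exact ⟨h0, zero_le_one⟩
      · exact ⟨hτ p hp, hp0.le⟩
    have := mul_nonneg (neg_nonneg.mpr hq0.le) hp'.1
    have := mul_nonneg hp'.2 (hτ q hq)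
    linarith

theorem lookup_eq_zero (h : IsElim k s s') {c : List (ℕ × ℝ)} (hc : c ∈ s') : lookup k c = 0 := by
  rcases (h c).mp hc with ⟨_, hc⟩ | ⟨p, q, _, _, _, rfl⟩
  · exact hc
  · rw [lookup_append, lookup_scaleForm, lookup_scaleForm]
    ring

theorem lookup_eq_zero_of (h : IsElim k s s') {m : ℕ} (hm : m ≠ k)
    (hs : ∀ c ∈ s, lookup m c = 0) {c : List (ℕ × ℝ)} (hc : c ∈ s') : lookup m c = 0 := by
  rcases (h c).mp hc with ⟨hc, _⟩ | ⟨p, q, hp, hq, _, rfl⟩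
  · exact hs c hc
  · rw [lookup_append, lookup_scaleForm, lookup_scaleForm, hs q hq]
    rcases hp with rfl | ⟨hp, _⟩
    · rw [lookup_single, if_neg hm]; ring
    · rw [hs p hp]; ring

/-- Forms with negative coefficient of `k` are upper bounds for `k`. The value `t` is itself one of
the lower bounds, with `[(k, 1)]` standing for `0 ≤ k`, and the combination of that bound with a
given upper bound is in `s'`, hence holds at `σ`. -/
theorem feasible_update (h : IsElim k s s') {σ : ℕ → ℝ} (hk : σ k = 0) (hσ : Feasible σ s')
    {t : ℝ} (ht : IsLeast' k s σ t) : Feasible (Function.update σ k t) s := by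
  intro c hc
  rw [evalForm_update σ k t hk]
  rcases lt_trichotomy (lookup k c) 0 with h0 | h0 | h0
  · rcases ht.2.2 with rfl | ⟨p, hp, hp0, rfl⟩
    · have := hσ _ ((h _).mpr (Or.inr ⟨[(k, 1)], c, Or.inl rfl, hc, h0, rfl⟩))
      rw [evalForm_append, evalForm_scaleForm, evalForm_scaleForm, evalForm_single, hk,
        lookup_single, if_pos rfl] at this
      linarith
    · have := hσ _ ((h _).mpr (Or.inr ⟨p, c, Or.inr ⟨hp, hp0⟩, hc, h0, rfl⟩))
      rw [evalForm_append, evalForm_scaleForm, evalForm_scaleForm] at this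
      have e : evalForm σ c + lookup k c * (-evalForm σ p / lookup k p) =
          (-lookup k c * evalForm σ p + lookup k p * evalForm σ c) / lookup k p := by
        field_simp
        ring
      rw [e]
      exact div_nonneg this hp0.le
  · have := hσ _ ((h _).mpr (Or.inl ⟨hc, h0⟩))
    rw [h0]
    linarith
  · have := ht.2.1 c hc h0
    rw [div_le_iff₀ h0] at this
    linarith

end IsElim

/-- A stack of eliminated variables, with the systems before their elimination, that starts with
the system `s₀` and ends with `s`. -/
inductive Chain (s₀ : List (List (ℕ × ℝ))) :
    List (ℕ × List (List (ℕ × ℝ))) → List (List (ℕ × ℝ)) → Prop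
  | nil : Chain s₀ [] s₀
  | cons {k st s s'} : Chain s₀ st s → IsElim k s s' → Chain s₀ ((k, s) :: st) s'

namespace Chain

variable {s₀ s : List (List (ℕ × ℝ))} {st : List (ℕ × List (List (ℕ × ℝ)))}

theorem feasible (h : Chain s₀ st s) {τ : ℕ → ℝ} (hτ : Feasible τ s₀)
    (h0 : ∀ e ∈ st, 0 ≤ τ e.1) : Feasible τ s := by
  induction h with
  | nil => exact hτ
  | cons _ he ih =>
    exact he.feasible (ih fun e he => h0 e (by simp [he])) (h0 _ (List.mem_cons_self))

theorem lookup_eq_zero (h : Chain s₀ st s) : ∀ e ∈ st, ∀ c ∈ s, lookup e.1 c = 0 := by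
  induction h with
  | nil => simp
  | @cons k st s s' _ he ih =>
    intro e hm c hc
    by_cases hk : e.1 = k
    · rw [hk]; exact he.lookup_eq_zero hc
    · rcases List.mem_cons.mp hm with rfl | hm
      · exact absurd rfl hk
      · exact he.lookup_eq_zero_of hk (ih e hm) hc

/-- Back substitution. `least k s σ` is the value chosen for `k`. -/
theorem backSubst (h : Chain s₀ st s) (least : List (ℕ × ℝ) → ℕ × List (List (ℕ × ℝ)) → ℝ)
    (hl : ∀ σ e, IsLeast' e.1 e.2 (fun k => lookup k σ) (least σ e))
    (hnd : (st.map Prod.fst).Nodup) (σ : List (ℕ × ℝ)) (hσ0 : ∀ e ∈ st, lookup e.1 σ = 0)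
    (hσ : Feasible (fun k => lookup k σ) s) :
    Feasible (fun k => lookup k (st.foldl (fun σ e => (e.1, least σ e) :: σ) σ)) s₀ ∧
    (∀ e ∈ st, 0 ≤ lookup e.1 (st.foldl (fun σ e => (e.1, least σ e) :: σ) σ)) ∧
    ∀ k, k ∉ st.map Prod.fst →
      lookup k (st.foldl (fun σ e => (e.1, least σ e) :: σ) σ) = lookup k σ := by
  induction h generalizing σ with
  | nil => exact ⟨hσ, by simp, by simp⟩
  | @cons k st s s' _ he ih =>
    simp only [List.map_cons, List.nodup_cons] at hnd
    have hk0 : lookup k σ = 0 := hσ0 _ (List.mem_cons_self)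
    have hupd : (fun m => lookup m ((k, least σ (k, s)) :: σ)) =
        Function.update (fun m => lookup m σ) k (least σ (k, s)) := by
      funext m
      rw [lookup_cons]
      by_cases hm : m = k
      · subst hm; simp [hk0]
      · rw [Function.update_of_ne hm, if_neg hm, zero_add]
    have hF : Feasible (fun m => lookup m ((k, least σ (k, s)) :: σ)) s := by
      rw [hupd]
      exact he.feasible_update hk0 hσ (hl σ (k, s))
    obtain ⟨h1, h2, h3⟩ := ih hnd.2 ((k, least σ (k, s)) :: σ) (by
      intro e hm
      rw [lookup_cons, if_neg, zero_add]
      · exact hσ0 e (by simp [hm])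
      · intro hek
        exact hnd.1 (List.mem_map.mpr ⟨e, hm, hek⟩)) hF
    refine ⟨h1, ?_, ?_⟩
    · intro e hm
      rcases List.mem_cons.mp hm with rfl | hm
      · rw [List.foldl_cons, h3 _ hnd.1, lookup_cons, if_pos rfl, hk0, add_zero]
        exact (hl σ (k, s)).1
      · exact h2 e hm
    · intro m hm
      simp only [List.map_cons, List.mem_cons, not_or] at hm
      rw [List.foldl_cons, h3 m hm.2, lookup_cons, if_neg hm.1, zero_add]

end Chain

/-- Elimination and back substitution find a feasible point that minimizes the variable eliminated
last. -/
theorem exists_solution {s₀ s s' : List (List (ℕ × ℝ))} {k : ℕ}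
    {st : List (ℕ × List (List (ℕ × ℝ)))} (h : Chain s₀ ((k, s) :: st) s')
    (least : List (ℕ × ℝ) → ℕ × List (List (ℕ × ℝ)) → ℝ)
    (hl : ∀ σ e, IsLeast' e.1 e.2 (fun k => lookup k σ) (least σ e))
    (hnd : (((k, s) :: st).map Prod.fst).Nodup) (h0 : 0 ∉ ((k, s) :: st).map Prod.fst)
    (hvar : ∀ c ∈ s₀, ∀ m, m ≠ 0 → m ∉ ((k, s) :: st).map Prod.fst → lookup m c = 0)
    {σ : ℕ → ℝ}
    (hσ : σ = fun m => lookup m (((k, s) :: st).foldl (fun σ e => (e.1, least σ e) :: σ) [(0, 1)]))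
    {τ : ℕ → ℝ} (hτ : Feasible τ s₀) (hτ0 : τ 0 = 1)
    (hτn : ∀ m ∈ ((k, s) :: st).map Prod.fst, 0 ≤ τ m) :
    Feasible σ s₀ ∧ (∀ m ∈ ((k, s) :: st).map Prod.fst, 0 ≤ σ m) ∧ σ 0 = 1 ∧ σ k ≤ τ k := by
  have hmem : ∀ e ∈ (k, s) :: st, e.1 ∈ ((k, s) :: st).map Prod.fst := fun e he =>
    List.mem_map.mpr ⟨e, he, rfl⟩
  -- Variables absent from the initial system never enter through an elimination.
  have hout : ∀ (st' : List (ℕ × List (List (ℕ × ℝ)))) (s' : List (List (ℕ × ℝ))),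
      Chain s₀ st' s' → ∀ m, m ∉ st'.map Prod.fst → (∀ c ∈ s₀, lookup m c = 0) →
      ∀ c ∈ s', lookup m c = 0 := by
    intro st' s' hch m
    induction hch with
    | nil => intro _ h; exact h
    | cons _ he ih =>
      intro hm hs c hc
      simp only [List.map_cons, List.mem_cons, not_or] at hm
      exact he.lookup_eq_zero_of hm.1 (ih hm.2 hs) hc
  have hbase : ∀ m, lookup m [(0, (1 : ℝ))] = if m = 0 then 1 else 0 := fun m => lookup_single 0 m
  -- In the final system only the variable `0`, which carries the constant `1`, can occur. Its
  -- feasibility can thus be checked at `τ`, where it is inherited from `s₀`.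
  have hfin : Feasible (fun m => lookup m [(0, (1 : ℝ))]) s' := by
    intro c hc
    rw [evalForm_congr (τ := τ)]
    · exact h.feasible hτ (fun e he => hτn _ (hmem e he)) c hc
    · intro m
      by_cases hm0 : m = 0
      · left; rw [hbase, if_pos hm0, hm0, hτ0]
      · right
        by_cases hm : m ∈ ((k, s) :: st).map Prod.fst
        · obtain ⟨e, he, rfl⟩ := List.mem_map.mp hm
          exact h.lookup_eq_zero e he c hc
        · exact hout _ _ h m hm (fun c hc => hvar c hc m hm0 hm) c hc
  obtain ⟨h1, h2, h3⟩ := h.backSubst least hl hnd [(0, 1)] (fun e he => by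
    rw [hbase, if_neg]
    intro h
    exact h0 (h ▸ hmem e he)) hfin
  rw [← hσ] at h1
  refine ⟨h1, ?_, ?_, ?_⟩
  · intro m hm
    obtain ⟨e, he, rfl⟩ := List.mem_map.mp hm
    rw [hσ]
    exact h2 e he
  · rw [hσ]
    simp only
    rw [h3 0 h0, hbase, if_pos rfl]
  · obtain ⟨hch, he⟩ : Chain s₀ st s ∧ IsElim k s s' := by
      cases h with
      | cons h1 h2 => exact ⟨h1, h2⟩
    simp only [List.map_cons, List.nodup_cons] at hnd
    simp only [List.map_cons, List.mem_cons, not_or] at h0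
    have hσk : σ k = least [(0, 1)] (k, s) := by
      rw [hσ]
      simp only [List.foldl_cons]
      have hfs : Feasible (fun m => lookup m ((k, least [(0, 1)] (k, s)) :: [(0, 1)])) s := by
        have hupd : (fun m => lookup m ((k, least [(0, 1)] (k, s)) :: [(0, 1)])) =
            Function.update (fun m => lookup m [(0, 1)]) k (least [(0, 1)] (k, s)) := by
          funext m
          rw [lookup_cons]
          by_cases hm : m = k
          · subst hm; simp [hbase, Ne.symm h0.1]
          · rw [Function.update_of_ne hm, if_neg hm, zero_add]
        rw [hupd]
        exact he.feasible_update (by rw [hbase, if_neg (Ne.symm h0.1)]) hfin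
          (hl [(0, 1)] (k, s))
      obtain ⟨_, _, g3⟩ := hch.backSubst least hl hnd.2 ((k, least [(0, 1)] (k, s)) :: [(0, 1)])
        (fun e hm => by
          have hm' : e.1 ∈ st.map Prod.fst := List.mem_map.mpr ⟨e, hm, rfl⟩
          rw [lookup_cons, if_neg, hbase, if_neg, zero_add]
          · intro h; exact h0.2 (h ▸ hm')
          · intro h; simp only at h; exact hnd.1 (h ▸ hm')) hfs
      rw [g3 k hnd.1, lookup_cons, if_pos rfl, hbase, if_neg (Ne.symm h0.1), add_zero]
    -- Minimality: the value chosen for `k` is `0` or a lower bound given by a form in `k` and the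
    -- constant alone. The point `τ` satisfies the same form, hence the same bound.
    rw [hσk]
    rcases (hl [(0, 1)] (k, s)).2.2 with ht | ⟨c, hc, hc0, ht⟩
    · rw [ht]
      exact hτn k (by simp)
    · rw [ht]
      simp only at hc hc0 ⊢
      have hτs : 0 ≤ evalForm τ c := hch.feasible hτ
        (fun e he => hτn _ (hmem e (by simp [he]))) c hc
      have : evalForm τ c = evalForm (Function.update (fun m => lookup m [(0, 1)]) k (τ k)) c := by
        apply evalForm_congr
        intro m
        by_cases hmk : m = k
        · left; subst hmk; simp
        · rw [Function.update_of_ne hmk, hbase]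
          by_cases hm0 : m = 0
          · left; rw [if_pos hm0, hm0, hτ0]
          · right
            by_cases hm : m ∈ st.map Prod.fst
            · obtain ⟨e, he, rfl⟩ := List.mem_map.mp hm
              exact hch.lookup_eq_zero e he c hc
            · exact hout _ _ hch m hm (fun c hc => hvar c hc m hm0 (by simp [hmk]; simpa using hm))
                c hc
      rw [evalForm_update _ _ _ (by rw [hbase, if_neg (Ne.symm h0.1)])] at this
      rw [div_le_iff₀ hc0]
      linarith

end DataExchange

namespace DataExchange
open Sized (Within)

/-! ## Decoding of outputs -/

section Decode

variable {n : ℕ} {M : Market n}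

theorem toBundle_mem_bundles (i : Fin n) (l : List ℕ) : toBundle i l ∈ bundles i :=
  mem_bundles.mpr (not_mem_toBundle i l)

theorem sum_decode (L : List (ℕ × List ℕ × ℝ)) (i : Fin n) (F : Finset (Fin n) → ℝ) :
    ∑ S ∈ bundles i, F S * decode L i S =
      (L.map fun e => if e.1 = (i : ℕ) then F (toBundle i e.2.1) * e.2.2 else 0).sum := by
  induction L with
  | nil => simp [decode]
  | cons e L ih =>
    have h : ∀ S, decode (e :: L) i S =
        (if e.1 = (i : ℕ) ∧ toBundle i e.2.1 = S then e.2.2 else 0) + decode L i S := fun S => rfl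
    simp only [h, mul_add, Finset.sum_add_distrib, List.map_cons, List.sum_cons, ih]
    congr 1
    split
    · rename_i he
      simp only [he, true_and, mul_ite, mul_zero]
      rw [Finset.sum_ite_eq, if_pos (toBundle_mem_bundles i _)]
    · rename_i he
      simp [he]

theorem decode_nonneg {L : List (ℕ × List ℕ × ℝ)} (h : ∀ e ∈ L, 0 ≤ e.2.2) (i : Fin n)
    (S : Finset (Fin n)) : 0 ≤ decode L i S := by
  apply List.sum_nonneg
  intro x hx
  obtain ⟨e, he, rfl⟩ := List.mem_map.mp hx
  split
  · exact h e he
  · exact le_rfl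

theorem list_sum_comm {A : Type} (L : List A) (f : Fin n → A → ℝ) :
    ∑ j, (L.map fun e => f j e).sum = (L.map fun e => ∑ j, f j e).sum := by
  induction L with
  | nil => simp
  | cons e L ih => simp [Finset.sum_add_distrib, ih]

theorem askUtility_coe (i : Fin n) (l : List ℕ) :
    M.askUtility (i : ℕ) l = M.u i (toBundle i l) := by
  simp [Market.askUtility]

theorem askShare_coe (i j : Fin n) (l : List ℕ) :
    M.askShare (i : ℕ) (j : ℕ) l =
      if j ∈ toBundle i l then M.h i j (toBundle i l) else 0 := by
  simp [Market.askShare]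

theorem Market.Valid.received_decode (hV : M.Valid) (L : List (ℕ × List ℕ × ℝ)) (i : Fin n) :
    received M (decode L) i =
      (L.map fun e => (if e.1 = (i : ℕ) then M.askUtility e.1 e.2.1 else 0) * e.2.2).sum := by
  rw [hV.received_eq, sum_decode]
  congr 1
  refine List.map_congr_left fun e _ => ?_
  split
  · rename_i h; rw [h, askUtility_coe]
  · simp

theorem contributed_decode (L : List (ℕ × List ℕ × ℝ)) (hL : ∀ e ∈ L, e.1 < n) (i : Fin n) :
    contributed M (decode L) i = (L.map fun e => M.askShare e.1 (i : ℕ) e.2.1 * e.2.2).sum := by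
  rw [contributed_eq, Finset.sum_congr rfl fun j _ => sum_decode L j _, list_sum_comm]
  congr 1
  refine List.map_congr_left fun e he => ?_
  have h : ∀ j : Fin n, (e.1 = (j : ℕ)) ↔ j = ⟨e.1, hL e he⟩ := fun j => by
    rw [Fin.ext_iff]; exact eq_comm
  simp only [h]
  rw [Finset.sum_ite_eq' Finset.univ, if_pos (Finset.mem_univ _)]
  have := askShare_coe (M := M) ⟨e.1, hL e he⟩ i e.2.1
  simp only at this
  rw [this]

theorem welfare_decode (L : List (ℕ × List ℕ × ℝ)) (hL : ∀ e ∈ L, e.1 < n) :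
    welfare M (decode L) = (L.map fun e => M.askUtility e.1 e.2.1 * e.2.2).sum := by
  rw [welfare, Finset.sum_congr rfl fun j _ => sum_decode L j _, list_sum_comm]
  congr 1
  refine List.map_congr_left fun e he => ?_
  have h : ∀ j : Fin n, (e.1 = (j : ℕ)) ↔ j = ⟨e.1, hL e he⟩ := fun j => by
    rw [Fin.ext_iff]; exact eq_comm
  simp only [h]
  rw [Finset.sum_ite_eq' Finset.univ, if_pos (Finset.mem_univ _)]
  have := askUtility_coe (M := M) ⟨e.1, hL e he⟩ e.2.1
  simp only at this
  rw [this]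

end Decode

/-! ## Enumeration of all bundles -/

/-- All sublists. -/
def subsets (l : List ℕ) : List (List ℕ) :=
  l.foldl (fun acc j => acc ++ acc.map fun s => j :: s) [[]]

/-- Each subset is listed exactly once, since adding `j` doubles the list as it doubles the power
set. Multiplicity matters because repeated output entries are added. -/
theorem sum_subsets {n : ℕ} (i : Fin n) (l : List (Fin n)) (hl : l.Nodup) (hi : i ∉ l)
    (F : Finset (Fin n) → ℝ) :
    ((subsets (l.map Fin.val)).map fun s => F (toBundle i s)).sum =
      ∑ S ∈ l.toFinset.powerset, F S := by
  induction l using List.reverseRecOn generalizing F with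
  | nil => simp [subsets, toBundle]
  | append_singleton l j ih =>
    have hj : j ∉ l := by
      rw [List.nodup_append] at hl
      exact fun h => hl.2.2 j h j (by simp) rfl
    have hl' : l.Nodup := hl.of_append_left
    have hi' : i ∉ l := fun h => hi (by simp [h])
    have hji : j ≠ i := by rintro rfl; exact hi (by simp)
    have e1 : subsets ((l ++ [j]).map Fin.val) = subsets (l.map Fin.val) ++
        (subsets (l.map Fin.val)).map fun s => (j : ℕ) :: s := by
      simp [subsets, List.foldl_append]
    have e2 : (l ++ [j]).toFinset = insert j l.toFinset := by
      ext; simp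
    have e3 : ∀ s, toBundle i ((j : ℕ) :: s) = insert j (toBundle i s) := by
      intro s
      ext k
      simp only [toBundle, List.mem_cons, Finset.mem_filter, Finset.mem_univ, true_and,
        Finset.mem_insert, Fin.ext_iff]
      constructor
      · tauto
      · rintro (h | h)
        · refine ⟨?_, Or.inl h⟩
          exact fun hk => hji (Fin.ext (by rw [← h, hk]))
        · exact ⟨h.1, Or.inr h.2⟩
    rw [e1, e2, Finset.sum_powerset_insert (by simpa using hj), List.map_append, List.sum_append,
      ih hl' hi', List.map_map]
    congr 1
    rw [← ih hl' hi' fun S => F (insert j S)]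
    congr 1
    exact List.map_congr_left fun s _ => by simp only [Function.comp_apply, e3]

namespace Prog

variable {Γ A B : Type}

def trueE : Prog Γ Bool := ltE natZero (succE natZero)
def falseE : Prog Γ Bool := ltE natZero natZero
def posE (e : Prog Γ ℝ) : Prog Γ Bool := cond (leE e realZero) falseE trueE
def negE (e : Prog Γ ℝ) : Prog Γ ℝ := subE realZero e
def lookupE (k : Prog Γ ℕ) (c : Prog Γ (List (ℕ × ℝ))) : Prog Γ ℝ :=
  sumE c (cond (eqE (wk k) (fst.comp snd)) (snd.comp snd) realZero)
def scaleE (a : Prog Γ ℝ) (c : Prog Γ (List (ℕ × ℝ))) : Prog Γ (List (ℕ × ℝ)) :=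
  mapE c ((fst.comp snd).pair (mulE (wk a) (snd.comp snd)))
def evalE (σ c : Prog Γ (List (ℕ × ℝ))) : Prog Γ ℝ :=
  sumE c (mulE (snd.comp snd) (lookupE (fst.comp snd) (wk σ)))
def elimE (k : Prog Γ ℕ) (s : Prog Γ (List (List (ℕ × ℝ)))) : Prog Γ (List (List (ℕ × ℝ))) :=
  appendE
    (filterE s (cond (leE (lookupE (wk k) snd) realZero)
      (leE realZero (lookupE (wk k) snd)) falseE))
    (flatMapE
      (consE (consE (k.pair realOne) nil) (filterE s (posE (lookupE (wk k) snd))))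
      (mapE (wk (filterE s (posE (negE (lookupE (wk k) snd)))))
        (appendE (scaleE (negE (lookupE (wk (wk k)) snd)) (snd.comp fst))
          (scaleE (lookupE (wk (wk k)) (snd.comp fst)) snd))))
def leastE (k : Prog Γ ℕ) (s : Prog Γ (List (List (ℕ × ℝ)))) (σ : Prog Γ (List (ℕ × ℝ))) :
    Prog Γ ℝ :=
  fold s realZero
    (cond (leE (lookupE (wk (wk k)) snd) realZero) (snd.comp fst)
      (cond (leE (divE (negE (evalE (wk (wk σ)) snd)) (lookupE (wk (wk k)) snd)) (snd.comp fst))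
        (snd.comp fst)
        (divE (negE (evalE (wk (wk σ)) snd)) (lookupE (wk (wk k)) snd))))
def subsetsE (l : Prog Γ (List ℕ)) : Prog Γ (List (List ℕ)) :=
  fold l (consE nil nil)
    (appendE (snd.comp fst) (mapE (snd.comp fst) (consE (snd.comp fst) snd)))
/-- Number the members of a list, from `2` on. -/
def enumE (l : Prog Γ (List B)) : Prog Γ (List (ℕ × B)) :=
  snd.comp (fold l ((natLit 2).pair nil)
    ((succE (fst.comp (snd.comp fst))).pair
      (consE ((fst.comp (snd.comp fst)).pair snd) (snd.comp (snd.comp fst)))))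

section val

variable {n : ℕ} (M : Market n) (γ : Γ)

@[simp] theorem val_trueE : (trueE : Prog Γ Bool).val M γ = true := by simp [trueE]
@[simp] theorem val_falseE : (falseE : Prog Γ Bool).val M γ = false := by
  rw [← Bool.not_eq_true]; simp [falseE]
@[simp] theorem val_posE (e : Prog Γ ℝ) : (posE e).val M γ = true ↔ 0 < e.val M γ := by
  simp only [posE, val_cond, val_leE, val_realZero]
  split <;> simp_all
@[simp] theorem val_negE (e : Prog Γ ℝ) : (negE e).val M γ = -e.val M γ := by simp [negE]
@[simp] theorem val_lookupE (k : Prog Γ ℕ) (c : Prog Γ (List (ℕ × ℝ))) :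
    (lookupE k c).val M γ = lookup (k.val M γ) (c.val M γ) := by
  simp [lookupE, lookup]
@[simp] theorem val_scaleE (a : Prog Γ ℝ) (c : Prog Γ (List (ℕ × ℝ))) :
    (scaleE a c).val M γ = scaleForm (a.val M γ) (c.val M γ) := by
  simp [scaleE, scaleForm]
@[simp] theorem val_evalE (σ c : Prog Γ (List (ℕ × ℝ))) :
    (evalE σ c).val M γ = evalForm (fun k => lookup k (σ.val M γ)) (c.val M γ) := by
  simp [evalE, evalForm]

theorem val_elimE (k : Prog Γ ℕ) (s : Prog Γ (List (List (ℕ × ℝ)))) :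
    IsElim (k.val M γ) (s.val M γ) ((elimE k s).val M γ) := by
  intro c
  simp only [elimE, val_appendE, List.mem_append, val_filterE, List.mem_filter, val_cond, val_leE,
    val_lookupE, val_comp, val_fst, val_snd, val_realZero, val_flatMapE, List.mem_flatMap,
    val_consE, List.mem_cons, val_pair, val_realOne, val_nil, val_posE, val_mapE, List.mem_map,
    val_scaleE, val_negE, Left.neg_pos_iff]
  constructor
  · rintro (⟨h1, h2⟩ | ⟨p, hp, q, ⟨hq, hq0⟩, rfl⟩)
    · left
      refine ⟨h1, ?_⟩
      split at h2
      · rename_i h3; rw [val_leE] at h2; simp at h2; exact le_antisymm h3 h2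
      · simp at h2
    · exact Or.inr ⟨p, q, hp, hq, hq0, rfl⟩
  · rintro (⟨h1, h2⟩ | ⟨p, q, hp, hq, hq0, rfl⟩)
    · left
      refine ⟨h1, ?_⟩
      rw [if_pos h2.le, val_leE]
      simp [h2]
    · exact Or.inr ⟨p, hp, q, ⟨hq, hq0⟩, rfl⟩

/-- The fold maintains the maximum of `0` and the lower bounds seen so far; forms with coefficient
at most `0` are skipped. -/
theorem val_leastE (k : Prog Γ ℕ) (s : Prog Γ (List (List (ℕ × ℝ))))
    (σ : Prog Γ (List (ℕ × ℝ))) :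
    IsLeast' (k.val M γ) (s.val M γ) (fun m => lookup m (σ.val M γ)) ((leastE k s σ).val M γ) := by
  simp only [leastE, val_fold, val_cond, val_leE, val_lookupE, val_comp, val_fst, val_snd,
    val_realZero, val_divE, val_negE, val_evalE]
  generalize k.val M γ = k
  generalize σ.val M γ = σ
  generalize s.val M γ = s
  induction s using List.reverseRecOn with
  | nil => exact ⟨le_rfl, by simp, Or.inl rfl⟩
  | append_singleton s c ih =>
    rw [List.foldl_append, List.foldl_cons, List.foldl_nil]
    set t := s.foldl _ _ with ht
    obtain ⟨h1, h2, h3⟩ := ih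
    have h3' : t = 0 ∨ ∃ c' ∈ s ++ [c], 0 < lookup k c' ∧
        t = -evalForm (fun m => lookup m σ) c' / lookup k c' :=
      h3.imp_right fun ⟨c', hc', h⟩ => ⟨c', by simp [hc'], h⟩
    split
    · rename_i hc
      refine ⟨h1, fun c' hc' h0 => ?_, h3'⟩
      rcases List.mem_append.mp hc' with hc' | hc'
      · exact h2 c' hc' h0
      · simp at hc'; subst hc'; exact absurd h0 (not_lt.mpr hc)
    · rename_i hc
      split
      · rename_i hle
        refine ⟨h1, fun c' hc' h0 => ?_, h3'⟩
        rcases List.mem_append.mp hc' with hc' | hc'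
        · exact h2 c' hc' h0
        · simp at hc'; subst hc'; exact hle
      · rename_i hle
        push Not at hc hle
        refine ⟨h1.trans hle.le, fun c' hc' h0 => ?_, Or.inr ⟨c, by simp, hc, rfl⟩⟩
        rcases List.mem_append.mp hc' with hc' | hc'
        · exact (h2 c' hc' h0).trans hle.le
        · simp at hc'; subst hc'; exact le_rfl

@[simp] theorem val_subsetsE (l : Prog Γ (List ℕ)) :
    (subsetsE l).val M γ = subsets (l.val M γ) := by
  simp [subsetsE, subsets]

theorem val_enumE (l : Prog Γ (List B)) :
    ((enumE l).val M γ).map Prod.snd = (l.val M γ).reverse ∧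
      (((enumE l).val M γ).map Prod.fst).Nodup ∧ ∀ e ∈ (enumE l).val M γ, 2 ≤ e.1 := by
  simp only [enumE, val_comp, val_snd, val_fold, val_pair, val_succE, val_fst, val_consE,
    val_natLit, val_nil]
  generalize l.val M γ = l
  have h : ∀ l : List B, ∀ r, r = l.foldl (fun (a : ℕ × List (ℕ × B)) b =>
      (a.1 + 1, (a.1, b) :: a.2)) (2, []) → r.2.map Prod.snd = l.reverse ∧
      (r.2.map Prod.fst).Nodup ∧ (∀ e ∈ r.2, 2 ≤ e.1 ∧ e.1 < r.1) ∧ 2 ≤ r.1 := by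
    intro l
    induction l using List.reverseRecOn with
    | nil => rintro r rfl; simp
    | append_singleton l b ih =>
      rintro r rfl
      obtain ⟨h1, h2, h3, h4⟩ := ih _ rfl
      rw [List.foldl_append, List.foldl_cons, List.foldl_nil]
      refine ⟨by simp [h1], ?_, ?_, by simp only; omega⟩
      · simp only [List.map_cons, List.nodup_cons]
        refine ⟨fun hm => ?_, h2⟩
        obtain ⟨e, he, hee⟩ := List.mem_map.mp hm
        have := (h3 e he).2
        omega
      · intro e he
        simp only [List.mem_cons] at he
        rcases he with rfl | he
        · exact ⟨h4, by simp⟩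
        · have := h3 e he
          simp only
          omega
  obtain ⟨h1, h2, h3, _⟩ := h l _ rfl
  exact ⟨h1, h2, fun e he => (h3 e he).1⟩

end val

end Prog

end DataExchange

namespace DataExchange
open Sized (Within)

/-! ## The exact solver -/

namespace Prog

variable {Γ : Type}

/-- The variables of the linear program: pairs of an agent and a bundle, with their numbers. -/
def varsE : Prog (ℕ × ℝ) (List (ℕ × ℕ × List ℕ)) :=
  enumE (flatMapE (rangeE fst)
    (mapE (subsetsE (filterE (rangeE (fst.comp fst)) (cond (eqE snd (snd.comp fst)) falseE trueE)))
      ((snd.comp fst).pair snd)))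

def formE (c : Prog Γ (ℕ × ℝ)) (vs : Prog Γ (List (ℕ × ℕ × List ℕ)))
    (F : Prog (Γ × (ℕ × List ℕ)) ℝ) : Prog Γ (List (ℕ × ℝ)) :=
  consE c (mapE vs ((fst.comp snd).pair (F.comp (fst.pair (snd.comp snd)))))

/-- The net amount that the agent in the context receives when a bundle is delivered. -/
def netE : Prog ((Γ × ℕ) × (ℕ × List ℕ)) ℝ :=
  subE (cond (eqE (fst.comp snd) (snd.comp fst)) (utilityE (fst.comp snd) (snd.comp snd)) realZero)
    (shareE (fst.comp snd) (snd.comp fst) (snd.comp snd))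

/-- The constraints of the linear program. The variable `1` is an upper bound on the number of
agents minus the welfare. -/
def systemE : Prog ((ℕ × ℝ) × List (ℕ × ℕ × List ℕ)) (List (List (ℕ × ℝ))) :=
  appendE (mapE (rangeE (fst.comp fst)) (formE (natZero.pair realOne) (snd.comp fst)
      (cond (eqE (fst.comp snd) (snd.comp fst)) (negE realOne) realZero)))
    (appendE (mapE (rangeE (fst.comp fst)) (formE (natZero.pair (snd.comp (fst.comp fst)))
        (snd.comp fst) netE))
      (appendE (mapE (rangeE (fst.comp fst)) (formE (natZero.pair (snd.comp (fst.comp fst)))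
          (snd.comp fst) (negE netE)))
        (consE (consE ((natLit 1).pair realOne)
          (formE (natZero.pair (negE (castE (fst.comp fst)))) snd
            (utilityE (fst.comp snd) (snd.comp snd)))) nil)))

def forwardE : Prog (((ℕ × ℝ) × List (ℕ × ℕ × List ℕ)) × List (List (ℕ × ℝ)))
    (List (List (ℕ × ℝ)) × List (ℕ × List (List (ℕ × ℝ)))) :=
  fold (appendE (mapE (snd.comp fst) (fst.comp snd)) (consE (natLit 1) nil)) (snd.pair nil)
    ((elimE snd (fst.comp (snd.comp fst))).pair
      (consE (snd.pair (fst.comp (snd.comp fst))) (snd.comp (snd.comp fst))))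

def backE (st : Prog Γ (List (ℕ × List (List (ℕ × ℝ))))) : Prog Γ (List (ℕ × ℝ)) :=
  fold st (consE (natZero.pair realOne) nil)
    (consE ((fst.comp snd).pair (leastE (fst.comp snd) (snd.comp snd) (snd.comp fst)))
      (snd.comp fst))

def exactE : Prog (ℕ × ℝ) (List (ℕ × List ℕ × ℝ)) :=
  bind varsE (bind systemE (bind forwardE (bind (backE (snd.comp snd))
    (mapE (snd.comp (fst.comp (fst.comp fst)))
      ((fst.comp (snd.comp snd)).pair
        ((snd.comp (snd.comp snd)).pair (lookupE (fst.comp snd) (snd.comp fst))))))))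

end Prog

namespace Tame

open Prog

variable {Γ A B : Type} [Sized Γ] [Sized A] [Sized B]

instance trueE : Tame (trueE : Prog Γ Bool) := by unfold Prog.trueE; infer_instance
instance falseE : Tame (falseE : Prog Γ Bool) := by unfold Prog.falseE; infer_instance
instance posE (e : Prog Γ ℝ) [Tame e] : Tame (posE e) := by unfold Prog.posE; infer_instance
instance negE (e : Prog Γ ℝ) [Tame e] : Tame (negE e) := by unfold Prog.negE; infer_instance
instance lookupE (k : Prog Γ ℕ) (c : Prog Γ (List (ℕ × ℝ))) [Tame k] [Tame c] :
    Tame (lookupE k c) := by unfold Prog.lookupE; infer_instance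
instance scaleE (a : Prog Γ ℝ) (c : Prog Γ (List (ℕ × ℝ))) [Tame a] [Tame c] :
    Tame (scaleE a c) := by unfold Prog.scaleE; infer_instance
instance evalE (σ c : Prog Γ (List (ℕ × ℝ))) [Tame σ] [Tame c] : Tame (evalE σ c) := by
  unfold Prog.evalE; infer_instance
instance elimE (k : Prog Γ ℕ) (s : Prog Γ (List (List (ℕ × ℝ)))) [Tame k] [Tame s] :
    Tame (elimE k s) := by unfold Prog.elimE; infer_instance
instance leastE (k : Prog Γ ℕ) (s : Prog Γ (List (List (ℕ × ℝ)))) (σ : Prog Γ (List (ℕ × ℝ)))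
    [Tame k] [Tame s] [Tame σ] : Tame (leastE k s σ) := by unfold Prog.leastE; infer_instance
instance subsetsE (l : Prog Γ (List ℕ)) [Tame l] : Tame (subsetsE l) := by
  unfold Prog.subsetsE; infer_instance
instance natLit (k : ℕ) : Tame (natLit k : Prog Γ ℕ) := by
  induction k with
  | zero => unfold Prog.natLit; infer_instance
  | succ k ih => unfold Prog.natLit; infer_instance
instance enumE (l : Prog Γ (List B)) [Tame l] : Tame (enumE l) := by
  unfold Prog.enumE; infer_instance
instance formE (c : Prog Γ (ℕ × ℝ)) (vs : Prog Γ (List (ℕ × ℕ × List ℕ)))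
    (F : Prog (Γ × (ℕ × List ℕ)) ℝ) [Tame c] [Tame vs] [Tame F] : Tame (formE c vs F) := by
  unfold Prog.formE; infer_instance
instance netE : Tame (netE : Prog ((Γ × ℕ) × (ℕ × List ℕ)) ℝ) := by
  unfold Prog.netE; infer_instance
instance backE (st : Prog Γ (List (ℕ × List (List (ℕ × ℝ))))) [Tame st] : Tame (backE st) := by
  unfold Prog.backE; infer_instance
instance varsE : Tame varsE := by unfold Prog.varsE; infer_instance
set_option synthInstance.maxSize 4096
set_option synthInstance.maxHeartbeats 400000

instance systemE : Tame systemE := by unfold Prog.systemE; infer_instance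
instance forwardE : Tame forwardE := by unfold Prog.forwardE; infer_instance
instance exactE : Tame exactE := by unfold Prog.exactE; infer_instance

end Tame

/-! ### Correctness -/

theorem list_sum_neg {α : Type*} (l : List α) (f : α → ℝ) :
    (l.map fun a => -f a).sum = -(l.map f).sum := by
  induction l with
  | nil => simp
  | cons a l ih => simp only [List.map_cons, List.sum_cons, ih]; ring

theorem list_sum_sub {α : Type*} (l : List α) (f g : α → ℝ) :
    (l.map fun a => f a - g a).sum = (l.map f).sum - (l.map g).sum := by
  simp only [sub_eq_add_neg, List.sum_map_add, list_sum_neg]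

/-- All pairs of an agent and a bundle. -/
def allPairs (n : ℕ) : List (ℕ × List ℕ) :=
  (List.range n).flatMap fun i =>
    (subsets ((List.range n).filter fun j => j ≠ i)).map fun s => (i, s)

theorem sum_allPairs {n : ℕ} (g : ℕ × List ℕ → ℝ) (F : Fin n → Finset (Fin n) → ℝ)
    (h : ∀ (i : Fin n) (s : List ℕ), g ((i : ℕ), s) = F i (toBundle i s)) :
    ((allPairs n).map g).sum = ∑ i, ∑ S ∈ bundles i, F i S := by
  have h1 : ∀ i : Fin n, ((subsets ((List.range n).filter fun j => j ≠ (i : ℕ))).map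
      fun s => g ((i : ℕ), s)).sum = ∑ S ∈ bundles i, F i S := by
    intro i
    have e : (List.range n).filter (fun j => j ≠ (i : ℕ)) =
        ((List.finRange n).filter fun j => j ≠ i).map Fin.val := by
      rw [← List.map_coe_finRange_eq_range, List.filter_map]
      congr 1
      refine List.filter_congr fun j _ => ?_
      simp [Fin.ext_iff]
    simp only [h]
    rw [e, sum_subsets i _ ((List.nodup_finRange n).filter _) (by simp) (F i)]
    congr 1
    rw [bundles]
    congr 1
    ext j
    simp
  rw [allPairs, List.map_flatMap, List.flatMap_def, List.sum_flatten, List.map_map]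
  rw [← List.map_coe_finRange_eq_range, List.map_map]
  simp only [List.map_map, Function.comp_def]
  rw [List.map_coe_finRange_eq_range, List.map_congr_left fun i _ => h1 i]
  exact (Fin.sum_univ_def _).symm

theorem fst_lt_of_mem_allPairs {n : ℕ} {e : ℕ × List ℕ} (h : e ∈ allPairs n) : e.1 < n := by
  simp only [allPairs, List.mem_flatMap, List.mem_map, List.mem_range] at h
  obtain ⟨i, hi, s, _, rfl⟩ := h
  exact hi

theorem val_varsE {n : ℕ} (M : Market n) (k : ℕ) (ε : ℝ) :
    (Prog.varsE.val M (k, ε)).map Prod.snd = (allPairs k).reverse ∧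
      ((Prog.varsE.val M (k, ε)).map Prod.fst).Nodup ∧
      ∀ e ∈ Prog.varsE.val M (k, ε), 2 ≤ e.1 := by
  have h := Prog.val_enumE M (k, ε) (Prog.flatMapE (Prog.rangeE Prog.fst)
    (Prog.mapE (Prog.subsetsE (Prog.filterE (Prog.rangeE (Prog.fst.comp Prog.fst))
      (Prog.cond (Prog.eqE Prog.snd (Prog.snd.comp Prog.fst)) Prog.falseE Prog.trueE)))
      ((Prog.snd.comp Prog.fst).pair Prog.snd)) : Prog (ℕ × ℝ) (List (ℕ × List ℕ)))
  refine ⟨h.1.trans ?_, h.2⟩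
  congr 1
  simp only [Prog.val_flatMapE, Prog.val_rangeE, Prog.val_fst, Prog.val_mapE, Prog.val_subsetsE,
    Prog.val_filterE, Prog.val_comp, Prog.val_pair, Prog.val_snd, allPairs]
  congr 1
  funext i
  congr 3
  funext j
  rw [Bool.eq_iff_iff, Prog.val_cond]
  split
  · rename_i hj
    rw [Prog.val_eqE] at hj
    simpa using hj
  · rename_i hj
    rw [Prog.val_eqE] at hj
    simpa using hj

theorem lookup_of_mem {c : List (ℕ × ℝ)} (hc : (c.map Prod.fst).Nodup) {e : ℕ × ℝ} (he : e ∈ c) :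
    lookup e.1 c = e.2 := by
  have h0 : ∀ (c : List (ℕ × ℝ)) k, k ∉ c.map Prod.fst → lookup k c = 0 := by
    intro c k hk
    apply List.sum_eq_zero
    intro x hx
    obtain ⟨e, he, rfl⟩ := List.mem_map.mp hx
    rw [if_neg]
    rintro rfl
    exact hk (List.mem_map.mpr ⟨e, he, rfl⟩)
  induction c with
  | nil => simp at he
  | cons d c ih =>
    simp only [List.map_cons, List.nodup_cons] at hc
    rw [lookup_cons]
    rcases List.mem_cons.mp he with rfl | he
    · rw [if_pos rfl, h0 c _ hc.1, add_zero]
    · rw [if_neg, zero_add, ih hc.2 he]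
      intro h
      exact hc.1 (h ▸ List.mem_map.mpr ⟨e, he, rfl⟩)

/-- The output for a valuation of the variables. -/
def outputOf (vs : List (ℕ × ℕ × List ℕ)) (σ : ℕ → ℝ) : List (ℕ × List ℕ × ℝ) :=
  vs.map fun v => (v.2.1, v.2.2, σ v.1)

/-- A linear form with one term outside the variables of the linear program. -/
def formOf (c : ℕ × ℝ) (vs : List (ℕ × ℕ × List ℕ)) (F : ℕ × List ℕ → ℝ) : List (ℕ × ℝ) :=
  c :: vs.map fun v => (v.1, F v.2)

theorem evalForm_formOf (σ : ℕ → ℝ) (c : ℕ × ℝ) (vs : List (ℕ × ℕ × List ℕ))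
    (F : ℕ × List ℕ → ℝ) : evalForm σ (formOf c vs F) =
      c.2 * σ c.1 + (vs.map fun v => F v.2 * σ v.1).sum := by
  simp [evalForm, formOf, Function.comp_def]

section

variable {n : ℕ} {M : Market n}

theorem mem_val_systemE (ε : ℝ) (vs : List (ℕ × ℕ × List ℕ)) (c : List (ℕ × ℝ)) :
    c ∈ Prog.systemE.val M ((n, ε), vs) ↔
      (∃ i : Fin n, c = formOf (0, 1) vs fun e => if e.1 = (i : ℕ) then -1 else 0) ∨
      (∃ i : Fin n, c = formOf (0, ε) vs fun e =>
        (if e.1 = (i : ℕ) then M.askUtility e.1 e.2 else 0) - M.askShare e.1 (i : ℕ) e.2) ∨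
      (∃ i : Fin n, c = formOf (0, ε) vs fun e =>
        -((if e.1 = (i : ℕ) then M.askUtility e.1 e.2 else 0) - M.askShare e.1 (i : ℕ) e.2)) ∨
      c = (1, 1) :: formOf (0, -n) vs fun e => M.askUtility e.1 e.2 := by
  simp only [Prog.systemE, Prog.val_appendE, List.mem_append, Prog.val_mapE, List.mem_map,
    Prog.val_rangeE, Prog.formE, Prog.netE, Prog.val_consE, Prog.val_comp, Prog.val_fst,
    Prog.val_snd, Prog.val_pair, Prog.val_natZero, Prog.val_realOne, Prog.val_cond, Prog.val_eqE,
    Prog.val_negE, Prog.val_realZero, Prog.val_subE, Prog.val_utilityE, Prog.val_shareE,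
    Prog.val_nil, List.mem_singleton, Prog.val_castE, Prog.val_natLit, formOf, List.mem_range]
  have hex : ∀ p : ℕ → Prop, (∃ a, a < n ∧ p a) ↔ ∃ i : Fin n, p i := fun p =>
    ⟨fun ⟨a, h, hp⟩ => ⟨⟨a, h⟩, hp⟩, fun ⟨i, hp⟩ => ⟨i, i.2, hp⟩⟩
  simp only [hex, eq_comm (a := c)]

/-- The linear system says exactly that the decoded output is ε-balanced and that the variable `1`
bounds `n - welfare` from above. Minimizing that variable therefore maximizes the welfare. -/
theorem feasible_iff (hV : M.Valid) {ε : ℝ} {vs : List (ℕ × ℕ × List ℕ)}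
    (hvs : ∀ v ∈ vs, v.2.1 < n) {σ : ℕ → ℝ} (h0 : σ 0 = 1) (hnn : ∀ v ∈ vs, 0 ≤ σ v.1) :
    Feasible σ (Prog.systemE.val M ((n, ε), vs)) ↔
      BalancedUpTo M ε (decode (outputOf vs σ)) ∧
        n - welfare M (decode (outputOf vs σ)) ≤ σ 1 := by
  have hL : ∀ e ∈ outputOf vs σ, e.1 < n := by
    intro e he
    obtain ⟨v, hv, rfl⟩ := List.mem_map.mp he
    exact hvs v hv
  have hnL : ∀ e ∈ outputOf vs σ, 0 ≤ e.2.2 := by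
    intro e he
    obtain ⟨v, hv, rfl⟩ := List.mem_map.mp he
    exact hnn v hv
  have e1 : ∀ i : Fin n, evalForm σ (formOf (0, 1) vs fun e => if e.1 = (i : ℕ) then -1 else 0) =
      1 - ∑ S ∈ bundles i, decode (outputOf vs σ) i S := by
    intro i
    have := sum_decode (outputOf vs σ) i (fun _ => 1)
    simp only [one_mul] at this
    rw [this, evalForm_formOf, h0, outputOf, List.map_map, sub_eq_add_neg, ← list_sum_neg]
    simp only [one_mul, Function.comp_def, ite_mul, neg_mul, zero_mul, neg_ite, neg_zero, mul_one]
  have e2 : ∀ i : Fin n, (vs.map fun v =>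
      ((if v.2.1 = (i : ℕ) then M.askUtility v.2.1 v.2.2 else 0) -
      M.askShare v.2.1 (i : ℕ) v.2.2) * σ v.1).sum =
      received M (decode (outputOf vs σ)) i - contributed M (decode (outputOf vs σ)) i := by
    intro i
    rw [hV.received_decode, contributed_decode _ hL, outputOf, List.map_map, List.map_map]
    simp only [sub_mul, list_sum_sub, Function.comp_def]
  have e3 : evalForm σ ((1, 1) :: formOf (0, -n) vs fun e => M.askUtility e.1 e.2) =
      σ 1 - n + welfare M (decode (outputOf vs σ)) := by
    rw [evalForm_cons, evalForm_formOf, welfare_decode _ hL, outputOf, List.map_map, h0]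
    simp only [Function.comp_def]
    ring
  constructor
  · intro h
    refine ⟨⟨fun i S _ => decode_nonneg hnL i S, fun i => ?_, fun i => ?_⟩, ?_⟩
    · have := h _ ((mem_val_systemE ε vs _).mpr (Or.inl ⟨i, rfl⟩))
      rw [e1] at this
      linarith
    · have h1 := h _ ((mem_val_systemE ε vs _).mpr (Or.inr (Or.inl ⟨i, rfl⟩)))
      have h2 := h _ ((mem_val_systemE ε vs _).mpr (Or.inr (Or.inr (Or.inl ⟨i, rfl⟩))))
      rw [evalForm_formOf] at h1 h2
      simp only [neg_mul, list_sum_neg] at h2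
      rw [e2, h0] at h1 h2
      rw [abs_le]
      constructor <;> linarith
    · have := h _ ((mem_val_systemE ε vs _).mpr (Or.inr (Or.inr (Or.inr rfl))))
      rw [e3] at this
      linarith
  · rintro ⟨hb, hw⟩ c hc
    rcases (mem_val_systemE ε vs c).mp hc with ⟨i, rfl⟩ | ⟨i, rfl⟩ | ⟨i, rfl⟩ | rfl
    · rw [e1]
      linarith [hb.sum_le_one i]
    · have := abs_le.mp (hb.balance i)
      rw [evalForm_formOf, e2, h0]
      linarith
    · have := abs_le.mp (hb.balance i)
      rw [evalForm_formOf]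
      simp only [neg_mul, list_sum_neg]
      rw [e2, h0]
      linarith
    · rw [e3]
      linarith

/-- Every solution arises from a valuation of the variables: each bundle is enumerated once,
possibly in a different representation as a list, so decoding picks out a single term. -/
theorem decode_outputOf {vs : List (ℕ × ℕ × List ℕ)}
    (hvs : vs.map Prod.snd = (allPairs n).reverse) {y : Fin n → Finset (Fin n) → ℝ} {τ : ℕ → ℝ}
    {g : ℕ × List ℕ → ℝ} (hτ : ∀ v ∈ vs, τ v.1 = g v.2)
    (hg : ∀ (i : Fin n) (s : List ℕ), g ((i : ℕ), s) = y i (toBundle i s)) (i : Fin n)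
    {S : Finset (Fin n)} (hS : S ∈ bundles i) : decode (outputOf vs τ) i S = y i S := by
  have h1 : decode (outputOf vs τ) i S = ((vs.map Prod.snd).map fun e : ℕ × List ℕ =>
      if e.1 = (i : ℕ) ∧ toBundle i e.2 = S then g e else 0).sum := by
    rw [decode, outputOf, List.map_map, List.map_map]
    congr 1
    refine List.map_congr_left fun v hv => ?_
    simp only [Function.comp_apply, hτ v hv]
  rw [h1, hvs, List.map_reverse, List.sum_reverse,
    sum_allPairs _ (fun j S' => if j = i ∧ S' = S then y j S' else 0)]
  · rw [Finset.sum_eq_single i, Finset.sum_eq_single S]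
    · simp
    · intro S' _ h; simp [h]
    · intro h; exact absurd hS h
    · intro j _ h; simp [h]
    · simp
  · intro j s
    simp only [hg, Fin.val_inj]
    by_cases hji : j = i
    · subst hji; rfl
    · simp [hji]

theorem BalancedUpTo.congr {ε : ℝ} {x y : Fin n → Finset (Fin n) → ℝ} (hx : BalancedUpTo M ε x)
    (h : ∀ i, ∀ S ∈ bundles i, y i S = x i S) : BalancedUpTo M ε y := by
  refine ⟨fun i S hS => by rw [h i S hS]; exact hx.nonneg i S hS, fun i => ?_, fun i => ?_⟩
  · rw [Finset.sum_congr rfl fun S hS => h i S hS]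
    exact hx.sum_le_one i
  · have e1 : received M y i = received M x i :=
      Finset.sum_congr rfl fun S hS => by rw [h i S hS]
    have e2 : contributed M y i = contributed M x i :=
      Finset.sum_congr rfl fun j _ => Finset.sum_congr rfl fun S hS => by
        rw [h j S (Finset.mem_of_mem_filter S hS)]
    rw [e1, e2]
    exact hx.balance i

theorem welfare_congr {x y : Fin n → Finset (Fin n) → ℝ}
    (h : ∀ i, ∀ S ∈ bundles i, y i S = x i S) : welfare M y = welfare M x :=
  Finset.sum_congr rfl fun i _ => Finset.sum_congr rfl fun S hS => by rw [h i S hS]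

theorem BalancedUpTo.welfare_le {ε : ℝ} {x : Fin n → Finset (Fin n) → ℝ} (hV : M.Valid)
    (hx : BalancedUpTo M ε x) : welfare M x ≤ n := by
  have h := hx.sum_le (F := fun i S => M.u i S) (a := 0) (b := fun _ => 1)
    (fun _ => zero_le_one) fun i S hi => by simpa using hV.le_one i S hi
  simpa [welfare] using h

/-- Any ε-balanced `y` gives a feasible point with variable `1` equal to `n - welfare M y`, which is
non-negative as the variables must be. By `exists_solution` the point that is found has a value of
variable `1` no larger. -/
theorem exactE_correct (hV : M.Valid) {ε : ℝ} (hε : 0 ≤ ε) :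
    BalancedUpTo M ε (decode (Prog.exactE.val M (n, ε))) ∧
      ∀ y, BalancedUpTo M ε y → welfare M y ≤ welfare M (decode (Prog.exactE.val M (n, ε))) := by
  obtain ⟨hv1, hv2, hv3⟩ := val_varsE M n ε
  set vs := Prog.varsE.val M (n, ε) with hvs
  have hvlt : ∀ v ∈ vs, v.2.1 < n := fun v hv =>
    fst_lt_of_mem_allPairs (List.mem_reverse.mp (hv1 ▸ List.mem_map.mpr ⟨v, hv, rfl⟩))
  set sys := Prog.systemE.val M ((n, ε), vs) with hsys
  set fwd := Prog.forwardE.val M (((n, ε), vs), sys) with hfwd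
  set bk := (Prog.backE (Prog.snd.comp Prog.snd)).val M ((((n, ε), vs), sys), fwd) with hbk
  have hout : Prog.exactE.val M (n, ε) = outputOf vs fun k => lookup k bk := by
    simp only [Prog.exactE, Prog.val_bind, Prog.val_mapE, Prog.val_comp, Prog.val_pair,
      Prog.val_snd, Prog.val_fst, Prog.val_lookupE]
    rfl
  have hkeys : ∀ (ks : List ℕ) (s : List (List (ℕ × ℝ))) (st : List (ℕ × List (List (ℕ × ℝ)))),
      Chain sys st s → ∀ r, r = ks.foldl (fun (a : List (List (ℕ × ℝ)) × _) k =>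
        ((Prog.elimE Prog.snd (Prog.fst.comp (Prog.snd.comp Prog.fst))).val M
          (((((n, ε), vs), sys), a), k), (k, a.1) :: a.2)) (s, st) →
      Chain sys r.2 r.1 ∧ r.2.map Prod.fst = ks.reverse ++ st.map Prod.fst := by
    intro ks
    induction ks with
    | nil => rintro s st h r rfl; exact ⟨h, by simp⟩
    | cons k ks ih =>
      rintro s st h r hr
      rw [List.foldl_cons] at hr
      obtain ⟨h1, h2⟩ := ih _ _ (Chain.cons h (Prog.val_elimE M (((((n, ε), vs), sys), (s, st)), k)
        Prog.snd (Prog.fst.comp (Prog.snd.comp Prog.fst)))) r hr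
      exact ⟨h1, by simp [h2]⟩
  -- The variable `1` is eliminated last, so it is on top of the stack and is the one minimized.
  obtain ⟨hch, hst⟩ := hkeys (vs.map Prod.fst ++ [1]) sys [] Chain.nil fwd (by
    rw [hfwd]
    simp only [Prog.forwardE, Prog.val_fold, Prog.val_appendE, Prog.val_mapE, Prog.val_comp,
      Prog.val_snd, Prog.val_fst, Prog.val_consE, Prog.val_natLit, Prog.val_nil, Prog.val_pair])
  simp only [List.reverse_append, List.reverse_cons, List.reverse_nil, List.nil_append,
    List.map_nil, List.append_nil, List.cons_append] at hst
  obtain ⟨s', stk⟩ := fwd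
  simp only at hch hst
  obtain _ | ⟨⟨k, s⟩, st⟩ := stk
  · simp at hst
  have hk : k = 1 := by simpa using (List.cons.inj hst).1
  subst hk
  set least : List (ℕ × ℝ) → ℕ × List (List (ℕ × ℝ)) → ℝ := fun σ e =>
    (Prog.leastE (Prog.fst.comp Prog.snd) (Prog.snd.comp Prog.snd) (Prog.snd.comp Prog.fst)).val M
      ((((((n, ε), vs), sys), (s', (1, s) :: st)), σ), e) with hleast
  have hl : ∀ σ e, IsLeast' e.1 e.2 (fun k => lookup k σ) (least σ e) := fun σ e =>
    Prog.val_leastE M ((((((n, ε), vs), sys), (s', (1, s) :: st)), σ), e) _ _ _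
  have hbk' : bk = ((1, s) :: st).foldl (fun σ e => (e.1, least σ e) :: σ) [(0, 1)] := by
    rw [hbk]
    simp only [Prog.backE, Prog.val_fold, Prog.val_comp, Prog.val_snd, Prog.val_consE,
      Prog.val_pair, Prog.val_natZero, Prog.val_realOne, Prog.val_nil, Prog.val_fst]
    rfl
  have hmemst : ∀ m, m ∈ ((1, s) :: st).map Prod.fst ↔ m = 1 ∨ m ∈ vs.map Prod.fst := by
    intro m
    rw [hst, List.mem_cons, List.mem_reverse]
  have hge : ∀ m ∈ vs.map Prod.fst, 2 ≤ m := by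
    intro m hm
    obtain ⟨v, hv, rfl⟩ := List.mem_map.mp hm
    exact hv3 v hv
  have key : ∀ y, BalancedUpTo M ε y → BalancedUpTo M ε (decode (Prog.exactE.val M (n, ε))) ∧
      welfare M y ≤ welfare M (decode (Prog.exactE.val M (n, ε))) := by
    intro y hy
    set g : ℕ × List ℕ → ℝ := fun e =>
      if h : e.1 < n then y ⟨e.1, h⟩ (toBundle ⟨e.1, h⟩ e.2) else 0 with hg
    set cs : List (ℕ × ℝ) := (0, 1) :: (1, n - welfare M y) :: vs.map fun v => (v.1, g v.2)
      with hcs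
    have hcn : (cs.map Prod.fst).Nodup := by
      simp only [hcs, List.map_cons, List.map_map, Function.comp_def, List.nodup_cons,
        List.mem_cons]
      refine ⟨?_, ?_, hv2⟩
      · rintro (h | h)
        · exact absurd h (by norm_num)
        · have := hge 0 h; omega
      · intro h
        have := hge 1 h
        omega
    set τ : ℕ → ℝ := fun m => lookup m cs with hτ
    have ht0 : τ 0 = 1 := lookup_of_mem hcn (e := (0, 1)) (by simp [hcs])
    have ht1 : τ 1 = n - welfare M y := lookup_of_mem hcn (e := (1, _)) (by simp [hcs])
    have htv : ∀ v ∈ vs, τ v.1 = g v.2 := fun v hv =>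
      lookup_of_mem hcn (e := (v.1, g v.2)) (by
        simp only [hcs, List.mem_cons, List.mem_map]
        exact Or.inr (Or.inr ⟨v, hv, rfl⟩))
    have hgy : ∀ (i : Fin n) (l : List ℕ), g ((i : ℕ), l) = y i (toBundle i l) := fun i l => by
      simp [hg]
    have hdec := fun i S (hS : S ∈ bundles i) => decode_outputOf hv1 htv hgy i hS
    have htnn : ∀ v ∈ vs, 0 ≤ τ v.1 := by
      intro v hv
      rw [htv v hv]
      simp only [hg, dif_pos (hvlt v hv)]
      exact hy.nonneg _ _ (toBundle_mem_bundles _ _)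
    have hfeas : Feasible τ sys := by
      rw [hsys, feasible_iff hV hvlt ht0 htnn]
      refine ⟨hy.congr hdec, ?_⟩
      rw [welfare_congr hdec, ht1]
    obtain ⟨h1, h2, h3, h4⟩ := exists_solution hch least hl
      (by rw [hst]; exact List.nodup_cons.mpr ⟨fun h => by
        have := hge 1 (List.mem_reverse.mp h); omega, List.nodup_reverse.mpr hv2⟩)
      (by
        rw [hmemst]
        rintro (h | h)
        · exact absurd h (by norm_num)
        · have := hge 0 h; omega)
      (by
        intro c hc m hm0 hm
        rw [hmemst, not_or] at hm
        have hform : ∀ a F, lookup m (formOf (0, a) vs F) = 0 := by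
          intro a F
          apply List.sum_eq_zero
          intro x hx
          obtain ⟨e, he, rfl⟩ := List.mem_map.mp hx
          rw [if_neg]
          rintro rfl
          rcases List.mem_cons.mp he with rfl | he
          · exact hm0 rfl
          · obtain ⟨v, hv, rfl⟩ := List.mem_map.mp he
            exact hm.2 (List.mem_map.mpr ⟨v, hv, rfl⟩)
        rcases (mem_val_systemE ε vs c).mp hc with ⟨i, rfl⟩ | ⟨i, rfl⟩ | ⟨i, rfl⟩ | rfl
        · exact hform _ _
        · exact hform _ _
        · exact hform _ _
        · rw [lookup_cons, if_neg hm.1, zero_add]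
          exact hform _ _)
      (σ := fun k => lookup k bk) (by rw [hbk']) hfeas ht0 (by
        intro m hm
        rcases (hmemst m).mp hm with rfl | hm
        · rw [ht1]
          have := hy.welfare_le hV
          linarith
        · obtain ⟨v, hv, rfl⟩ := List.mem_map.mp hm
          exact htnn v hv)
    have hnn : ∀ v ∈ vs, 0 ≤ lookup v.1 bk := fun v hv =>
      h2 v.1 ((hmemst _).mpr (Or.inr (List.mem_map.mpr ⟨v, hv, rfl⟩)))
    obtain ⟨g1, g2⟩ := (feasible_iff hV hvlt h3 hnn).mp h1
    rw [hout]
    refine ⟨g1, ?_⟩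
    rw [ht1] at h4
    linarith
  -- The zero solution shows that the linear program is feasible.
  refine ⟨(key (fun _ _ => 0) ⟨fun _ _ _ => le_rfl, by simp, ?_⟩).1, fun y hy => (key y hy).2⟩
  intro i
  simpa [received, contributed] using hε

end

end DataExchange

/-! ### The dual algorithm: knapsack oracle, rounds, and quality of the averaged output -/

namespace DataExchange
open Sized (Within)

/-! ## The dual algorithm: programs -/

/-- Parameters of the dual algorithm: accuracy `N`, drift `θ`, weight of the welfare and step. -/
abbrev Params := ℕ × ℝ × ℝ × ℝ

/-- Total size of a list of items. The second component of an item is its size. -/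
def itemsSize (l : List (ℕ × ℝ × ℝ)) : ℝ := (l.map fun x => x.2.1).sum

/-- Total gain of a list of items. The third component of an item is its gain. -/
def itemsGain (l : List (ℕ × ℝ × ℝ)) : ℝ := (l.map fun x => x.2.2).sum

namespace Prog

variable {Γ A B : Type}

def powN (e : Prog Γ ℕ) : ℕ → Prog Γ ℕ
  | 0 => succE natZero
  | k + 1 => mulN (powN e k) e

def powE (e : Prog Γ ℝ) : ℕ → Prog Γ ℝ
  | 0 => realOne
  | k + 1 => mulE (powE e k) e

def sgnE (e : Prog Γ ℝ) : Prog Γ ℝ := cond (leE realZero e) realOne (negE realOne)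

/-- A list of large gain and of at most a given multiple of the size `u`. It is one of the given
lists, possibly with the given item put in front. -/
def packE (u : Prog Γ ℝ) :
    Prog (((Γ × List (List (ℕ × ℝ × ℝ))) × (ℕ × ℝ × ℝ)) × ℕ) (List (ℕ × ℝ × ℝ)) :=
  argmaxE
    (filterE (appendE (snd.comp (fst.comp fst))
        (mapE (snd.comp (fst.comp fst)) (consE (snd.comp (fst.comp fst)) snd)))
      (leE (sumE snd (fst.comp (snd.comp snd)))
        (mulE (castE (snd.comp fst)) (u.comp (fst.comp (fst.comp (fst.comp fst)))))))
    nil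
    (sumE snd (snd.comp (snd.comp snd)))

/-- For each of the first `q` multiples of `u`, a list of items of at most that size, and with
large gain. -/
def knapE (q : Prog Γ ℕ) (u : Prog Γ ℝ) (items : Prog Γ (List (ℕ × ℝ × ℝ))) :
    Prog Γ (List (List (ℕ × ℝ × ℝ))) :=
  fold items (consE nil nil) (mapE (rangeE (wk (wk q))) (packE u))

theorem val_packE {n : ℕ} (M : Market n) (u : Prog Γ ℝ) (γ : Γ) (L : List (List (ℕ × ℝ × ℝ)))
    (x : ℕ × ℝ × ℝ) (k : ℕ) (r : List (ℕ × ℝ × ℝ))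
    (hr : r = (packE u).val M (((γ, L), x), k)) :
    (r = [] ∨ (r ∈ L ∨ ∃ e ∈ L, x :: e = r) ∧ itemsSize r ≤ k * u.val M γ) ∧
      ∀ e', (e' ∈ L ∨ ∃ e ∈ L, x :: e = e') → itemsSize e' ≤ k * u.val M γ →
        itemsGain e' ≤ itemsGain r := by
  obtain ⟨h1, h2⟩ := val_argmaxE M (((γ, L), x), k)
    (filterE (appendE (snd.comp (fst.comp fst))
        (mapE (snd.comp (fst.comp fst)) (consE (snd.comp (fst.comp fst)) snd)))
      (leE (sumE snd (fst.comp (snd.comp snd)))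
        (mulE (castE (snd.comp fst)) (u.comp (fst.comp (fst.comp (fst.comp fst)))))))
    nil (sumE snd (snd.comp (snd.comp snd)))
  rw [← packE, ← hr] at h1 h2
  simp only [val_filterE, List.mem_cons, List.mem_filter, val_appendE, val_mapE, val_comp, val_fst,
    val_snd, val_nil, val_consE, List.mem_append, List.mem_map, val_leE, val_sumE, val_mulE,
    val_castE] at h1 h2
  exact ⟨h1, fun e' he hs => h2 e' (Or.inr ⟨he, hs⟩)⟩

/-- The price of a set for the agent in the context, given the dual variables. -/
def priceE (l : Prog Γ (List ℕ)) (i : Prog Γ (ℕ × ℝ)) (tab : Prog Γ (List (ℕ × ℝ)))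
    (R : Prog Γ ℝ) : Prog Γ ℝ :=
  sumE tab (mulE (shareE (fst.comp (wk i)) (fst.comp snd) (wk l))
    (subE (addE (wk R) (snd.comp snd)) (snd.comp (wk i))))

/-- The sets of agents with large dual variables. -/
def levelsE : Prog ((Params × List (ℕ × ℝ)) × (ℕ × ℝ)) (List (List ℕ)) :=
  mapE (snd.comp fst)
    (mapE (filterE (snd.comp (fst.comp fst)) (leE (snd.comp (snd.comp fst)) (snd.comp snd)))
      (fst.comp snd))

/-- The agents with their shares and their gains for the agent in the context. -/
def itemsE : Prog ((Params × List (ℕ × ℝ)) × (ℕ × ℝ)) (List (ℕ × ℝ × ℝ)) :=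
  bind (mapE (snd.comp fst) (fst.comp snd))
    (mapE (snd.comp (fst.comp fst))
      (bind (shareE (fst.comp (snd.comp (fst.comp fst))) (fst.comp snd) (snd.comp fst))
        ((fst.comp (snd.comp fst)).pair (snd.pair
          (mulE snd (subE (addE (fst.comp (snd.comp (snd.comp (fst.comp (fst.comp (fst.comp
            (fst.comp fst))))))) (snd.comp (snd.comp fst)))
            (snd.comp (snd.comp (fst.comp (fst.comp fst))))))))))

/-- The results of a scaled knapsack algorithm. -/
def packedE : Prog ((Params × List (ℕ × ℝ)) × (ℕ × ℝ)) (List (List ℕ)) :=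
  bind itemsE
    (flatMapE snd
      (mapE (knapE (powN (fst.comp (fst.comp (fst.comp (fst.comp fst)))) 5)
          (divE (fst.comp (snd.comp snd))
            (powE (castE (fst.comp (fst.comp (fst.comp (fst.comp fst))))) 3))
          (snd.comp fst))
        (mapE snd (fst.comp snd))))

/-- The set that the agent in the context receives. -/
def bestE : Prog ((Params × List (ℕ × ℝ)) × (ℕ × ℝ)) (List ℕ) :=
  argmaxE (appendE levelsE packedE) nil
    (priceE snd (snd.comp fst) (snd.comp (fst.comp fst))
      (fst.comp (snd.comp (snd.comp (fst.comp (fst.comp fst))))))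

def picksE : Prog (Params × List (ℕ × ℝ)) (List (ℕ × List ℕ)) :=
  mapE snd ((fst.comp snd).pair bestE)

/-- The update of a dual variable. -/
def stepE : Prog (((Params × List (ℕ × ℝ)) × List (ℕ × List ℕ)) × (ℕ × ℝ)) ℝ :=
  subE (snd.comp snd)
    (addE
      (sumE (snd.comp fst)
        (subE (shareE (fst.comp snd) (fst.comp (snd.comp fst)) (snd.comp snd))
          (cond (eqE (fst.comp snd) (fst.comp (snd.comp fst)))
            (utilityE (fst.comp snd) (snd.comp snd)) realZero)))
      (mulE (fst.comp (snd.comp (fst.comp (fst.comp fst)))) (sgnE (snd.comp snd))))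

def roundE : Prog (Params × (List (ℕ × ℝ) × List (ℕ × List ℕ × ℝ)))
    (List (ℕ × ℝ) × List (ℕ × List ℕ × ℝ)) :=
  bind (fst.pair (fst.comp snd))
    (bind (picksE.comp snd)
      ((mapE (snd.comp (snd.comp fst))
          ((fst.comp snd).pair
            (stepE.comp ((((snd.comp fst).comp fst).pair (snd.comp fst)).pair snd)))).pair
        (appendE (mapE snd ((fst.comp snd).pair ((snd.comp snd).pair
            (snd.comp (snd.comp (snd.comp (fst.comp (snd.comp (fst.comp fst)))))))))
          (snd.comp (snd.comp (fst.comp fst))))))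

end Prog

namespace Poly

open Prog

variable {Γ A B : Type} [Sized Γ] [Sized A] [Sized B]

instance powN (e : Prog Γ ℕ) [Poly e] (k : ℕ) : Poly (powN e k) := by
  induction k with
  | zero => unfold Prog.powN; infer_instance
  | succ k ih => unfold Prog.powN; infer_instance
instance powE (e : Prog Γ ℝ) [Poly e] (k : ℕ) : Poly (powE e k) := by
  induction k with
  | zero => unfold Prog.powE; infer_instance
  | succ k ih => unfold Prog.powE; infer_instance
instance negE (e : Prog Γ ℝ) [Poly e] : Poly (negE e) := by unfold Prog.negE; infer_instance
instance sgnE (e : Prog Γ ℝ) [Poly e] : Poly (sgnE e) := by unfold Prog.sgnE; infer_instance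
instance priceE (l : Prog Γ (List ℕ)) (i : Prog Γ (ℕ × ℝ)) (tab : Prog Γ (List (ℕ × ℝ)))
    (R : Prog Γ ℝ) [Poly l] [Poly i] [Poly tab] [Poly R] : Poly (priceE l i tab R) := by
  unfold Prog.priceE; infer_instance
set_option synthInstance.maxSize 4096
set_option synthInstance.maxHeartbeats 400000

instance levelsE : Poly levelsE := by unfold Prog.levelsE; infer_instance
instance itemsE : Poly itemsE := by unfold Prog.itemsE; infer_instance
instance stepE : Poly stepE := by unfold Prog.stepE; infer_instance

instance packE (u : Prog Γ ℝ) [Poly u] : Poly (packE u) := by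
  unfold Prog.packE; infer_instance

/-- A round rebuilds the table with one list for each of the `q` cells, each an old list with at
most one item added. So the growth per item is additive, although the candidates double inside a
round. -/
instance knapE (q : Prog Γ ℕ) (u : Prog Γ ℝ) (items : Prog Γ (List (ℕ × ℝ × ℝ))) [hq : Poly q]
    [Poly u] [Poly items] : Poly (knapE q u items) := by
  unfold Prog.knapE
  obtain ⟨d, hd⟩ := hq.bound
  refine fold _ _ _ ⟨fun X => X + (X + 2) ^ d + 1,
    (PolyBdd.id.add (PolyBdd.pow d)).add (PolyBdd.const 1), ?_⟩
  intro n M w H hG X hX γ b a Z hγ hb ha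
  have h : q.val M γ ≤ (X + 2) ^ d := (hd M w H hG X hX γ hγ).2
  beta_reduce
  rw [val_mapE, val_rangeE]
  refine ⟨?_, fun c hc => ?_⟩
  · simp only [List.length_map, List.length_range, wk, val_comp, val_fst]
    omega
  · obtain ⟨k, _, hk⟩ := List.mem_map.mp hc
    rcases (val_packE M u γ a b k c hk.symm).1 with rfl | ⟨h1 | ⟨c, h1, rfl⟩, _⟩
    · exact ⟨Nat.zero_le _, by simp⟩
    · exact Sized.mono hG (ha.2 c h1) (by omega) (by omega)
    · exact Sized.mono hG (within_cons hG (s := X + Z) (b := X + Z)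
        (Sized.mono hG hb (by omega) (by omega)) (Sized.mono hG (ha.2 c h1) (by omega) (by omega)))
        (by omega) (by omega)

instance packedE : Poly packedE := by unfold Prog.packedE; infer_instance
instance bestE : Poly bestE := by unfold Prog.bestE; infer_instance
instance picksE : Poly picksE := by unfold Prog.picksE; infer_instance
instance roundE : Poly roundE := by unfold Prog.roundE; infer_instance

end Poly

end DataExchange

namespace DataExchange
open Sized (Within)

/-! ## The dual algorithm: values of the programs -/

namespace Prog

variable {Γ : Type} {n : ℕ} (M : Market n)

@[simp] theorem val_powN (γ : Γ) (e : Prog Γ ℕ) (k : ℕ) :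
    (powN e k).val M γ = e.val M γ ^ k := by
  induction k with
  | zero => rfl
  | succ k ih => rw [powN, val_mulN, ih, pow_succ]

@[simp] theorem val_powE (γ : Γ) (e : Prog Γ ℝ) (k : ℕ) :
    (powE e k).val M γ = e.val M γ ^ k := by
  induction k with
  | zero => simp [powE]
  | succ k ih => rw [powE, val_mulE, ih, pow_succ]

@[simp] theorem val_sgnE (γ : Γ) (e : Prog Γ ℝ) : (sgnE e).val M γ = sgn (e.val M γ) := by
  simp [sgnE, sgn, negE]

/-- Dynamic programming with sizes rounded up to multiples of the unit `u`. Cell `k` keeps a list of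
largest gain among candidates of size at most `k * u`. Each item can replace a list by one larger in
size by at most one unit, so the loss is at most one unit per item. -/
theorem val_knapE (γ : Γ) (q : Prog Γ ℕ) (u : Prog Γ ℝ) (items : Prog Γ (List (ℕ × ℝ × ℝ)))
    (h0 : ∀ x ∈ items.val M γ, 0 ≤ x.2.1) (hu : 0 ≤ u.val M γ) (B : ℕ)
    (hB : B + (items.val M γ).length < q.val M γ) :
    (∀ e ∈ (knapE q u items).val M γ, e.Sublist (items.val M γ).reverse) ∧
      ∀ S : List (ℕ × ℝ × ℝ), S.Sublist (items.val M γ).reverse →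
        itemsSize S ≤ B * u.val M γ → ∃ e ∈ (knapE q u items).val M γ,
          itemsGain S ≤ itemsGain e ∧
            itemsSize e ≤ itemsSize S + (items.val M γ).length * u.val M γ := by
  set U := u.val M γ with hU
  set F : List (List (ℕ × ℝ × ℝ)) → ℕ × ℝ × ℝ → List (List (ℕ × ℝ × ℝ)) := fun L x =>
    (List.range (q.val M γ)).map fun k => (packE u).val M (((γ, L), x), k) with hF
  have key : ∀ (l P : List (ℕ × ℝ × ℝ)) (L : List (List (ℕ × ℝ × ℝ))),
      (∀ x ∈ l, 0 ≤ x.2.1) → (∀ x ∈ P, 0 ≤ x.2.1) → B + (l.length + P.length) < q.val M γ →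
      ((∀ e ∈ L, e.Sublist P) ∧ ∀ S : List (ℕ × ℝ × ℝ), S.Sublist P → itemsSize S ≤ B * U →
        ∃ e ∈ L, itemsGain S ≤ itemsGain e ∧ itemsSize e ≤ itemsSize S + P.length * U) →
      ((∀ e ∈ l.foldl F L, e.Sublist (l.reverse ++ P)) ∧ ∀ S : List (ℕ × ℝ × ℝ),
        S.Sublist (l.reverse ++ P) → itemsSize S ≤ B * U → ∃ e ∈ l.foldl F L,
          itemsGain S ≤ itemsGain e ∧
            itemsSize e ≤ itemsSize S + (l.length + P.length : ℕ) * U) := by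
    intro l
    induction l with
    | nil => intro P L _ _ _ h; simpa using h
    | cons x l ih =>
      intro P L hl hP hq h
      have hx := hl x (by simp)
      have e1 : (x :: l).reverse ++ P = l.reverse ++ x :: P := by simp
      have e2 : (x :: l).length + P.length = l.length + (x :: P).length := by
        simp only [List.length_cons]; omega
      rw [e1, e2, List.foldl_cons]
      rw [e2] at hq
      refine ih (x :: P) (F L x) (fun y hy => hl y (by simp [hy]))
        (List.forall_mem_cons.mpr ⟨hx, hP⟩) hq ⟨fun e he => ?_, fun S hS hSB => ?_⟩
      · obtain ⟨k, _, hk⟩ := List.mem_map.mp he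
        rcases (val_packE M u γ L x k e hk.symm).1 with rfl | ⟨h1 | ⟨c, h1, rfl⟩, _⟩
        · exact List.nil_sublist _
        · exact (h.1 e h1).cons x
        · exact (h.1 c h1).cons_cons x
      · obtain ⟨e', he', hg, hs⟩ : ∃ e', (e' ∈ L ∨ ∃ e ∈ L, x :: e = e') ∧
            itemsGain S ≤ itemsGain e' ∧ itemsSize e' ≤ itemsSize S + P.length * U := by
          rcases List.sublist_cons_iff.mp hS with hS | ⟨r, rfl, hr⟩
          · obtain ⟨e, he, h1, h2⟩ := h.2 S hS hSB
            exact ⟨e, Or.inl he, h1, h2⟩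
          · have hsz : itemsSize (x :: r) = x.2.1 + itemsSize r := by simp [itemsSize]
            obtain ⟨e, he, h1, h2⟩ := h.2 r hr (by linarith)
            refine ⟨x :: e, Or.inr ⟨e, he, rfl⟩, ?_, ?_⟩
            · simp only [itemsGain, List.map_cons, List.sum_cons] at h1 ⊢
              linarith
            · simp only [itemsSize, List.map_cons, List.sum_cons] at h2 ⊢
              linarith
        -- The candidate is entered in the smallest cell that admits it. Any list kept there has at
        -- least its gain, and exceeds its size by at most one unit.
        have hex : ∃ k : ℕ, itemsSize e' ≤ k * U := ⟨B + P.length, by push_cast; linarith⟩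
        classical
        have hk := Nat.find_spec hex
        have hkle : Nat.find hex ≤ B + P.length := Nat.find_min' hex (by push_cast; linarith)
        have hkU : (Nat.find hex : ℝ) * U ≤ itemsSize S + (x :: P).length * U := by
          rcases Nat.eq_zero_or_pos (Nat.find hex) with h0 | hpos
          · rw [h0]
            have : 0 ≤ itemsSize S := by
              apply List.sum_nonneg
              intro y hy
              obtain ⟨z, hz, rfl⟩ := List.mem_map.mp hy
              rcases List.mem_cons.mp (hS.subset hz) with rfl | hz
              · exact hx
              · exact hP z hz
            push_cast
            have : 0 ≤ ((x :: P).length : ℝ) * U := by positivity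
            linarith
          · have := Nat.find_min hex (Nat.sub_lt hpos one_pos)
            rw [not_le, Nat.cast_pred hpos] at this
            push_cast [List.length_cons] at this ⊢
            linarith
        refine ⟨_, List.mem_map.mpr ⟨Nat.find hex, List.mem_range.mpr ?_, rfl⟩, ?_, ?_⟩
        · simp only [List.length_cons] at hq; omega
        · exact hg.trans ((val_packE M u γ L x _ _ rfl).2 e' he' hk)
        · rcases (val_packE M u γ L x (Nat.find hex) _ rfl).1 with h1 | ⟨_, h1⟩
          · rw [h1]
            refine le_trans ?_ hkU
            simp only [itemsSize, List.map_nil, List.sum_nil]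
            positivity
          · exact h1.trans hkU
  have h := key (items.val M γ) [] [[]] h0 (by simp) (by simpa using hB)
    ⟨by simp, fun S hS _ => ⟨[], by simp, by simp [List.sublist_nil.mp hS],
      by simp [List.sublist_nil.mp hS]⟩⟩
  have hv : (knapE q u items).val M γ = (items.val M γ).foldl F [[]] := by
    simp only [knapE, val_fold, val_mapE, val_rangeE, wk, val_comp, val_fst, val_consE, val_nil, hF]
  rw [hv]
  simpa using h

end Prog

end DataExchange

namespace DataExchange
open Sized (Within)

section

variable {n : ℕ} {M : Market n}

/-- The table of the dual variables. -/
def tabOf (Y : Fin n → ℝ) : List (ℕ × ℝ) := (List.finRange n).map fun j : Fin n => ((j : ℕ), Y j)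

theorem sum_map_tabOf (Y : Fin n → ℝ) (g : ℕ × ℝ → ℝ) :
    ((tabOf Y).map g).sum = ∑ j : Fin n, g ((j : ℕ), Y j) := by
  rw [tabOf, List.map_map, Fin.sum_univ_def]
  rfl

theorem sum_toBundle (i : Fin n) (l : List ℕ) (c : Fin n → ℝ) :
    ∑ j : Fin n, M.askShare (i : ℕ) (j : ℕ) l * c j = score M c i (toBundle i l) := by
  simp only [askShare_coe, ite_mul, zero_mul, score]
  rw [← Finset.sum_filter]
  congr 1
  ext; simp

theorem val_priceE {Γ : Type} (γ : Γ) (l : Prog Γ (List ℕ)) (e : Prog Γ (ℕ × ℝ))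
    (tab : Prog Γ (List (ℕ × ℝ))) (R : Prog Γ ℝ) {Y : Fin n → ℝ} {i : Fin n}
    (ht : tab.val M γ = tabOf Y) (he : e.val M γ = ((i : ℕ), Y i)) :
    (Prog.priceE l e tab R).val M γ =
      score M (fun j => R.val M γ + Y j - Y i) i (toBundle i (l.val M γ)) := by
  simp only [Prog.priceE, Prog.val_sumE, ht, Prog.val_mulE, Prog.val_shareE, Prog.val_comp,
    Prog.wk, Prog.val_fst, Prog.val_snd, Prog.val_subE, Prog.val_addE, he]
  rw [sum_map_tabOf, ← sum_toBundle]

/-- The share of `j` when `i` receives everything. -/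
def fullShare (M : Market n) (i j : Fin n) : ℝ :=
  if j ≠ i then M.h i j (Finset.univ.erase i) else 0

theorem askShare_range (i j : Fin n) :
    M.askShare (i : ℕ) (j : ℕ) ((List.finRange n).map Fin.val) = fullShare M i j := by
  have h : toBundle i ((List.finRange n).map Fin.val) = Finset.univ.erase i := by
    ext k
    simp [toBundle]
  rw [askShare_coe, h, fullShare]
  simp

theorem sum_fullShare {i : Fin n} {S : Finset (Fin n)} (hi : i ∉ S) (c : Fin n → ℝ) :
    ∑ j ∈ S, fullShare M i j * c j = ∑ j ∈ S, M.h i j (Finset.univ.erase i) * c j := by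
  refine Finset.sum_congr rfl fun j hj => ?_
  rw [fullShare, if_pos]
  rintro rfl
  exact hi hj

/-- The items for the agent `i` under the prices `c`. -/
def itemOf (M : Market n) (c : Fin n → ℝ) (i j : Fin n) : ℕ × ℝ × ℝ :=
  (j, fullShare M i j, fullShare M i j * c j)

theorem val_itemsE (p : Params) (Y : Fin n → ℝ) (i : Fin n) :
    Prog.itemsE.val M ((p, tabOf Y), ((i : ℕ), Y i)) =
      (List.finRange n).map (itemOf M (fun j => p.2.2.1 + Y j - Y i) i) := by
  have h : (tabOf Y).map (fun b => b.1) = (List.finRange n).map Fin.val := by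
    simp [tabOf, Function.comp_def]
  simp only [Prog.itemsE, Prog.val_bind, Prog.val_mapE, Prog.val_comp, Prog.val_fst, Prog.val_snd,
    Prog.val_shareE, Prog.val_pair, Prog.val_mulE, Prog.val_subE, Prog.val_addE]
  rw [h, tabOf, List.map_map]
  refine List.map_congr_left fun j _ => ?_
  simp only [Function.comp_apply, askShare_range, itemOf]

/-- The set of agents that a list of items denotes. -/
theorem exists_bundle_of_sublist {c : Fin n → ℝ} {i : Fin n} {e : List (ℕ × ℝ × ℝ)}
    (he : e.Sublist ((List.finRange n).map (itemOf M c i)).reverse) :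
    itemsSize e = ∑ j ∈ toBundle i (e.map Prod.fst), M.h i j (Finset.univ.erase i) ∧
      itemsGain e = ∑ j ∈ toBundle i (e.map Prod.fst), M.h i j (Finset.univ.erase i) * c j := by
  rw [← List.map_reverse, List.sublist_map_iff] at he
  obtain ⟨l, hl, rfl⟩ := he
  have hn : l.Nodup := hl.nodup (List.nodup_reverse.mpr (List.nodup_finRange n))
  have hb : toBundle i ((l.map (itemOf M c i)).map Prod.fst) = l.toFinset.erase i := by
    ext k
    simp only [toBundle, List.map_map, List.mem_map, Function.comp_apply, itemOf,
      Finset.mem_filter, Finset.mem_univ, true_and, Finset.mem_erase, List.mem_toFinset,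
      Fin.val_inj, exists_eq_right]
  have hs : ∀ c' : Fin n → ℝ, (l.map fun j => fullShare M i j * c' j).sum =
      ∑ j ∈ l.toFinset.erase i, M.h i j (Finset.univ.erase i) * c' j := by
    intro c'
    rw [← sum_fullShare (by simp), Finset.sum_erase, List.sum_toFinset _ hn]
    simp [fullShare]
  rw [hb]
  constructor
  · have := hs fun _ => 1
    simp only [mul_one] at this
    simpa [itemsSize, Function.comp_def, itemOf] using this
  · simpa [itemsGain, Function.comp_def, itemOf] using hs c

theorem exists_items {c : Fin n → ℝ} {i : Fin n} {S : Finset (Fin n)} (hi : i ∉ S) :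
    ∃ l : List (ℕ × ℝ × ℝ), l.Sublist ((List.finRange n).map (itemOf M c i)).reverse ∧
      itemsSize l = ∑ j ∈ S, M.h i j (Finset.univ.erase i) ∧
      itemsGain l = ∑ j ∈ S, M.h i j (Finset.univ.erase i) * c j := by
  refine ⟨(((List.finRange n).filter (· ∈ S)).map (itemOf M c i)).reverse,
    ((List.filter_sublist).map _).reverse, ?_⟩
  have hs : ∀ c' : Fin n → ℝ, (((List.finRange n).filter (· ∈ S)).map
      fun j => fullShare M i j * c' j).sum = ∑ j ∈ S, M.h i j (Finset.univ.erase i) * c' j := by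
    intro c'
    rw [← sum_fullShare hi, ← List.sum_toFinset _ ((List.nodup_finRange n).filter _)]
    congr 1
    ext; simp
  constructor
  · have := hs fun _ => 1
    simp only [mul_one] at this
    simpa [itemsSize, Function.comp_def, itemOf, List.sum_reverse] using this
  · simpa [itemsGain, Function.comp_def, itemOf, List.sum_reverse] using hs c

/-- The set that an agent receives in a round. -/
noncomputable def pick (M : Market n) (p : Params) (Y : Fin n → ℝ) (i : Fin n) : List ℕ :=
  Prog.bestE.val M ((p, tabOf Y), ((i : ℕ), Y i))

theorem score_le_pick (p : Params) (Y : Fin n → ℝ) (i : Fin n) {l : List ℕ}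
    (hl : l = [] ∨ l ∈ Prog.levelsE.val M ((p, tabOf Y), ((i : ℕ), Y i)) ∨
      l ∈ Prog.packedE.val M ((p, tabOf Y), ((i : ℕ), Y i))) :
    score M (fun j => p.2.2.1 + Y j - Y i) i (toBundle i l) ≤
      score M (fun j => p.2.2.1 + Y j - Y i) i (toBundle i (pick M p Y i)) := by
  have h := (Prog.val_argmaxE M ((p, tabOf Y), ((i : ℕ), Y i))
    (Prog.appendE Prog.levelsE Prog.packedE) Prog.nil
    (Prog.priceE Prog.snd (Prog.snd.comp Prog.fst) (Prog.snd.comp (Prog.fst.comp Prog.fst))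
      (Prog.fst.comp (Prog.snd.comp (Prog.snd.comp (Prog.fst.comp (Prog.fst.comp Prog.fst))))))).2 l
    (by simpa using hl)
  rw [val_priceE _ _ _ _ _ (Y := Y) (i := i) rfl rfl,
    val_priceE _ _ _ _ _ (Y := Y) (i := i) rfl rfl] at h
  exact h

theorem score_pick_nonneg (p : Params) (Y : Fin n → ℝ) (i : Fin n) :
    0 ≤ score M (fun j => p.2.2.1 + Y j - Y i) i (toBundle i (pick M p Y i)) := by
  have h := score_le_pick (M := M) p Y i (Or.inl rfl)
  have e : toBundle i [] = ∅ := by simp [toBundle]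
  rw [e] at h
  simpa [score] using h

theorem score_level_le_pick (p : Params) (Y : Fin n → ℝ) (i m : Fin n) :
    score M (fun j => p.2.2.1 + Y j - Y i) i
        (Finset.univ.filter fun j => j ≠ i ∧ Y m ≤ Y j) ≤
      score M (fun j => p.2.2.1 + Y j - Y i) i (toBundle i (pick M p Y i)) := by
  set l : List ℕ := ((tabOf Y).filter fun b => decide (Y m ≤ b.2)).map fun b => b.1 with hl
  have h := score_le_pick (M := M) p Y i (l := l) (Or.inr (Or.inl ?_))
  · convert h using 2
    ext j
    simp [toBundle, hl, tabOf, Fin.val_inj]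
  · simp only [Prog.levelsE, Prog.val_mapE, Prog.val_comp, Prog.val_fst, Prog.val_snd,
      Prog.val_filterE, List.mem_map]
    refine ⟨((m : ℕ), Y m), List.mem_map.mpr ⟨m, by simp, rfl⟩, ?_⟩
    rw [hl]
    refine congrArg (List.map fun b : ℕ × ℝ => b.1) (List.filter_congr fun b _ => ?_)
    rw [Bool.eq_iff_iff, Prog.val_leE]
    simp

/-- The algorithm tries every item as the largest one of `S`. For the right guess `m` the unit is `a
m / N ^ 3`, so `S` takes at most `n * N ^ 3` units, and the total rounding error `n * a m / N ^ 3`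
is at most `δ` times the size of `S`. -/
theorem exists_packed_le_pick (p : Params) (Y : Fin n → ℝ) (i : Fin n) (hn : n + 1 ≤ p.1)
    {δ : ℝ} (hδ : n ≤ δ * (p.1 : ℝ) ^ 3)
    (h0 : ∀ j, j ≠ i → 0 ≤ M.h i j (Finset.univ.erase i)) {S : Finset (Fin n)} (hi : i ∉ S) :
    ∃ S', i ∉ S' ∧ score M (fun j => p.2.2.1 + Y j - Y i) i S' ≤
        score M (fun j => p.2.2.1 + Y j - Y i) i (toBundle i (pick M p Y i)) ∧
      ∑ j ∈ S, M.h i j (Finset.univ.erase i) * (p.2.2.1 + Y j - Y i) ≤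
        ∑ j ∈ S', M.h i j (Finset.univ.erase i) * (p.2.2.1 + Y j - Y i) ∧
      ∑ j ∈ S', M.h i j (Finset.univ.erase i) ≤
        (1 + δ) * ∑ j ∈ S, M.h i j (Finset.univ.erase i) := by
  rcases S.eq_empty_or_nonempty with rfl | hne
  · exact ⟨∅, by simp, by simpa [score] using score_pick_nonneg p Y i, le_rfl, by simp⟩
  set c : Fin n → ℝ := fun j => p.2.2.1 + Y j - Y i with hc
  set γ : (Params × List (ℕ × ℝ)) × (ℕ × ℝ) := ((p, tabOf Y), ((i : ℕ), Y i)) with hγ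
  set a : Fin n → ℝ := fun j => M.h i j (Finset.univ.erase i) with ha
  have hji : ∀ j ∈ S, j ≠ i := fun j hj h => hi (h ▸ hj)
  obtain ⟨m, hm, hmax⟩ := Finset.exists_max_image S a hne
  have hN : (0 : ℝ) < (p.1 : ℝ) ^ 3 := by
    have : (0 : ℝ) < p.1 := by exact_mod_cast (by omega : 0 < p.1)
    positivity
  obtain ⟨l, hl, hls, hlg⟩ := exists_items (M := M) (c := c) hi
  have hit := val_itemsE (M := M) p Y i
  have hfull : fullShare M i m = a m := by rw [fullShare, if_pos (hji m hm)]
  have ha0 : 0 ≤ a m := h0 m (hji m hm)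
  set items := (List.finRange n).map (itemOf M c i) with hitems
  set q : Prog ((((Params × List (ℕ × ℝ)) × (ℕ × ℝ)) × List (ℕ × ℝ × ℝ)) × (ℕ × ℝ × ℝ)) ℕ :=
    Prog.powN (Prog.fst.comp (Prog.fst.comp (Prog.fst.comp (Prog.fst.comp Prog.fst)))) 5 with hq
  set u : Prog ((((Params × List (ℕ × ℝ)) × (ℕ × ℝ)) × List (ℕ × ℝ × ℝ)) × (ℕ × ℝ × ℝ)) ℝ :=
    Prog.divE (Prog.fst.comp (Prog.snd.comp Prog.snd))
      (Prog.powE (Prog.castE (Prog.fst.comp (Prog.fst.comp (Prog.fst.comp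
        (Prog.fst.comp Prog.fst))))) 3) with hu
  have hqv : q.val M ((γ, items), itemOf M c i m) = p.1 ^ 5 := by simp [hq, hγ]
  have huv : u.val M ((γ, items), itemOf M c i m) = a m / (p.1 : ℝ) ^ 3 := by
    simp [hu, hγ, itemOf, hfull]
  have hlen : items.length = n := by simp [hitems]
  obtain ⟨k1, k2⟩ := Prog.val_knapE M ((γ, items), itemOf M c i m) q u (Prog.snd.comp Prog.fst)
    (by
      intro x hx
      obtain ⟨j, _, rfl⟩ := List.mem_map.mp hx
      simp only [itemOf, fullShare]
      split
      · rename_i h; exact h0 j h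
      · exact le_rfl)
    (by rw [huv]; exact div_nonneg ha0 hN.le) (n * p.1 ^ 3) (by
      -- The `N ^ 5` cells leave room for the `n * N ^ 3` units of `S` and the `n` units of
      -- rounding.
      simp only [Prog.val_comp, Prog.val_fst, Prog.val_snd, hlen, hqv]
      have h1 : 1 ≤ p.1 ^ 3 := Nat.one_le_pow _ _ (by omega)
      calc n * p.1 ^ 3 + n < (n + 1) * p.1 ^ 3 + (n + 1) * 1 := by rw [add_mul]; omega
        _ ≤ (n + 1) * p.1 ^ 3 + (n + 1) * p.1 ^ 3 := by gcongr
        _ ≤ p.1 * p.1 ^ 3 + p.1 * p.1 ^ 3 := by gcongr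
        _ = 2 * p.1 ^ 4 := by ring
        _ ≤ p.1 * p.1 ^ 4 := Nat.mul_le_mul_right _ (by have := m.pos; omega)
        _ = p.1 ^ 5 := by ring)
  simp only [Prog.val_comp, Prog.val_fst, Prog.val_snd] at k1 k2
  obtain ⟨e, he, hg, hs⟩ := k2 l hl (by
    rw [huv, hls]
    refine (Finset.sum_le_card_nsmul S a (a m) hmax).trans ?_
    rw [nsmul_eq_mul]
    push_cast
    rw [mul_assoc, mul_div_cancel₀ _ hN.ne']
    exact mul_le_mul_of_nonneg_right
      (by exact_mod_cast (Finset.card_le_univ S).trans (by simp)) ha0)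
  obtain ⟨b1, b2⟩ := exists_bundle_of_sublist (k1 e he)
  refine ⟨toBundle i (e.map Prod.fst), not_mem_toBundle i _, ?_, ?_, ?_⟩
  · refine score_le_pick p Y i (Or.inr (Or.inr ?_))
    simp only [Prog.packedE, Prog.val_bind, Prog.val_flatMapE, Prog.val_snd, Prog.val_mapE,
      List.mem_flatMap, List.mem_map]
    rw [hit]
    exact ⟨itemOf M c i m, List.mem_map.mpr ⟨m, by simp, rfl⟩, e, he, by simp⟩
  · rw [← b2, ← hlg]
    exact hg
  · rw [← b1, ← hls]
    refine hs.trans ?_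
    rw [huv, hlen, add_mul, one_mul]
    refine add_le_add le_rfl ?_
    rw [hls, mul_div_assoc', div_le_iff₀ hN]
    have h1 : a m ≤ ∑ j ∈ S, a j :=
      Finset.single_le_sum (fun j hj => h0 j (hji j hj)) hm
    have hδ0 : 0 ≤ δ := by
      exact nonneg_of_mul_nonneg_left ((Nat.cast_nonneg n).trans hδ) hN
    calc (n : ℝ) * a m ≤ δ * (p.1 : ℝ) ^ 3 * a m := mul_le_mul_of_nonneg_right hδ ha0
      _ ≤ δ * (p.1 : ℝ) ^ 3 * ∑ j ∈ S, a j := mul_le_mul_of_nonneg_left h1 (mul_nonneg hδ0 hN.le)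
      _ = _ := by ring

end

end DataExchange

namespace DataExchange
open Sized (Within)

/-! ## The dual algorithm: its run and its output -/

namespace Prog

/-- All rounds of the dual algorithm, for given numbers of agents and of rounds. -/
def loopE : Prog ((ℕ × ℕ) × Params) (List (ℕ × List ℕ × ℝ)) :=
  snd.comp (iter (snd.comp fst) ((mapE (rangeE (fst.comp fst)) (snd.pair realZero)).pair nil)
    (roundE.comp ((snd.comp fst).pair snd)))

end Prog

noncomputable section

variable {n : ℕ} (M : Market n) (p : Params)

/-- The bundles of a round. -/
def roundBundles (Y : Fin n → ℝ) (i : Fin n) : Finset (Fin n) := toBundle i (pick M p Y i)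

/-- The dual variables after a round. -/
def nextDual (Y : Fin n → ℝ) (i : Fin n) : ℝ :=
  Y i - (imbalance M (roundBundles M p Y) i + p.2.1 * sgn (Y i))

/-- The dual variables after `t` rounds. -/
def dual : ℕ → Fin n → ℝ
  | 0 => fun _ => 0
  | t + 1 => nextDual M p (dual t)

/-- The output of `t` rounds. -/
def outputs : ℕ → List (ℕ × List ℕ × ℝ)
  | 0 => []
  | t + 1 => ((List.finRange n).map fun i : Fin n => ((i : ℕ), pick M p (dual M p t) i, p.2.2.2)) ++
      outputs t

end

section

variable {n : ℕ} {M : Market n} {p : Params}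

theorem val_picksE (Y : Fin n → ℝ) : Prog.picksE.val M (p, tabOf Y) =
    (List.finRange n).map fun i : Fin n => ((i : ℕ), pick M p Y i) := by
  simp only [Prog.picksE, Prog.val_mapE, Prog.val_snd, Prog.val_pair, Prog.val_comp, Prog.val_fst]
  rw [tabOf, List.map_map]
  rfl

theorem val_stepE (Y : Fin n → ℝ) (i : Fin n) :
    Prog.stepE.val M (((p, tabOf Y), (List.finRange n).map fun i : Fin n =>
      ((i : ℕ), pick M p Y i)), ((i : ℕ), Y i)) = nextDual M p Y i := by
  simp only [Prog.stepE, Prog.val_subE, Prog.val_comp, Prog.val_snd, Prog.val_addE, Prog.val_sumE,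
    Prog.val_shareE, Prog.val_fst, Prog.val_cond, Prog.val_eqE, Prog.val_utilityE,
    Prog.val_realZero, Prog.val_mulE, Prog.val_sgnE, List.map_map, nextDual]
  congr 2
  have h : ∀ j : Fin n, ((fun b : ℕ × List ℕ => M.askShare b.1 (i : ℕ) b.2 -
      if b.1 = (i : ℕ) then M.askUtility b.1 b.2 else 0) ∘
        fun i : Fin n => ((i : ℕ), pick M p Y i)) j =
      (if i ∈ roundBundles M p Y j then M.h j i (roundBundles M p Y j) else 0) -
        if j = i then M.u j (roundBundles M p Y j) else 0 := by
    intro j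
    simp only [Function.comp_apply, askShare_coe, askUtility_coe, Fin.val_inj, roundBundles]
    rfl
  rw [List.map_congr_left fun j _ => h j, ← Fin.sum_univ_def, Finset.sum_sub_distrib, imbalance,
    Finset.sum_ite_eq' Finset.univ, if_pos (Finset.mem_univ _)]

theorem val_roundE (Y : Fin n → ℝ) (out : List (ℕ × List ℕ × ℝ)) :
    Prog.roundE.val M (p, (tabOf Y, out)) = (tabOf (nextDual M p Y),
      ((List.finRange n).map fun i : Fin n => ((i : ℕ), pick M p Y i, p.2.2.2)) ++ out) := by
  simp only [Prog.roundE, Prog.val_bind, Prog.val_pair, Prog.val_fst, Prog.val_comp, Prog.val_snd,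
    Prog.val_mapE, Prog.val_appendE, val_picksE]
  congr 1
  · rw [tabOf, tabOf, List.map_map]
    refine List.map_congr_left fun i _ => ?_
    simp only [Function.comp_apply]
    rw [← tabOf, val_stepE]
  · rw [List.map_map]
    rfl

theorem iterate_roundE (t : ℕ) :
    (fun a => Prog.roundE.val M (p, a))^[t] (tabOf fun _ : Fin n => 0, []) =
      (tabOf (dual M p t), outputs M p t) := by
  induction t with
  | zero => rfl
  | succ t ih => rw [Function.iterate_succ_apply', ih, val_roundE]; rfl

theorem tabOf_zero : (List.range n).map (fun b => (b, (0 : ℝ))) = tabOf fun _ : Fin n => 0 := by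
  rw [tabOf, ← List.map_coe_finRange_eq_range, List.map_map]
  rfl

theorem val_loopE (T : ℕ) : Prog.loopE.val M ((n, T), p) = outputs M p T := by
  simp only [Prog.loopE, Prog.val_comp, Prog.val_iter, Prog.val_snd, Prog.val_fst, Prog.val_pair,
    Prog.val_mapE, Prog.val_rangeE, Prog.val_realZero, Prog.val_nil, tabOf_zero, iterate_roundE]

theorem dualRun : DualRun M p.2.1 (dual M p) fun t => roundBundles M p (dual M p t) where
  not_mem _ i := not_mem_toBundle i _
  zero _ := rfl
  succ _ _ := rfl

theorem sum_outputs (g : ℕ × List ℕ × ℝ → ℝ) (T : ℕ) : ((outputs M p T).map g).sum =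
    ∑ t ∈ Finset.range T, ∑ i : Fin n, g ((i : ℕ), pick M p (dual M p t) i, p.2.2.2) := by
  induction T with
  | zero => rfl
  | succ T ih =>
    rw [outputs, List.map_append, List.sum_append, ih, Finset.sum_range_succ, add_comm,
      List.map_map, Fin.sum_univ_def]
    rfl

theorem mem_outputs {T : ℕ} {e : ℕ × List ℕ × ℝ} (he : e ∈ outputs M p T) :
    ∃ t < T, ∃ i : Fin n, e = ((i : ℕ), pick M p (dual M p t) i, p.2.2.2) := by
  induction T with
  | zero => simp [outputs] at he
  | succ T ih =>
    rcases List.mem_append.mp he with he | he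
    · obtain ⟨i, _, rfl⟩ := List.mem_map.mp he
      exact ⟨T, by omega, i, rfl⟩
    · obtain ⟨t, ht, h⟩ := ih he
      exact ⟨t, by omega, h⟩

theorem length_outputs (T : ℕ) : (outputs M p T).length = T * n := by
  induction T with
  | zero => simp [outputs]
  | succ T ih => simp [outputs, ih]; ring

theorem fst_lt_of_mem_outputs {T : ℕ} {e : ℕ × List ℕ × ℝ} (he : e ∈ outputs M p T) : e.1 < n := by
  obtain ⟨t, _, i, rfl⟩ := mem_outputs he
  exact i.2

theorem welfare_outputs (T : ℕ) : welfare M (decode (outputs M p T)) =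
    p.2.2.2 * ∑ t ∈ Finset.range T, ∑ i, M.u i (roundBundles M p (dual M p t) i) := by
  rw [welfare_decode _ fun e he => fst_lt_of_mem_outputs he, sum_outputs, Finset.mul_sum]
  refine Finset.sum_congr rfl fun t _ => ?_
  rw [Finset.mul_sum]
  exact Finset.sum_congr rfl fun i _ => by rw [askUtility_coe, mul_comm]; rfl

theorem balance_outputs (hV : M.Valid) (T : ℕ) (i : Fin n) :
    contributed M (decode (outputs M p T)) i - received M (decode (outputs M p T)) i =
      p.2.2.2 * ∑ t ∈ Finset.range T, imbalance M (roundBundles M p (dual M p t)) i := by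
  rw [contributed_decode _ fun e he => fst_lt_of_mem_outputs he, hV.received_decode, sum_outputs,
    sum_outputs, ← Finset.sum_sub_distrib, Finset.mul_sum]
  refine Finset.sum_congr rfl fun t _ => ?_
  simp only [Fin.val_inj, ite_mul, zero_mul]
  rw [Finset.sum_ite_eq' Finset.univ, if_pos (Finset.mem_univ _), imbalance, mul_sub,
    Finset.mul_sum]
  congr 1
  · exact Finset.sum_congr rfl fun j _ => by rw [askShare_coe, mul_comm]; rfl
  · rw [askUtility_coe, mul_comm]; rfl

theorem sum_decode_outputs (T : ℕ) (i : Fin n) :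
    ∑ S ∈ bundles i, decode (outputs M p T) i S = T * p.2.2.2 := by
  have h := sum_decode (outputs M p T) i fun _ => 1
  simp only [one_mul] at h
  rw [h, sum_outputs]
  simp only [Fin.val_inj]
  simp

/-! ## The dual algorithm: quality of the output -/

/-- The parameters for accuracy `N`. -/
noncomputable def params (ε : ℝ) (N : ℕ) : Params :=
  (N, ε - ε * ε / 8, (N : ℝ) ^ 6, 1 / ((N ^ 14 : ℕ) : ℝ))

/-- Non-negativity of the final potential bounds `G` by the average welfare plus `n * (n + 1) ^ 2 /
(2 * N ^ 6)`. The weight `N ^ 6` makes this error at most `1 / (2 * N ^ 3)`. -/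
theorem average_welfare_ge {ε : ℝ} (h0 : 0 < ε) (h1 : ε < 1) {N : ℕ} (hN : 8 ≤ N) (hn : n + 1 ≤ N)
    (hV : M.Valid) (hc : M.CrossMonotonic) {G : ℝ}
    (hG : ∀ Y : Fin n → ℝ, (N : ℝ) ^ 6 * G - (ε - ε * ε / 8) * ∑ i, |Y i| ≤
      ∑ i, score M (fun j => (N : ℝ) ^ 6 + Y j - Y i) i (roundBundles M (params ε N) Y i)) :
    G ≤ welfare M (decode (outputs M (params ε N) (N ^ 14))) + 1 / (2 * (N : ℝ) ^ 3) := by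
  have hNr : (8 : ℝ) ≤ N := by exact_mod_cast hN
  have hnr : (n : ℝ) + 1 ≤ N := by exact_mod_cast hn
  have h := (dualRun (M := M) (p := params ε N)).sum_sq_le hV hc (by simp only [params]; nlinarith)
    (by simp only [params]; nlinarith) (L := (N : ℝ) ^ 6) (G := (N : ℝ) ^ 6 * G)
    (fun t => hG _) (N ^ 14)
  have hs : 0 ≤ ∑ i, dual M (params ε N) (N ^ 14) i ^ 2 :=
    Finset.sum_nonneg fun i _ => sq_nonneg _
  have hw := welfare_outputs (M := M) (p := params ε N) (N ^ 14)
  set W := welfare M (decode (outputs M (params ε N) (N ^ 14)))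
  set Wsum := ∑ t ∈ Finset.range (N ^ 14),
    ∑ i, M.u i (roundBundles M (params ε N) (dual M (params ε N) t) i)
  have hT : (0 : ℝ) < ((N ^ 14 : ℕ) : ℝ) := by positivity
  simp only [params] at hw
  rw [one_div, eq_inv_mul_iff_mul_eq₀ hT.ne'] at hw
  rw [← hw] at h
  have hnn : (n : ℝ) * (n + 1) ^ 2 ≤ (N : ℝ) ^ 3 := by
    calc (n : ℝ) * (n + 1) ^ 2 ≤ N * (N : ℝ) ^ 2 := by gcongr; linarith
      _ = _ := by ring
  have h2 : 2 * (N : ℝ) ^ 6 * G ≤ 2 * (N : ℝ) ^ 6 * W + (N : ℝ) ^ 3 := by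
    refine le_of_mul_le_mul_left ?_ hT
    have := mul_le_mul_of_nonneg_left hnn hT.le
    linarith
  have h3 : 0 < 2 * (N : ℝ) ^ 6 := by positivity
  refine le_of_mul_le_mul_left (h2.trans (le_of_eq ?_)) h3
  field_simp

/-- The average imbalance is at most `|Y| / T + θ`, where `T = N ^ 14`. Scores of the chosen sets
are non-negative, so the potential bound applies with `G = 0` and gives `|Y| ≤ T * ε ^ 2 / 8`. The
drift `θ = ε - ε ^ 2 / 8` leaves exactly this room. -/
theorem balancedUpTo_outputs {ε : ℝ} (h0 : 0 < ε) (h1 : ε < 1) {N : ℕ} (hN : 8 ≤ N)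
    (hn : n + 1 ≤ N) (hNε : 1 ≤ N * ε) (hV : M.Valid) (hc : M.CrossMonotonic) :
    BalancedUpTo M ε (decode (outputs M (params ε N) (N ^ 14))) := by
  have hNr : (8 : ℝ) ≤ N := by exact_mod_cast hN
  have hnr : (n : ℝ) + 1 ≤ N := by exact_mod_cast hn
  have hT : (0 : ℝ) < ((N ^ 14 : ℕ) : ℝ) := by positivity
  have hθ0 : 0 ≤ ε - ε * ε / 8 := by nlinarith
  have hθ1 : ε - ε * ε / 8 ≤ 1 := by nlinarith
  have hR := dualRun (M := M) (p := params ε N)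
  refine ⟨fun i S _ => decode_nonneg ?_ i S, fun i => ?_, fun i => ?_⟩
  · intro e he
    obtain ⟨t, _, i, rfl⟩ := mem_outputs he
    exact one_div_nonneg.mpr hT.le
  · rw [sum_decode_outputs]
    simp only [params]
    rw [mul_one_div_cancel hT.ne']
  · rw [abs_sub_comm, balance_outputs hV, abs_mul]
    have hs := hR.sum_sq_le hV hc hθ0 hθ1 (L := (N : ℝ) ^ 6) (G := 0) (fun t => by
      have h2 : 0 ≤ ∑ i, |dual M (params ε N) t i| := Finset.sum_nonneg fun i _ => abs_nonneg _
      have h3 : 0 ≤ ∑ i, score M (fun j => (N : ℝ) ^ 6 + dual M (params ε N) t j -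
          dual M (params ε N) t i) i (roundBundles M (params ε N) (dual M (params ε N) t) i) :=
        Finset.sum_nonneg fun i _ => score_pick_nonneg (params ε N) _ i
      have h4 := mul_nonneg hθ0 h2
      simp only [params] at h3 h4 ⊢
      linarith) (N ^ 14)
    have hi := Finset.single_le_sum (f := fun i => dual M (params ε N) (N ^ 14) i ^ 2)
      (fun j _ => sq_nonneg _) (Finset.mem_univ i)
    have hu : ∑ t ∈ Finset.range (N ^ 14), ∑ i,
        M.u i (roundBundles M (params ε N) (dual M (params ε N) t) i) ≤ ((N ^ 14 : ℕ) : ℝ) * n := by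
      refine (Finset.sum_le_card_nsmul _ _ (n : ℝ) fun t _ => ?_).trans (by simp)
      refine (Finset.sum_le_card_nsmul _ _ 1 fun i _ => ?_).trans (by simp)
      exact hV.le_one i _ (not_mem_toBundle i _)
    have hb := hR.abs_sum_imbalance_le hθ0 (N ^ 14) i
    set y := dual M (params ε N) (N ^ 14) i
    set T : ℝ := ((N ^ 14 : ℕ) : ℝ) with hTdef
    have hTN : T = (N : ℝ) ^ 14 := by rw [hTdef]; push_cast; rfl
    clear_value T y
    -- The potential is at most `3 * T * N ^ 7`, while the square of the bound is `T ^ 2 * ε ^ 4 /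
    -- 64`. With `T = N ^ 14`, `N * ε ≥ 1` and `N ≥ 8` the latter is larger.
    have hy : |y| ≤ T * (ε * ε / 8) := by
      refine abs_le_of_sq_le_sq ?_ (by positivity)
      have hN6 : (0 : ℝ) ≤ 2 * (N : ℝ) ^ 6 := by positivity
      have e1 : y ^ 2 ≤ 3 * T * (N : ℝ) ^ 7 := by
        have a1 := mul_le_mul_of_nonneg_left hu hN6
        have a2 : (n : ℝ) * (n + 1) ^ 2 ≤ (N : ℝ) ^ 7 := by
          calc (n : ℝ) * (n + 1) ^ 2 ≤ N * (N : ℝ) ^ 2 := by gcongr; linarith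
            _ = (N : ℝ) ^ 3 := by ring
            _ ≤ (N : ℝ) ^ 7 := pow_le_pow_right₀ (by linarith) (by norm_num)
        have a3 := mul_le_mul_of_nonneg_left a2 hT.le
        have a4 : 2 * (N : ℝ) ^ 6 * (T * n) ≤ 2 * (N : ℝ) ^ 6 * (T * N) := by
          gcongr; linarith
        have a5 : 2 * (N : ℝ) ^ 6 * (T * N) = 2 * T * (N : ℝ) ^ 7 := by ring
        linarith
      have e2 : 1 ≤ (N : ℝ) ^ 4 * (ε * ε * (ε * ε)) := by
        have : 1 ≤ ((N : ℝ) * ε) ^ 4 := one_le_pow₀ hNε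
        linarith [show ((N : ℝ) * ε) ^ 4 = (N : ℝ) ^ 4 * (ε * ε * (ε * ε)) by ring]
      refine e1.trans ?_
      have e3 : (512 : ℝ) ≤ (N : ℝ) ^ 3 := by
        calc (512 : ℝ) = 8 ^ 3 := by norm_num
          _ ≤ _ := by gcongr
      have e4 : (T * (ε * ε / 8)) ^ 2 = T * (N : ℝ) ^ 7 * ((N : ℝ) ^ 3 / 64) *
          ((N : ℝ) ^ 4 * (ε * ε * (ε * ε))) := by rw [hTN]; ring
      rw [e4]
      have e5 : 0 ≤ T * (N : ℝ) ^ 7 := by positivity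
      calc 3 * T * (N : ℝ) ^ 7 = T * (N : ℝ) ^ 7 * 3 * 1 := by ring
        _ ≤ T * (N : ℝ) ^ 7 * ((N : ℝ) ^ 3 / 64) * ((N : ℝ) ^ 4 * (ε * ε * (ε * ε))) := by
          refine mul_le_mul (mul_le_mul_of_nonneg_left ?_ e5) e2 zero_le_one (by positivity)
          linarith
    have hp : (params ε N).2.2.2 = 1 / T := by rw [hTdef, params]
    have hq : (params ε N).2.1 = ε - ε * ε / 8 := rfl
    rw [hq] at hb
    rw [hp, abs_of_pos (one_div_pos.mpr hT), one_div, inv_mul_le_iff₀ hT]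
    refine hb.trans ?_
    linarith

theorem welfare_le_of_crossMonotonic {ε : ℝ} (h0 : 0 < ε) (h1 : ε < 1) {N : ℕ} (hN : 8 ≤ N)
    (hn : n + 1 ≤ N) (hNε : 1 ≤ N * ε) (hV : M.Valid) (hc : M.CrossMonotonic)
    {y : Fin n → Finset (Fin n) → ℝ} (hy : BalancedUpTo M ε y) :
    welfare M y ≤ 48 * Real.log n * welfare M (decode (outputs M (params ε N) (N ^ 14))) := by
  have hNr : (8 : ℝ) ≤ N := by exact_mod_cast hN
  have h2n := hV.two_le
  set K := Nat.log 2 n + 3 with hK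
  set W := welfare M (decode (outputs M (params ε N) (N ^ 14))) with hW
  have hK1 : (1 : ℝ) ≤ K := by exact_mod_cast (by omega : 1 ≤ K)
  have hpow : n + 1 < 2 ^ (K - 1) := by
    have := Nat.lt_pow_succ_log_self one_lt_two n
    have e : K - 1 = Nat.log 2 n + 1 + 1 := by omega
    rw [e, pow_succ]
    omega
  have hR : (0 : ℝ) < (N : ℝ) ^ 6 := by positivity
  -- Half of the weight of the welfare is lost to the term `L / 2 * u` of `level_bound`, and `2 * K`
  -- is the factor of the level sets; together they give `4 * K`.
  have key : ∀ y, BalancedUpTo M ε y → welfare M y / (4 * K) ≤ W + 1 / (2 * (N : ℝ) ^ 3) := by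
    intro y hy
    refine average_welfare_ge h0 h1 hN hn hV hc fun Y => ?_
    obtain ⟨z, hz1, hz2, hz3⟩ := exists_compression Y hR
    have g1 := hy.le_lagrangian hV ((N : ℝ) ^ 6) hz2
    have g2 := hy.sum_le (F := fun i S => score M (fun j => (N : ℝ) ^ 6 + z j - z i) i S)
      (a := (N : ℝ) ^ 6 / 2) (b := fun i => 2 * K *
        score M (fun j => (N : ℝ) ^ 6 + Y j - Y i) i (roundBundles M (params ε N) Y i))
      (fun i => mul_nonneg (by positivity) (score_pick_nonneg (params ε N) Y i))
      (fun i S hi => level_bound hV hc hR hz1 hz3 K hpow i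
        (score_pick_nonneg (params ε N) Y i) (fun m => score_level_le_pick (params ε N) Y i m) hi)
    rw [← Finset.mul_sum] at g2
    set B := ∑ i, score M (fun j => (N : ℝ) ^ 6 + Y j - Y i) i (roundBundles M (params ε N) Y i)
    have hA : 0 ≤ ∑ i, |Y i| := Finset.sum_nonneg fun i _ => abs_nonneg _
    set A := ∑ i, |Y i|
    have g3 : (N : ℝ) ^ 6 / 2 * welfare M y - ε * A ≤ 2 * K * B := by linarith
    have g4 : (N : ℝ) ^ 6 * (welfare M y / (4 * K)) - ε * A / (2 * K) ≤ B := by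
      have e : (N : ℝ) ^ 6 * (welfare M y / (4 * K)) - ε * A / (2 * K) =
          ((N : ℝ) ^ 6 / 2 * welfare M y - ε * A) / (2 * K) := by
        field_simp
        ring
      rw [e, div_le_iff₀ (by positivity)]
      linarith
    -- Division by `2 * K` shrinks the loss from `ε`-balance well below the drift `θ`, which is at
    -- least `ε / 2`.
    have g5 : ε * A / (2 * K) ≤ (ε - ε * ε / 8) * A := by
      rw [div_le_iff₀ (by positivity)]
      have : ε ≤ (ε - ε * ε / 8) * (2 * K) := by
        have : ε / 2 ≤ ε - ε * ε / 8 := by nlinarith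
        nlinarith
      nlinarith
    linarith
  have hKN : 4 * (K : ℝ) ≤ (N : ℝ) ^ 2 := by
    have a1 : K ≤ N + 2 := by have := Nat.log_le_self 2 n; omega
    have a2 : (K : ℝ) ≤ N + 2 := by exact_mod_cast a1
    nlinarith
  have hr : 1 / (2 * (N : ℝ) ^ 3) ≤ ε / (8 * K) := by
    rw [div_le_div_iff₀ (by positivity) (by positivity)]
    have a1 : (N : ℝ) ^ 2 * 1 ≤ (N : ℝ) ^ 2 * (N * ε) := by gcongr
    nlinarith
  -- Comparison with a solution of welfare `ε` shows that the additive error is at most `W`, so it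
  -- costs only another factor of `2`.
  obtain ⟨x, hx, hxw⟩ := hV.exists_welfare_eq hc h0 h1
  have k1 := key x hx
  have k2 := key y hy
  rw [hxw] at k1
  have e1 : ε / (4 * K) = ε / (8 * K) + ε / (8 * K) := by field_simp; norm_num
  have k3 : 1 / (2 * (N : ℝ) ^ 3) ≤ W := by linarith
  have hW0 : 0 ≤ W := le_trans (by positivity) k3
  rw [div_le_iff₀ (by positivity)] at k2
  have k4 : welfare M y ≤ 8 * K * W := by
    refine k2.trans ?_
    have : (W + 1 / (2 * (N : ℝ) ^ 3)) * (4 * K) ≤ (W + W) * (4 * K) := by gcongr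
    linarith
  refine k4.trans (mul_le_mul_of_nonneg_right ?_ hW0)
  -- Here `8 * K = 8 * (log₂ n + 3) ≤ 32 * log₂ n`, with the integer part of the logarithm, and `32
  -- / log 2 < 48`.
  have hlog1 : 1 ≤ Nat.log 2 n := Nat.log_pos one_lt_two h2n
  have hlog : (Nat.log 2 n : ℝ) * Real.log 2 ≤ Real.log n := by
    rw [← Real.log_pow]
    refine Real.log_le_log (by positivity) ?_
    exact_mod_cast Nat.pow_log_le_self 2 (by omega)
  have hlog1' : (1 : ℝ) ≤ Nat.log 2 n := by exact_mod_cast hlog1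
  have := Real.log_two_gt_d9
  have e2 : (K : ℝ) = Nat.log 2 n + 3 := by rw [hK]; push_cast; ring
  rw [e2]
  nlinarith

theorem welfare_le_of_symmetric {ε : ℝ} (h0 : 0 < ε) (h1 : ε < 1) {N : ℕ} (hN : 8 ≤ N)
    (hn : n + 1 ≤ N) (hNε : 1 ≤ N * ε) (hM : SymmetricMarket n M)
    {y : Fin n → Finset (Fin n) → ℝ} (hy : BalancedUpTo M ε y) :
    welfare M y ≤ (1 + ε) * welfare M (decode (outputs M (params ε N) (N ^ 14))) := by
  have hV := hM.1
  have hc := hM.crossMonotonic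
  have hNr : (8 : ℝ) ≤ N := by exact_mod_cast hN
  have hnr : (n : ℝ) + 1 ≤ N := by exact_mod_cast hn
  set W := welfare M (decode (outputs M (params ε N) (N ^ 14))) with hW
  have hN3 : (n : ℝ) ≤ ε / 4 * (N : ℝ) ^ 3 := by
    have a1 : (N : ℝ) ^ 2 * 1 ≤ (N : ℝ) ^ 2 * (N * ε) := by gcongr
    nlinarith
  have key : ∀ y, BalancedUpTo M ε y →
      welfare M y / (1 + ε / 4) ≤ W + 1 / (2 * (N : ℝ) ^ 3) := by
    intro y hy
    refine average_welfare_ge h0 h1 hN hn hV hc fun Y => ?_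
    -- No compression is needed here: the knapsack oracle is good for all prices.
    have g1 := hy.le_lagrangian hV ((N : ℝ) ^ 6) (z := Y) fun i => le_rfl
    have g2 := hy.sum_le (F := fun i S => score M (fun j => (N : ℝ) ^ 6 + Y j - Y i) i S)
      (a := 0) (b := fun i => (1 + ε / 4) *
        score M (fun j => (N : ℝ) ^ 6 + Y j - Y i) i (roundBundles M (params ε N) Y i))
      (fun i => mul_nonneg (by positivity) (score_pick_nonneg (params ε N) Y i))
      (fun i S hi => by
        have hp := mul_nonneg (show 0 ≤ 1 + ε / 4 by positivity)
          (score_pick_nonneg (M := M) (params ε N) Y i)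
        rw [zero_mul, zero_add]
        rcases le_or_gt (score M (fun j => (N : ℝ) ^ 6 + Y j - Y i) i S) 0 with hs | hs
        · exact hs.trans hp
        · obtain ⟨S', hi', s1, s2, s3⟩ := exists_packed_le_pick (M := M) (params ε N) Y i hn hN3
            (fun j hj => hV.share_nonneg hc (by simp) (by simp [hj])) hi
          exact (hM.score_le (by positivity) hi hi' hs s2 s3).trans
            (mul_le_mul_of_nonneg_left s1 (by positivity)))
    rw [← Finset.mul_sum, zero_mul, zero_add] at g2
    set B := ∑ i, score M (fun j => (N : ℝ) ^ 6 + Y j - Y i) i (roundBundles M (params ε N) Y i)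
    have hA : 0 ≤ ∑ i, |Y i| := Finset.sum_nonneg fun i _ => abs_nonneg _
    set A := ∑ i, |Y i|
    have g3 : (N : ℝ) ^ 6 * welfare M y - ε * A ≤ (1 + ε / 4) * B := g1.trans g2
    have hpos : 0 < 1 + ε / 4 := by positivity
    refine le_of_mul_le_mul_left (le_trans ?_ g3) hpos
    -- Although `θ < ε`, the oracle's factor compensates: `(1 + ε / 4) * (ε - ε ^ 2 / 8) = ε + ε ^ 2
    -- * (4 - ε) / 32`.
    have g4 : ε * A ≤ (1 + ε / 4) * (ε - ε * ε / 8) * A := by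
      refine mul_le_mul_of_nonneg_right ?_ hA
      have : 0 ≤ ε * ε * (4 - ε) := mul_nonneg (by positivity) (by linarith)
      nlinarith
    have e : (1 + ε / 4) * ((N : ℝ) ^ 6 * (welfare M y / (1 + ε / 4)) -
        (ε - ε * ε / 8) * A) = (N : ℝ) ^ 6 * welfare M y - (1 + ε / 4) * (ε - ε * ε / 8) * A := by
      field_simp
    rw [e]
    linarith
  have hr : 1 / (2 * (N : ℝ) ^ 3) ≤ ε * ε / 16 := by
    rw [div_le_div_iff₀ (by positivity) (by norm_num)]
    have a1 : 1 ≤ ((N : ℝ) * ε) ^ 2 := one_le_pow₀ hNε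
    have a2 : (8 : ℝ) * 1 ≤ N * ((N : ℝ) * ε) ^ 2 := by gcongr
    have a3 : (N : ℝ) * ((N : ℝ) * ε) ^ 2 = ε * ε * (N : ℝ) ^ 3 := by ring
    linarith
  obtain ⟨x, hx, hxw⟩ := hV.exists_welfare_eq hc h0 h1
  have k1 := key x hx
  have k2 := key y hy
  rw [hxw] at k1
  have hpos : 0 < 1 + ε / 4 := by positivity
  rw [div_le_iff₀ hpos] at k1 k2
  have hεε : ε * ε ≤ ε := by nlinarith
  -- The comparison with welfare `ε` makes `W` of order `ε`, so the additive error, at most `ε ^ 2 /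
  -- 16`, is at most `ε / 8` times `W`.
  have hW0 : ε / 2 ≤ W := by
    by_contra hcon
    push Not at hcon
    have : (W + 1 / (2 * (N : ℝ) ^ 3)) * (1 + ε / 4) ≤ (ε / 2 + ε / 16) * (1 + 1 / 4) :=
      mul_le_mul (by linarith) (by linarith) (by positivity) (by positivity)
    linarith
  refine k2.trans ?_
  have h3 : 1 / (2 * (N : ℝ) ^ 3) * (1 + ε / 4) ≤ ε * ε / 16 * (5 / 4) := by
    gcongr
    linarith
  have h4 : ε * (ε / 2) ≤ ε * W := by gcongr
  nlinarith

end

end DataExchange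

/-! ### Running time of the dual algorithm, and the hybrid algorithm -/

namespace DataExchange
open Sized (Within)

/-! ## The dual algorithm: running time -/

section

variable {n : ℕ} {M : Market n} {p : Params} {w : ℝ → ℕ} {H : ℕ → ℝ → Prop}

theorem nextDual_within (hG : Gauge w H) {X : ℕ} (hX : Answers M H X) (hn : n ≤ X)
    (hp : Within H X X p) {Y : Fin n → ℝ} {B : ℕ} (hY : ∀ i, H B (Y i)) (i : Fin n) :
    H (B + (X * (X + 1) + 2 * X + 8)) (nextDual M p Y i) := by
  have h1 : H (X * (X + 1) + 1)
      (∑ j, if i ∈ roundBundles M p Y j then M.h j i (roundBundles M p Y j) else 0) := by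
    rw [Fin.sum_univ_def]
    refine hG.mono (Poly.within_sum hG (B := X) ?_) (by
      simp only [List.length_map, List.length_finRange]
      exact Nat.succ_le_succ (Nat.mul_le_mul_right _ hn))
    intro x hx
    obtain ⟨j, _, rfl⟩ := List.mem_map.mp hx
    have := hX.share (j : ℕ) (i : ℕ) (pick M p Y j)
    rwa [askShare_coe] at this
  have h2 : H X (M.u i (roundBundles M p Y i)) := by
    have := hX.utility (i : ℕ) (pick M p Y i)
    rwa [askUtility_coe] at this
  have h3 : H 3 (sgn (Y i)) := by
    unfold sgn
    split
    · exact hG.mono hG.one (by omega)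
    · rw [← zero_sub]
      exact hG.sub hG.zero hG.one
  have h4 : H X p.2.1 := hp.2.1
  exact hG.mono (hG.sub (hY i) (hG.add (hG.sub h1 h2) (hG.mul h4 h3))) (by omega)

/-- A round adds to each dual variable a number built from fresh answers and `θ` only, whose size
does not depend on the round. Bit lengths therefore grow linearly in the number of rounds. -/
theorem dual_within (hG : Gauge w H) {X : ℕ} (hX : Answers M H X) (hn : n ≤ X)
    (hp : Within H X X p) (t : ℕ) (i : Fin n) :
    H (1 + t * (X * (X + 1) + 2 * X + 8)) (dual M p t i) := by
  induction t generalizing i with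
  | zero => simpa [dual] using hG.zero
  | succ t ih =>
    refine hG.mono (nextDual_within hG hX hn hp ih i) ?_
    rw [add_mul]
    omega

/-- The compositional bound for a round depends on the size of its state, so iterating it would not
give a polynomial. Instead the states of the actual run are bounded directly: the dual variables by
`dual_within`, and the output by the picks of the rounds so far. -/
theorem loop_cost : ∃ d : ℕ, ∀ {n : ℕ} (M : Market n) (w : ℝ → ℕ) (H : ℕ → ℝ → Prop),
    Gauge w H → ∀ X, Answers M H X → n ≤ X → ∀ T ≤ X, ∀ p : Params, Within H X X p →
      Prog.loopE.cost M w ((n, T), p) ≤ (X + 2) ^ d := by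
  obtain ⟨d1, h1⟩ := (inferInstance : Poly Prog.picksE).bound
  obtain ⟨d2, h2⟩ := (inferInstance : Poly (Prog.roundE.comp
    ((Prog.snd.comp Prog.fst).pair Prog.snd :
      Prog (((ℕ × ℕ) × Params) × (List (ℕ × ℝ) × List (ℕ × List ℕ × ℝ))) _))).bound
  obtain ⟨d3, h3⟩ := (inferInstance : Poly ((Prog.mapE (Prog.rangeE (Prog.fst.comp Prog.fst))
    (Prog.snd.pair Prog.realZero)).pair Prog.nil :
      Prog ((ℕ × ℕ) × Params) (List (ℕ × ℝ) × List (ℕ × List ℕ × ℝ)))).bound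
  set Z : ℕ → ℕ := fun X => X + (1 + X * (X * (X + 1) + 2 * X + 8)) with hZ
  set V : ℕ → ℕ := fun X => Z X + X * X + (Z X + 2) ^ d1 with hV
  have hZp : PolyBdd Z := PolyBdd.id.add ((PolyBdd.const 1).add (PolyBdd.id.mul
    (((PolyBdd.id.mul (PolyBdd.id.add (PolyBdd.const 1))).add
      ((PolyBdd.const 2).mul PolyBdd.id)).add (PolyBdd.const 8))))
  have hVp : PolyBdd V := (hZp.add (PolyBdd.id.mul PolyBdd.id)).add (hZp.comp_pow d1)
  obtain ⟨d, hd⟩ := (((PolyBdd.const 3).add (PolyBdd.pow d3)).add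
    (PolyBdd.id.mul ((hVp.comp_pow d2).add (PolyBdd.const 3)))).add (PolyBdd.const 6)
  refine ⟨d, fun {n} M w H hG X hX hn T hT p hp => le_trans ?_ (hd X)⟩
  have hXZ : X ≤ Z X := by simp [hZ]
  have hZV : Z X ≤ V X := by simp [hV, add_assoc]
  have hγ : Within H X X (((n, T), p) : (ℕ × ℕ) × Params) := ⟨⟨hn, hT⟩, hp⟩
  have htab : ∀ t ≤ X, Within H (Z X) (Z X) (tabOf (dual M p t)) := by
    intro t ht
    refine ⟨by simp only [tabOf, List.length_map, List.length_finRange]; omega, fun e he => ?_⟩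
    obtain ⟨i, _, rfl⟩ := List.mem_map.mp he
    refine ⟨?_, hG.mono (dual_within hG hX hn hp t i) ?_⟩
    · change (i : ℕ) ≤ Z X
      omega
    · have := Nat.mul_le_mul_right (X * (X + 1) + 2 * X + 8) ht
      simp only [hZ]
      omega
  have hpick : ∀ t ≤ X, ∀ i : Fin n,
      Within H ((Z X + 2) ^ d1) ((Z X + 2) ^ d1) ((i : ℕ), pick M p (dual M p t) i) := by
    intro t ht i
    have h := (h1 M w H hG (Z X) (hX.mono hG hXZ) (p, tabOf (dual M p t))
      ⟨Sized.mono hG hp hXZ hXZ, htab t ht⟩).2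
    rw [val_picksE] at h
    exact h.2 _ (List.mem_map.mpr ⟨i, by simp, rfl⟩)
  have hout : ∀ t ≤ X, Within H (V X) (V X) (outputs M p t) := by
    intro t ht
    refine ⟨?_, fun e he => ?_⟩
    · rw [length_outputs]
      have := Nat.mul_le_mul ht hn
      simp only [hV]
      omega
    · obtain ⟨s, hs, i, rfl⟩ := mem_outputs he
      have h := hpick s (by omega) i
      refine ⟨Sized.mono hG h.1 (by simp only [hV]; omega) (by simp only [hV]; omega),
        Sized.mono hG h.2 (by simp only [hV]; omega) (by simp only [hV]; omega), ?_⟩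
      exact hG.mono hp.2.2.2 (hXZ.trans hZV)
  have h4 := Prog.iter_cost M w (Prog.snd.comp Prog.fst)
    ((Prog.mapE (Prog.rangeE (Prog.fst.comp Prog.fst)) (Prog.snd.pair Prog.realZero)).pair Prog.nil)
    (Prog.roundE.comp ((Prog.snd.comp Prog.fst).pair Prog.snd)) ((n, T), p) ((V X + 2) ^ d2) (by
      intro t ht
      have e : (fun a => Prog.val M (Prog.roundE.comp ((Prog.snd.comp Prog.fst).pair Prog.snd))
          (((n, T), p), a))^[t] (Prog.val M ((Prog.mapE (Prog.rangeE (Prog.fst.comp Prog.fst))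
            (Prog.snd.pair Prog.realZero)).pair Prog.nil) ((n, T), p)) =
          (tabOf (dual M p t), outputs M p t) := by
        simp only [Prog.val_comp, Prog.val_pair, Prog.val_mapE, Prog.val_rangeE, Prog.val_fst,
          Prog.val_snd, Prog.val_realZero, Prog.val_nil, tabOf_zero, iterate_roundE]
      rw [e]
      have ht' : t ≤ X := ht.le.trans hT
      exact (h2 M w H hG (V X) (hX.mono hG (hXZ.trans hZV)) _
        ⟨Sized.mono hG hγ (hXZ.trans hZV) (hXZ.trans hZV),
          Sized.mono hG (htab t ht') hZV hZV, hout t ht'⟩).1)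
  have h5 := (h3 M w H hG X hX ((n, T), p) hγ).1
  have h6 : (Prog.snd.comp Prog.fst : Prog ((ℕ × ℕ) × Params) ℕ).cost M w ((n, T), p) = 2 := rfl
  have h7 : Prog.val M (Prog.snd.comp Prog.fst : Prog ((ℕ × ℕ) × Params) ℕ) ((n, T), p) = T := rfl
  rw [h6, h7] at h4
  have h8 := Nat.mul_le_mul_right ((V X + 2) ^ d2 + 3) hT
  have h9 : Prog.loopE.cost M w ((n, T), p) = (Prog.iter (Prog.snd.comp Prog.fst)
    ((Prog.mapE (Prog.rangeE (Prog.fst.comp Prog.fst)) (Prog.snd.pair Prog.realZero)).pair Prog.nil)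
    (Prog.roundE.comp ((Prog.snd.comp Prog.fst).pair Prog.snd))).cost M w ((n, T), p) + 1 := rfl
  rw [h9]
  beta_reduce
  omega

end

/-! ## The algorithm -/

namespace Prog

def startE : Prog (ℕ × ℝ) (ℝ × ℕ × ℝ) :=
  bind (succE (succE fst)) ((snd.comp fst).pair (snd.pair (castE snd)))

/-- The arguments of the dual algorithm. -/
def argsE : Prog ((ℕ × ℝ) × (ℕ × ℝ)) ((ℕ × ℕ) × Params) :=
  bind (addN (fst.comp snd) (addN (fst.comp fst) (natLit 8)))
    (((fst.comp (fst.comp fst)).pair (powN snd 14)).pair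
      (snd.pair ((subE (snd.comp (fst.comp fst)) (divE (mulE (snd.comp (fst.comp fst))
          (snd.comp (fst.comp fst))) (castE (natLit 8)))).pair
        ((powE (castE snd) 6).pair (divE realOne (castE (powN snd 14)))))))

/-- The dual algorithm, unless `1 / ε` exceeds a fast growing function of the number of agents; in
that case the linear program is solved exactly. -/
def hybridE (r : ℕ) : Algorithm :=
  bind ((grow r).comp startE)
    (cond (leE realOne (mulE (snd.comp snd) (snd.comp fst))) (loopE.comp argsE) (exactE.comp fst))

end Prog

instance : Poly Prog.startE := by unfold Prog.startE; infer_instance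

set_option synthInstance.maxSize 4096 in
set_option synthInstance.maxHeartbeats 400000 in
instance : Poly Prog.argsE := by unfold Prog.argsE; infer_instance

section

variable {n : ℕ} {M : Market n}

theorem val_argsE (ε : ℝ) (k : ℕ) (x : ℝ) : Prog.argsE.val M ((n, ε), (k, x)) =
    ((n, (k + (n + 8)) ^ 14), params ε (k + (n + 8))) := by
  simp [Prog.argsE, params]

theorem val_startE (ε : ℝ) :
    Prog.startE.val M (n, ε) = (ε, n + 2, ((n + 2 : ℕ) : ℝ)) := by
  simp [Prog.startE]
  ring

/-- The accuracy is `N = k + (n + 8)` for the counter `k` found by `grow`; the summand `n + 8`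
provides the bounds `8 ≤ N` and `n + 1 ≤ N` needed for the dual algorithm. -/
theorem hybridE_solution (r : ℕ) {ε : ℝ} (h0 : 0 < ε) :
    (∃ N : ℕ, 8 ≤ N ∧ n + 1 ≤ N ∧ 1 ≤ N * ε ∧
      (Prog.hybridE r).solution M ε = decode (outputs M (params ε N) (N ^ 14))) ∨
    (Prog.hybridE r).solution M ε = decode (Prog.exactE.val M (n, ε)) := by
  obtain ⟨k, h1, _, _, _⟩ := Prog.grow_spec M h0 r (n + 2)
  have hv : Prog.val M (Prog.hybridE r) (n, ε) = if 1 ≤ (k : ℝ) * ε then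
      outputs M (params ε (k + (n + 8))) ((k + (n + 8)) ^ 14)
      else Prog.exactE.val M (n, ε) := by
    rw [Prog.hybridE, Prog.val_bind, Prog.val_comp, val_startE, h1, Prog.val_cond]
    simp only [Prog.val_leE, Prog.val_realOne, Prog.val_mulE, Prog.val_comp, Prog.val_snd,
      Prog.val_fst, val_argsE, val_loopE]
  unfold Algorithm.solution
  rw [hv]
  split
  · rename_i h
    refine Or.inl ⟨k + (n + 8), by omega, by omega, ?_, rfl⟩
    refine h.trans (mul_le_mul_of_nonneg_right ?_ h0.le)
    exact_mod_cast (by omega : k ≤ k + (n + 8))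
  · exact Or.inr rfl

theorem hybridE_approximates_crossMonotonic (r : ℕ) :
    (Prog.hybridE r).Approximates CrossMonotonicMarket fun n _ => 48 * Real.log n := by
  intro n M ε hM h0 h1
  have hV := hM.1
  have hc := hM.crossMonotonic
  rcases hybridE_solution (M := M) r h0 with ⟨N, a1, a2, a3, a4⟩ | h
  · rw [a4]
    exact ⟨balancedUpTo_outputs h0 h1 a1 a2 a3 hV hc,
      fun y hy => welfare_le_of_crossMonotonic h0 h1 a1 a2 a3 hV hc hy⟩
  · rw [h]
    obtain ⟨b1, b2⟩ := exactE_correct hV h0.le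
    -- An exact optimum needs no factor, but the stated one must be at least `1`. This holds because
    -- validity forces `n ≥ 2`.
    refine ⟨b1, fun y hy => (b2 y hy).trans (le_mul_of_one_le_left ?_ ?_)⟩
    · obtain ⟨x, hx, hxw⟩ := hV.exists_welfare_eq hc h0 h1
      have := b2 x hx
      linarith
    · have h2 : Real.log 2 ≤ Real.log n :=
        Real.log_le_log (by norm_num) (by exact_mod_cast hV.two_le)
      have := Real.log_two_gt_d9
      linarith

theorem hybridE_approximates_symmetric (r : ℕ) :
    (Prog.hybridE r).Approximates SymmetricMarket fun _ ε => 1 + ε := by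
  intro n M ε hM h0 h1
  have hV := hM.1
  have hc := hM.crossMonotonic
  rcases hybridE_solution (M := M) r h0 with ⟨N, a1, a2, a3, a4⟩ | h
  · rw [a4]
    exact ⟨balancedUpTo_outputs h0 h1 a1 a2 a3 hV hc,
      fun y hy => welfare_le_of_symmetric h0 h1 a1 a2 a3 hM hy⟩
  · rw [h]
    obtain ⟨b1, b2⟩ := exactE_correct hV h0.le
    refine ⟨b1, fun y hy => (b2 y hy).trans (le_mul_of_one_le_left ?_ (by linarith))⟩
    obtain ⟨x, hx, hxw⟩ := hV.exists_welfare_eq hc h0 h1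
    have := b2 x hx
    linarith

end

/-- The level `r` is taken from the bound for `exactE`, which makes its cost at most `ack r (n + 2)
* (X + 1)`. The exact solver is called only if `grow` has passed `ack r (n + 2)`, and the counter is
at most `X + 2` since `⌈1 / ε⌉₊ ≤ X`. -/
theorem exists_hybridE_cost : ∃ r d : ℕ, ∀ {n : ℕ} (M : Market n) (w : ℝ → ℕ) (H : ℕ → ℝ → Prop),
    Gauge w H → ∀ X, Answers M H X → n ≤ X → ∀ ε : ℝ, 0 < ε → H X ε → ⌈1 / ε⌉₊ ≤ X →
      (Prog.hybridE r).cost M w (n, ε) ≤ (X + 2) ^ d := by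
  obtain ⟨r, hr⟩ := (inferInstance : Tame Prog.exactE).bound
  obtain ⟨d1, h1⟩ := (inferInstance : Poly Prog.startE).bound
  obtain ⟨d2, h2⟩ := Prog.grow_cost r
  obtain ⟨d3, h3⟩ := (inferInstance : Poly (Prog.leE Prog.realOne (Prog.mulE
    (Prog.snd.comp Prog.snd) (Prog.snd.comp Prog.fst)) : Prog ((ℕ × ℝ) × (ℕ × ℝ)) Bool)).bound
  obtain ⟨d4, h4⟩ := (inferInstance : Poly Prog.argsE).bound
  obtain ⟨d5, h5⟩ := loop_cost
  -- The counter is at most `X + 2`, and as a real number it has size at most `2 * (X + 2) + 1`.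
  have hXp : PolyBdd fun X => 2 * X + 5 := ((PolyBdd.const 2).mul PolyBdd.id).add (PolyBdd.const 5)
  have hQp : PolyBdd fun X => 2 * X + 5 + (2 * X + 5 + 2) ^ d4 := hXp.add (hXp.comp_pow d4)
  have hap := (hXp.comp_pow d4).add (hQp.comp_pow d5)
  have hep := (PolyBdd.id.add (PolyBdd.const 2)).mul (PolyBdd.id.add (PolyBdd.const 1))
  obtain ⟨d, hd⟩ := ((((PolyBdd.pow d1).add (hXp.comp_pow d2)).add (hXp.comp_pow d3)).add
    (hap.add hep)).add (PolyBdd.const 10)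
  refine ⟨r, d, fun {n} M w H hG X hX hn ε h0 hε hc => le_trans ?_ (hd X)⟩
  have hXX : X ≤ 2 * X + 5 := by omega
  obtain ⟨k, g1, g2, g3, g4⟩ := Prog.grow_spec M h0 r (n + 2)
  have hk : k ≤ X + 2 := g3.trans (max_le (by omega) (by omega))
  have c1 := (h1 M w H hG X hX (n, ε) ⟨hn, hε⟩).1
  have c2 := h2 M w H hG (2 * X + 5) (hX.mono hG hXX) ε h0 (hG.mono hε hXX) (by omega) (n + 2)
    (by omega)
  have hctx : Within H (2 * X + 5) (2 * X + 5) (((n, ε), (k, (k : ℝ))) : (ℕ × ℝ) × (ℕ × ℝ)) := by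
    refine ⟨⟨?_, hG.mono hε hXX⟩, ?_, hG.mono (Prog.natCast_within hG k) (by omega)⟩
    · change n ≤ _
      omega
    · change k ≤ _
      omega
  have c3 := (h3 M w H hG (2 * X + 5) (hX.mono hG hXX) _ hctx).1
  have hcost : (Prog.hybridE r).cost M w (n, ε) ≤ Prog.startE.cost M w (n, ε) +
      (Prog.grow r).cost M w (ε, n + 2, ((n + 2 : ℕ) : ℝ)) +
      (Prog.leE Prog.realOne (Prog.mulE (Prog.snd.comp Prog.snd) (Prog.snd.comp Prog.fst))).cost M w
        ((n, ε), (k, (k : ℝ))) +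
      (if 1 ≤ (k : ℝ) * ε then (Prog.loopE.comp Prog.argsE).cost M w ((n, ε), (k, (k : ℝ)))
        else Prog.exactE.cost M w (n, ε) + 1) + 3 := by
    have e1 : ((Prog.grow r).comp Prog.startE).val M (n, ε) = (k, (k : ℝ)) := by
      rw [Prog.val_comp, val_startE, g1]
    have e2 : (Prog.hybridE r).cost M w (n, ε) = (1 + 1 + (Prog.startE.cost M w (n, ε) +
        (Prog.grow r).cost M w (Prog.startE.val M (n, ε)))) +
        (Prog.cond (Prog.leE Prog.realOne (Prog.mulE (Prog.snd.comp Prog.snd)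
          (Prog.snd.comp Prog.fst))) (Prog.loopE.comp Prog.argsE)
            (Prog.exactE.comp Prog.fst)).cost M w
          ((n, ε), ((Prog.grow r).comp Prog.startE).val M (n, ε)) := rfl
    have e4 : ∀ (c : Prog ((ℕ × ℝ) × (ℕ × ℝ)) Bool)
        (t e : Prog ((ℕ × ℝ) × (ℕ × ℝ)) (List (ℕ × List ℕ × ℝ))) (γ : (ℕ × ℝ) × (ℕ × ℝ)),
        (Prog.cond c t e).cost M w γ = 1 + c.cost M w γ +
          if c.val M γ = true then t.cost M w γ else e.cost M w γ := fun _ _ _ _ => rfl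
    rw [e2, e1, val_startE, e4]
    simp only [Prog.val_leE, Prog.val_realOne, Prog.val_mulE, Prog.val_comp, Prog.val_snd,
      Prog.val_fst]
    split
    · omega
    · have e3 : (Prog.exactE.comp Prog.fst).cost M w ((n, ε), (k, (k : ℝ))) =
          1 + Prog.exactE.cost M w (n, ε) := rfl
      omega
  have hbranch : (if 1 ≤ (k : ℝ) * ε then
      (Prog.loopE.comp Prog.argsE).cost M w ((n, ε), (k, (k : ℝ)))
        else Prog.exactE.cost M w (n, ε) + 1) ≤
      ((2 * X + 5 + 2) ^ d4 + (2 * X + 5 + (2 * X + 5 + 2) ^ d4 + 2) ^ d5) +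
        (X + 2) * (X + 1) + 1 := by
    split
    · obtain ⟨c4, c5⟩ := h4 M w H hG (2 * X + 5) (hX.mono hG hXX) _ hctx
      rw [val_argsE] at c5
      have c6 := h5 M w H hG (2 * X + 5 + (2 * X + 5 + 2) ^ d4) (hX.mono hG (by omega)) (by omega)
        ((k + (n + 8)) ^ 14) (le_trans c5.1.2 (by omega)) (params ε (k + (n + 8)))
        (Sized.mono hG c5.2 (by omega) (by omega))
      have e : (Prog.loopE.comp Prog.argsE).cost M w ((n, ε), (k, (k : ℝ))) =
          Prog.argsE.cost M w ((n, ε), (k, (k : ℝ))) +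
            Prog.loopE.cost M w (Prog.argsE.val M ((n, ε), (k, (k : ℝ)))) := rfl
      rw [e, val_argsE]
      omega
    · rename_i hcon
      have hack : ack r (n + 2) ≤ X + 2 := (g4.resolve_left hcon).trans hk
      have c4 := (hr M w H hG (n + 2) X hX (n, ε) ⟨by change n ≤ _; omega, hε⟩).1
      have := Nat.mul_le_mul_right (X + 1) hack
      omega
  beta_reduce
  omega

end DataExchange

theorem theorem2 :
    (∃ C : ℝ, 0 < C ∧ ∃ P : DataExchange.Algorithm,
      P.PolynomialTime DataExchange.CrossMonotonicMarket ∧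
      P.Approximates DataExchange.CrossMonotonicMarket (fun n _ => C * Real.log n)) ∧
    (∃ P : DataExchange.Algorithm,
      P.PolynomialTime DataExchange.SymmetricMarket ∧
      P.Approximates DataExchange.SymmetricMarket (fun _ ε => 1 + ε)) := by
  obtain ⟨r, d, hd⟩ := DataExchange.exists_hybridE_cost
  have hpoly : ∀ K, (DataExchange.Prog.hybridE r).PolynomialTime K := by
    intro K
    -- The bound `(X + 2) ^ d` is used at a parameter shifted by `1`, which covers the extra bit of
    -- `answers_bits`.
    refine ⟨(Polynomial.X + 3) ^ d, fun n M ε _ h0 h1 => ⟨?_, fun b hε hM => ?_⟩⟩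
    · refine (hd M _ _ DataExchange.gauge_unit (n + ⌈1 / ε⌉₊ + 1)
        ⟨fun _ _ => trivial, fun _ _ _ => trivial⟩ (by omega) ε h0 trivial
        (by omega)).trans (le_of_eq ?_)
      simp [add_assoc]
    · refine (hd M _ _ DataExchange.gauge_bits (n + ⌈1 / ε⌉₊ + b + 1)
        ((DataExchange.answers_bits hM).mono DataExchange.gauge_bits (by omega)) (by omega) ε h0
        (hε.fracBits.mono (by omega)) (by omega)).trans (le_of_eq ?_)
      simp [add_assoc]
  exact ⟨⟨48, by norm_num, DataExchange.Prog.hybridE r, hpoly _,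
      DataExchange.hybridE_approximates_crossMonotonic r⟩,
    DataExchange.Prog.hybridE r, hpoly _, DataExchange.hybridE_approximates_symmetric r⟩
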